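/- Write $\mathfrak M(0,\infty)$ for the finite Borel measures on $(0,\infty)$ with the topology of weak convergence; identify $\mu\in\mathfrak M(0,\infty)$ with its distribution function $\mu(x)=\mu((0,x])$ (so that $\mathfrak M(0,\infty)$ is identified with the set $\mathfrak D(0,\infty)$ of bounded, nonnegative, right-continuous, increasing functions on $\mathbb R$ vanishing on $(-\infty,0]$), and put $\mu(\infty)=\mu((0,\infty))$ and $\langle\mu,f\rangle=\int_{(0,\infty)}f\,d\mu$. Let $C^1(0,\infty)^+$ be the set of nonnegative bounded continuous functions on $(0,\infty)$ with bounded continuous derivative. Functions on $(0,\infty)$ are extended by $0$ to $[-\infty,\infty]\setminus(0,\infty)$. Let $\alpha\in C^1(0,\infty)^+$, and for each $x>0$ let $\{p(x,i):i\in\mathbb N\}$, $\mathbb N=\{0,1,2,\dots\}$, be a probability distribution with $p(\cdot,i)\in C^1(0,\infty)^+$ for every $i$ and $\sup_{x>0}\sum_{i}i\,p(x,i)<\infty$. Put $\beta=\sup_{x>0}\alpha(x)\sum_i i\,p(x,i)$. Let $G$ be a Borel probability measure on $(0,\infty)$. For a finite measure $\mu$ on $[0,\infty)$ and $0\le y\le1$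 let $$A_\alpha(\mu,y)=\inf\{z\ge0:\langle\mu,\alpha1_{(0,z]}\rangle>\langle\mu,\alpha\rangle y\},\qquad \inf\emptyset=\infty .$$ Let $(\Omega,\mathscr F,(\mathscr F_t)_{t\ge0},\mathbf P)$ be a filtered probability space satisfying the usual hypotheses, let $E=(0,1]\times\mathbb N\times(0,\infty)^{\infty}$ with points $w=(y,n,z)$, $z=(z_1,z_2,\dots)$, and let $M(ds,du,dw,dv)$ be an $(\mathscr F_t)$-Poisson random measure on $(0,\infty)^2\times E\times(0,1]$ with intensity $ds\,du\,K(dw)\,dv$, where $K(dw)=dy\,\pi(dn)\,G^{\infty}(dz)$, $\pi$ is the counting measure on $\mathbb N$ and $G^\infty$ the infinite product measure. Let $X_0$ be an $\mathscr F_0$-measurable random element of $\mathfrak M(0,\infty)$. Consider the equation $$X_t(x)=X_0(x+t)-X_0(t)+\int_0^t\!\int_0^{\langle X_{s-},\alpha\rangle}\!\int_E\int_0^{p(A_\alpha(X_{s-},y),n)}\sum_{i=1}^n1_{\{0<z_i-(t-s)\le x\}}\,M(ds,du,dw,dv),\qquad x>0. \tag{$*$}$$ For a stopping time $\zeta$ with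 values in $[0,\infty]$, a solution with lifetime $\zeta$ is an $(\mathscr F_t)$-adapted $\mathfrak M(0,\infty)$-valued process $X$ such that almost surely $t\mapsto X_t$ is càdlàg on $[0,\zeta)$ (left limits $X_{s-}$ being taken in the sense of weak convergence of finite measures on $[0,\infty)$, so that they may charge $0$) and $(*)$ holds for all $t\in[0,\zeta)$ and $x>0$. It is a strong solution if it is adapted to the $\mathbf P$-completed filtration generated by $X_0$ and $M$, i.e. $X_t$ is measurable with respect to the $\sigma$-algebra generated by $X_0$, by $M$ restricted to times $\le t$, and by the $\mathbf P$-null sets. Then: 1. There is a strong solution $X$ of $(*)$ with lifetime $\zeta=\infty$. Almost surely, for every $t\ge0$ only finitely many points $(s,u,(y,n,z),v)$ of $M$ satisfy $0<s\le t$, $u\le\langle X_{s-},\alpha\rangle$ and $v\le p(A_\alpha(X_{s-},y),n)$. Moreover, for all $t\ge0$, $$\mathbf E\Big[\sup_{0\le s\le t}X_s(\infty)\Big]\le\mathbf E[X_0(\infty)]\,e^{\beta t}$$ (the bound being trivial when $\mathbf E[X_0(\infty)]=\infty$). 2. Pathwise uniqueness holds: if $X$ and $Y$ are solutions of $(*)$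 with lifetimes $\zeta$ and $\eta$ (with the same $\mathscr F_t$, $M$ and $X_0$), then almost surely $X_t=Y_t$ for all $t<\zeta\wedge\eta$. -/

import Mathlib

open MeasureTheory ProbabilityTheory Set Filter Topology
open scoped NNReal ENNReal

noncomputable section

namespace AgeBranching

/-- `𝔐(0,∞)`: the finite Borel measures on `(0,∞)`, realised as the finite Borel measures on `ℝ`
that do not charge `(-∞,0]`. The subspace topology is that of weak convergence on `(0,∞)`. A measure
is identified with its distribution function, see `distrib`. -/
abbrev LifeMeasure : Type := {μ : FiniteMeasure ℝ // μ (Iic 0) = 0}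

/-- The distribution function `μ(x) = μ((0,x])`, which vanishes for `x ≤ 0`. -/
def distrib (μ : LifeMeasure) (x : ℝ) : ℝ≥0∞ := (μ.1 : Measure ℝ) (Ioc 0 x)

/-- The total mass `μ(∞)`. -/
def totalMass (μ : LifeMeasure) : ℝ≥0∞ := (μ.1 : Measure ℝ) univ

/-- `⟨ν,f⟩`, the integral of `f` over `(0,∞)`. It is also applied to left limits in time of paths
with values in `𝔐(0,∞)`; these may carry mass at `0` (particles that die at that very time), which
does not contribute. -/
def pairing (ν : FiniteMeasure ℝ) (f : ℝ → ℝ) : ℝ := ∫ x in Ioi 0, f x ∂(ν : Measure ℝ)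

/-- `A_α(ν,y) = inf {z ≥ 0 : ⟨ν, α 1_{(0,z]}⟩ > ⟨ν,α⟩ y}` in `[0,∞]`, with `inf ∅ = ∞`. -/
def parentLife (α : ℝ → ℝ) (ν : FiniteMeasure ℝ) (y : ℝ) : ℝ≥0∞ :=
  ⨅ (z : ℝ≥0) (_ : pairing ν α * y < pairing ν ((Ioc 0 (z : ℝ)).indicator α)), (z : ℝ≥0∞)

/-- `p(a,n)` for `a ∈ [0,∞]`, extended by zero outside `(0,∞)`. -/
def offspringProb (p : ℝ → ℕ → ℝ) (a : ℝ≥0∞) (n : ℕ) : ℝ :=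
  if 0 < a ∧ a < ⊤ then p a.toReal n else 0

/-- The class `C¹(0,∞)⁺` of nonnegative bounded continuous functions on `(0,∞)` with bounded
continuous derivative. -/
structure IsC1Plus (f : ℝ → ℝ) : Prop where
  contDiffOn : ContDiffOn ℝ 1 f (Ioi 0)
  nonneg : ∀ x, 0 < x → 0 ≤ f x
  bounded : ∃ C, ∀ x, 0 < x → f x ≤ C
  deriv_bounded : ∃ C, ∀ x, 0 < x → |deriv f x| ≤ C

/-- The mean offspring number `g'(x,1-) = ∑ i, i p(x,i)`. -/
def offspringMean (p : ℝ → ℕ → ℝ) (x : ℝ) : ℝ≥0∞ :=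
  ∑' i : ℕ, (i : ℝ≥0∞) * ENNReal.ofReal (p x i)

/-- The assumptions on the birth rate `α` and on the offspring laws `p(x,·)`. -/
structure IsBranchingMechanism (α : ℝ → ℝ) (p : ℝ → ℕ → ℝ) : Prop where
  rate : IsC1Plus α
  prob : ∀ i, IsC1Plus fun x => p x i
  prob_sum : ∀ x, 0 < x → HasSum (p x) 1
  mean_bounded : (⨆ x ∈ Ioi (0 : ℝ), offspringMean p x) < ⊤

/-- `β = ‖α g'(·,1-)‖`. -/
def growthRate (α : ℝ → ℝ) (p : ℝ → ℕ → ℝ) : ℝ≥0∞ :=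
  ⨆ x ∈ Ioi (0 : ℝ), ENNReal.ofReal (α x) * offspringMean p x

/-- Points `w = (y,n,z)` of `E = (0,1] × ℕ × (0,∞)^∞`; the constraints are carried by
`markMeasure`, and the coordinates `z_1, z_2, …` are indexed from `0`. -/
abbrev Mark : Type := ℝ × ℕ × (ℕ → ℝ)

/-- Points `(s,u,w,v)` of `(0,∞)² × E × (0,1]`; the constraints are carried by `intensity`. -/
abbrev NoisePoint : Type := ℝ × ℝ × Mark × ℝ

/-- `K(dw) = dy π(dn) G^∞(dz)`, with `π` the counting measure. -/
def markMeasure (G : Measure ℝ) [IsProbabilityMeasure G] : Measure Mark :=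
  (volume.restrict (Ioc (0 : ℝ) 1)).prod
    ((Measure.count : Measure ℕ).prod (Measure.infinitePi fun _ : ℕ => G))

/-- The intensity `ds du K(dw) dv` on `(0,∞)² × E × (0,1]`. -/
def intensity (G : Measure ℝ) [IsProbabilityMeasure G] : Measure NoisePoint :=
  (volume.restrict (Ioi (0 : ℝ))).prod
    ((volume.restrict (Ioi (0 : ℝ))).prod
      ((markMeasure G).prod (volume.restrict (Ioc (0 : ℝ) 1))))

/-- The σ-algebra generated by the noise at times in `I`. -/
@[reducible] def noiseSigma {Ω : Type*} (M : Ω → Measure NoisePoint) (I : Set ℝ) : MeasurableSpace Ω :=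
  ⨆ (B : Set NoisePoint) (_ : MeasurableSet B ∧ B ⊆ {q | q.1 ∈ I}),
    MeasurableSpace.comap (fun ω => M ω B) inferInstance

/-- The usual hypotheses: the filtration is right-continuous and its initial σ-algebra contains all
subsets of null sets. -/
structure UsualHypotheses {Ω : Type*} {mΩ : MeasurableSpace Ω} (P : Measure Ω)
    (F : Filtration ℝ≥0 mΩ) : Prop where
  rightCont : F.IsRightContinuous
  complete : ∀ N : Set Ω, P N = 0 → MeasurableSet[F 0] N

/-- `M` is an `(F_t)`-Poisson random measure with intensity `Λ`; the first coordinate is time. -/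
structure IsPoissonRandomMeasure {Ω : Type*} {mΩ : MeasurableSpace Ω} (P : Measure Ω)
    (F : Filtration ℝ≥0 mΩ) (Λ : Measure NoisePoint) (M : Ω → Measure NoisePoint) : Prop where
  measurable : Measurable M
  integer_valued : ∀ ω B, MeasurableSet B → ∃ k : ℕ∞, M ω B = (k : ℝ≥0∞)
  law : ∀ B, MeasurableSet B → Λ B < ⊤ →
    P.map (fun ω => M ω B) = (poissonMeasure (Λ B).toNNReal).map (fun k : ℕ => (k : ℝ≥0∞))
  indep : ∀ (n : ℕ) (B : Fin n → Set NoisePoint), (∀ i, MeasurableSet (B i)) →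
    Pairwise (Function.onFun Disjoint B) → iIndepFun (fun i ω => M ω (B i)) P
  adapted : ∀ t : ℝ≥0, noiseSigma M (Iic (t : ℝ)) ≤ F t
  indep_past : ∀ t : ℝ≥0, Indep (noiseSigma M (Ioi (t : ℝ))) (F t) P

/-- `X_{s-}`, the left limit of a path in the space of finite measures on `ℝ` with the topology of
weak convergence. -/
def leftLimit (X : ℝ≥0 → LifeMeasure) (s : ℝ≥0) : FiniteMeasure ℝ :=
  Function.leftLim (fun r => (X r).1) s

/-- The points `(s,u,(y,n,z),v)` with `0 < s ≤ t`, `0 < u ≤ ⟨X_{s-},α⟩` and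
`0 < v ≤ p(A_α(X_{s-},y),n)`: the domain of integration up to time `t`, i.e. the reproduction events
of the path `X`. -/
def birthEvents (α : ℝ → ℝ) (p : ℝ → ℕ → ℝ) (X : ℝ≥0 → LifeMeasure) (t : ℝ≥0) :
    Set NoisePoint :=
  {q | q.1 ∈ Ioc 0 (t : ℝ) ∧
    q.2.1 ∈ Ioc 0 (pairing (leftLimit X q.1.toNNReal) α) ∧
    q.2.2.2 ∈ Ioc 0
      (offspringProb p (parentLife α (leftLimit X q.1.toNNReal) q.2.2.1.1) q.2.2.1.2.1)}

/-- `∑_{i=1}^n 1_{0 < z_i - (t-s) ≤ x}` for the point `(s,u,(y,n,z),v)`. -/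
def aliveOffspring (t : ℝ≥0) (x : ℝ) (q : NoisePoint) : ℝ≥0∞ :=
  ∑ i ∈ Finset.range q.2.2.1.2.1, (Ioc 0 x).indicator 1 (q.2.2.1.2.2 i - ((t : ℝ) - q.1))

/-- The stochastic integral equation at time `t` for one realisation `N` of the noise, one initial
value `μ` and one path `X`:
`X_t(x) = μ(x+t) - μ(t) + ∫ ∑_{i=1}^n 1_{0 < z_i - (t-s) ≤ x} N(ds,du,dw,dv)` for all `x > 0`,
the integral being over `birthEvents`. It is an identity in `[0,∞]` whose left side is finite. -/
def SolvesAt (α : ℝ → ℝ) (p : ℝ → ℕ → ℝ) (N : Measure NoisePoint) (μ : LifeMeasure)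
    (X : ℝ≥0 → LifeMeasure) (t : ℝ≥0) : Prop :=
  ∀ x : ℝ, 0 < x →
    distrib (X t) x = (distrib μ (x + t) - distrib μ t) +
      ∫⁻ q, (birthEvents α p X t).indicator (aliveOffspring t x) q ∂N

/-- The path is right-continuous at `t` and has a left limit at `t`. The left limit is taken
among finite measures on `ℝ`, because it has mass at `0` when particles die at time `t`. -/
def CadlagAt (X : ℝ≥0 → LifeMeasure) (t : ℝ≥0) : Prop :=
  ContinuousWithinAt X (Ici t) t ∧
    ∃ ν : FiniteMeasure ℝ, Tendsto (fun r => (X r).1) (𝓝[<] t) (𝓝 ν)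

/-- `X` is an `(F_t)`-adapted càdlàg solution on the random time interval `[0,ζ)`, where the
lifetime `ζ` is a stopping time with values in `[0,∞]`. The values of `X` from time `ζ` on are
irrelevant. -/
structure IsSolution {Ω : Type*} {mΩ : MeasurableSpace Ω} (P : Measure Ω)
    (F : Filtration ℝ≥0 mΩ) (α : ℝ → ℝ) (p : ℝ → ℕ → ℝ) (M : Ω → Measure NoisePoint)
    (X₀ : Ω → LifeMeasure) (X : ℝ≥0 → Ω → LifeMeasure) (ζ : Ω → WithTop ℝ≥0) : Prop where
  lifetime : IsStoppingTime F ζ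
  adapted : ∀ t, Measurable[F t] (X t)
  cadlag : ∀ᵐ ω ∂P, ∀ t : ℝ≥0, (t : WithTop ℝ≥0) < ζ ω → CadlagAt (fun r => X r ω) t
  equation : ∀ᵐ ω ∂P, ∀ t : ℝ≥0, (t : WithTop ℝ≥0) < ζ ω →
    SolvesAt α p (M ω) (X₀ ω) (fun r => X r ω) t

/-- The σ-algebra generated by the initial value, the noise up to time `t` and the null sets. -/
@[reducible] def drivingSigma {Ω : Type*} {mΩ : MeasurableSpace Ω} (P : Measure Ω)
    (M : Ω → Measure NoisePoint) (X₀ : Ω → LifeMeasure) (t : ℝ≥0) : MeasurableSpace Ω :=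
  MeasurableSpace.comap X₀ inferInstance ⊔ noiseSigma M (Iic (t : ℝ)) ⊔
    MeasurableSpace.generateFrom {N | P N = 0}

/-- A strong solution is one adapted to the completed filtration generated by the initial value and
the noise. -/
structure IsStrongSolution {Ω : Type*} {mΩ : MeasurableSpace Ω} (P : Measure Ω)
    (F : Filtration ℝ≥0 mΩ) (α : ℝ → ℝ) (p : ℝ → ℕ → ℝ) (M : Ω → Measure NoisePoint)
    (X₀ : Ω → LifeMeasure) (X : ℝ≥0 → Ω → LifeMeasure) (ζ : Ω → WithTop ℝ≥0) : Prop
    extends IsSolution P F α p M X₀ X ζ where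
  strong : ∀ t, Measurable[drivingSigma P M X₀ t] (X t)

end AgeBranching

end

/-!
The points of `M` in a predictable set `D ⊆ Ω × NoisePoint` have expected number (or expected
offspring) equal to the expected intensity of the sections of `D`: for predictable rectangles this
holds because `M` after time `s` is independent of `F s`, and these form a π-system. Left limits of
adapted càdlàg paths are predictable, so births come at rate at most `β` times the current mass.

Stop reproduction above a mass level `K`. Then the event rate is bounded, only finitely many events
occur in finite time, and each event set determines a càdlàg path. Picard iterates of this map
differ up to time `t` only if some event lies in the symmetric difference of the event sets of their
predecessors; the probability of this is at most `∫₀ᵗ c P(predecessors differ before s) ds`, which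
is summable after iteration. Hence the iterates are almost surely eventually constant and their
eventual value solves the truncated equation.

Grönwall's inequality bounds the expected progeny uniformly in `K`, so on `{X₀(∞) ≤ m}` Markov's
inequality excludes that every level is reached before a given time; the truncated solutions are
then eventually constant in `K`. Uniqueness is pathwise: two solutions agree at the first time at
which they could differ, and no event of either follows immediately.
-/

noncomputable section

namespace AgeBranching

theorem tendsto_measure_Iic_nhdsGT (ρ : Measure ℝ) [IsFiniteMeasure ρ] (a : ℝ) :
    Tendsto (fun b => ρ (Iic b)) (𝓝[>] a) (𝓝 (ρ (Iic a))) := by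
  have hInter : ⋂ b > a, Iic b = Iic a := by
    ext x
    simp only [mem_iInter, mem_Iic]
    exact ⟨le_of_forall_gt_imp_ge_of_dense, fun hx b hb => hx.trans hb.le⟩
  rw [← hInter]
  exact tendsto_measure_biInter_gt (fun _ _ => measurableSet_Iic.nullMeasurableSet)
    (fun _ _ _ hij => Iic_subset_Iic.2 hij) ⟨a + 1, lt_add_one a, measure_ne_top _ _⟩

theorem tendsto_measure_Iic_atBot (ρ : Measure ℝ) [IsFiniteMeasure ρ] :
    Tendsto (fun a => ρ (Iic a)) atBot (𝓝 0) := by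
  have hInter : ⋂ a : ℝ, Iic a = ∅ := iInter_Iic_eq_empty_iff.2 (by simp)
  simpa only [hInter, measure_empty, Function.comp_def] using
    tendsto_measure_iInter_atBot (μ := ρ) (fun _ => measurableSet_Iic.nullMeasurableSet)
      (fun _ _ hab => Iic_subset_Iic.2 hab) ⟨0, measure_ne_top ρ _⟩

theorem measure_Iic_zero (μ : LifeMeasure) : (μ.1 : Measure ℝ) (Iic 0) = 0 :=
  (FiniteMeasure.null_iff_toMeasure_null _ _).1 μ.2

theorem measure_Iic_eq_distrib (μ : LifeMeasure) (x : ℝ) :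
    (μ.1 : Measure ℝ) (Iic x) = distrib μ x := by
  refine le_antisymm ?_ (measure_mono Ioc_subset_Iic_self)
  calc (μ.1 : Measure ℝ) (Iic x) ≤ (μ.1 : Measure ℝ) (Iic 0 ∪ Ioc 0 x) :=
        measure_mono fun y hy => (le_or_gt y 0).imp id fun h => ⟨h, hy⟩
    _ ≤ (μ.1 : Measure ℝ) (Iic 0) + distrib μ x := measure_union_le _ _
    _ = distrib μ x := by rw [measure_Iic_zero, zero_add]

theorem distrib_ext {μ ν : LifeMeasure} (h : ∀ x, 0 < x → distrib μ x = distrib ν x) : μ = ν := by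
  refine Subtype.ext (Subtype.ext ?_)
  change (μ.1 : Measure ℝ) = (ν.1 : Measure ℝ)
  refine Measure.ext_of_Iic _ _ fun x => ?_
  rw [measure_Iic_eq_distrib, measure_Iic_eq_distrib]
  rcases le_or_gt x 0 with hx | hx
  · simp only [distrib, Ioc_eq_empty (not_lt.2 hx), measure_empty]
  · exact h x hx

section WeakLimits

/-- The upper limit of the distribution functions of a sequence of finite measures, set to zero if
the total masses are unbounded. -/
def limsupDistrib (ν : ℕ → FiniteMeasure ℝ) (a : ℝ) : ℝ :=
  if limsup (fun n => (ν n : Measure ℝ) univ) atTop = ⊤ then 0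
  else (limsup (fun n => (ν n : Measure ℝ) (Iic a)) atTop).toReal

theorem limsup_measure_Iic_le_limsup_mass (ν : ℕ → FiniteMeasure ℝ) (a : ℝ) :
    limsup (fun n => (ν n : Measure ℝ) (Iic a)) atTop ≤
      limsup (fun n => (ν n : Measure ℝ) univ) atTop :=
  limsup_le_limsup (Eventually.of_forall fun _ => measure_mono (subset_univ _))

theorem monotone_limsupDistrib (ν : ℕ → FiniteMeasure ℝ) : Monotone (limsupDistrib ν) := by
  intro a b hab
  unfold limsupDistrib
  split_ifs with h
  · exact le_rfl
  · exact ENNReal.toReal_mono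
      (ne_top_of_le_ne_top h (limsup_measure_Iic_le_limsup_mass ν b))
      (limsup_le_limsup (Eventually.of_forall fun _ => measure_mono (Iic_subset_Iic.2 hab)))

theorem limsupDistrib_mem_Icc (ν : ℕ → FiniteMeasure ℝ) (a : ℝ) :
    limsupDistrib ν a ∈ Icc 0 (limsup (fun n => (ν n : Measure ℝ) univ) atTop).toReal := by
  unfold limsupDistrib
  split_ifs with h
  · exact ⟨le_rfl, ENNReal.toReal_nonneg⟩
  · exact ⟨ENNReal.toReal_nonneg, ENNReal.toReal_mono h (limsup_measure_Iic_le_limsup_mass ν a)⟩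

/-- The right-continuous modification of `limsupDistrib`. -/
def limsupStieltjes (ν : ℕ → FiniteMeasure ℝ) : StieltjesFunction ℝ :=
  (monotone_limsupDistrib ν).stieltjesFunction

theorem tendsto_limsupDistrib_nhdsGT (ν : ℕ → FiniteMeasure ℝ) (a : ℝ) :
    Tendsto (limsupDistrib ν) (𝓝[>] a) (𝓝 (limsupStieltjes ν a)) :=
  (monotone_limsupDistrib ν).tendsto_rightLim a

theorem limsupStieltjes_mem_Icc (ν : ℕ → FiniteMeasure ℝ) (a : ℝ) :
    limsupStieltjes ν a ∈ Icc 0 (limsup (fun n => (ν n : Measure ℝ) univ) atTop).toReal :=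
  isClosed_Icc.mem_of_tendsto (tendsto_limsupDistrib_nhdsGT ν a)
    (Eventually.of_forall (limsupDistrib_mem_Icc ν))

instance isFiniteMeasure_limsupStieltjes (ν : ℕ → FiniteMeasure ℝ) :
    IsFiniteMeasure (limsupStieltjes ν).measure := by
  have hbelow : BddBelow (range (limsupStieltjes ν)) :=
    ⟨0, forall_mem_range.2 fun a => (limsupStieltjes_mem_Icc ν a).1⟩
  have habove : BddAbove (range (limsupStieltjes ν)) :=
    ⟨_, forall_mem_range.2 fun a => (limsupStieltjes_mem_Icc ν a).2⟩
  exact (limsupStieltjes ν).isFiniteMeasure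
    (tendsto_atBot_ciInf (limsupStieltjes ν).mono hbelow)
    (tendsto_atTop_ciSup (limsupStieltjes ν).mono habove)

/-- A finite measure attached to every sequence of finite measures on the line, whether convergent
or not, that depends measurably on the sequence and is its weak limit whenever there is one. It
replaces left limits of paths, which need not exist at the end of their lifetime. -/
def limsupMeasure (ν : ℕ → FiniteMeasure ℝ) : FiniteMeasure ℝ :=
  ⟨(limsupStieltjes ν).measure, inferInstance⟩

theorem measure_Iic_le_limsup_of_tendsto {ν : ℕ → FiniteMeasure ℝ} {ρ : FiniteMeasure ℝ}
    (h : Tendsto ν atTop (𝓝 ρ)) {a b : ℝ} (hab : a < b) :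
    (ρ : Measure ℝ) (Iic a) ≤ limsup (fun n => (ν n : Measure ℝ) (Iic b)) atTop := by
  have hδ : 0 < b - a := sub_pos.2 hab
  let f := thickenedIndicator hδ (Iic a)
  have hf_le : ∀ x, (f x : ℝ≥0∞) ≤ (Iic b).indicator 1 x := by
    intro x
    by_cases hx : x ≤ b
    · rw [indicator_of_mem (mem_Iic.2 hx)]
      exact ENNReal.coe_le_one_iff.2 (thickenedIndicator_le_one hδ (Iic a) x)
    · have hfx : f x = 0 := by
        refine thickenedIndicator_zero hδ (Iic a) fun hmem => hx ?_
        obtain ⟨y, hy, hxy⟩ := Metric.mem_thickening_iff.1 hmem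
        linarith [(abs_lt.1 (Real.dist_eq x y ▸ hxy)).2, mem_Iic.1 hy]
      rw [hfx, ENNReal.coe_zero]
      exact zero_le
  calc (ρ : Measure ℝ) (Iic a) ≤ ∫⁻ x, f x ∂(ρ : Measure ℝ) :=
        measure_le_lintegral_thickenedIndicator _ measurableSet_Iic hδ
    _ = limsup (fun n => ∫⁻ x, f x ∂(ν n : Measure ℝ)) atTop :=
        ((FiniteMeasure.tendsto_iff_forall_lintegral_tendsto.1 h f).limsup_eq).symm
    _ ≤ limsup (fun n => (ν n : Measure ℝ) (Iic b)) atTop := by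
        refine limsup_le_limsup (Eventually.of_forall fun n => ?_)
        exact (lintegral_mono hf_le).trans (lintegral_indicator_one measurableSet_Iic).le

theorem limsupStieltjes_eq_of_tendsto {ν : ℕ → FiniteMeasure ℝ} {ρ : FiniteMeasure ℝ}
    (h : Tendsto ν atTop (𝓝 ρ)) (a : ℝ) :
    limsupStieltjes ν a = ((ρ : Measure ℝ) (Iic a)).toReal := by
  have hmass : limsup (fun n => (ν n : Measure ℝ) univ) atTop ≠ ⊤ :=
    ne_top_of_le_ne_top (measure_ne_top _ _)
      (FiniteMeasure.limsup_measure_closed_le_of_tendsto h isClosed_univ)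
  have hupper : ∀ b, limsup (fun n => (ν n : Measure ℝ) (Iic b)) atTop ≤ (ρ : Measure ℝ) (Iic b) :=
    fun b => FiniteMeasure.limsup_measure_closed_le_of_tendsto h isClosed_Iic
  have hD : ∀ b, limsupDistrib ν b =
      (limsup (fun n => (ν n : Measure ℝ) (Iic b)) atTop).toReal := fun b => if_neg hmass
  refine tendsto_nhds_unique (tendsto_limsupDistrib_nhdsGT ν a) ?_
  refine tendsto_of_tendsto_of_tendsto_of_le_of_le' tendsto_const_nhds
    ((ENNReal.tendsto_toReal (measure_ne_top _ _)).comp (tendsto_measure_Iic_nhdsGT ρ a)) ?_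
    (Eventually.of_forall fun b => ?_)
  · filter_upwards [self_mem_nhdsWithin] with b hb
    rw [hD]
    exact ENNReal.toReal_mono (ne_top_of_le_ne_top (measure_ne_top _ _) (hupper b))
      (measure_Iic_le_limsup_of_tendsto h hb)
  · rw [hD]
    exact ENNReal.toReal_mono (measure_ne_top _ _) (hupper b)

theorem limsupMeasure_eq_of_tendsto {ν : ℕ → FiniteMeasure ℝ} {ρ : FiniteMeasure ℝ}
    (h : Tendsto ν atTop (𝓝 ρ)) : limsupMeasure ν = ρ := by
  have hbot : Tendsto (limsupStieltjes ν) atBot (𝓝 0) := by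
    rw [funext (limsupStieltjes_eq_of_tendsto h)]
    exact (ENNReal.tendsto_toReal ENNReal.zero_ne_top).comp (tendsto_measure_Iic_atBot _)
  refine Subtype.ext ?_
  change (limsupStieltjes ν).measure = (ρ : Measure ℝ)
  refine Measure.ext_of_Iic _ _ fun a => ?_
  rw [StieltjesFunction.measure_Iic _ hbot, sub_zero, limsupStieltjes_eq_of_tendsto h,
    ENNReal.ofReal_toReal (measure_ne_top _ _)]

theorem measurable_finiteMeasure_apply {E : Type*} [MeasurableSpace E] {s : Set E}
    (hs : MeasurableSet s) : Measurable fun ν : FiniteMeasure E => (ν : Measure E) s :=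
  (Measure.measurable_coe hs).comp measurable_subtype_coe

theorem measurable_limsupStieltjes {X : Type*} [MeasurableSpace X] {ν : ℕ → X → FiniteMeasure ℝ}
    (hν : ∀ n, Measurable (ν n)) (a : ℝ) :
    Measurable fun x => limsupStieltjes (fun n => ν n x) a := by
  have hmeas : ∀ {s : Set ℝ}, MeasurableSet s →
      Measurable fun x => limsup (fun n => (ν n x : Measure ℝ) s) atTop := fun hs =>
    Measurable.limsup fun n => (measurable_finiteMeasure_apply hs).comp (hν n)
  have hD : ∀ b, Measurable fun x => limsupDistrib (fun n => ν n x) b := fun b =>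
    Measurable.ite (measurableSet_eq_fun (hmeas MeasurableSet.univ) measurable_const)
      measurable_const (hmeas measurableSet_Iic).ennreal_toReal
  exact measurable_of_tendsto_metrizable' (𝓝[>] a) hD
    (tendsto_pi_nhds.2 fun x => tendsto_limsupDistrib_nhdsGT (fun n => ν n x) a)

theorem measurable_limsupMeasure {X : Type*} [MeasurableSpace X] {ν : ℕ → X → FiniteMeasure ℝ}
    (hν : ∀ n, Measurable (ν n)) : Measurable fun x => limsupMeasure fun n => ν n x := by
  have hIoc : ∀ a b : ℝ,
      Measurable fun x => (limsupStieltjes fun n => ν n x).measure (Ioc a b) := by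
    intro a b
    simp_rw [StieltjesFunction.measure_Ioc]
    exact ((measurable_limsupStieltjes hν b).sub (measurable_limsupStieltjes hν a)).ennreal_ofReal
  refine Measurable.subtype_mk (Measurable.measure_of_isPiSystem
    (borel_eq_generateFrom_Ioc ℝ ▸ BorelSpace.measurable_eq) (isPiSystem_Ioc id id) ?_ ?_)
  · rintro s ⟨a, b, _, rfl⟩
    exact hIoc a b
  · have hUnion : (univ : Set ℝ) = ⋃ n : ℕ, Ioc (-(n : ℝ)) n := by
      refine (eq_univ_of_forall fun x => ?_).symm
      obtain ⟨n, hn⟩ := exists_nat_gt |x|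
      exact mem_iUnion.2 ⟨n, (abs_lt.1 hn).1, (abs_lt.1 hn).2.le⟩
    have hmono : Monotone fun n : ℕ => Ioc (-(n : ℝ)) n := fun m n hmn =>
      Ioc_subset_Ioc (neg_le_neg (Nat.cast_le.2 hmn)) (Nat.cast_le.2 hmn)
    simp_rw [hUnion, hmono.measure_iUnion]
    exact Measurable.iSup fun n => hIoc _ _

end WeakLimits

section ResidualLives

theorem tendsto_map_restrict {ι E X : Type*} [MeasurableSpace E] [TopologicalSpace X]
    [MeasurableSpace X] [BorelSpace X] {l : Filter ι} [l.IsCountablyGenerated] {B : Measure E}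
    {S : Set E} (hBS : B S ≠ ⊤) {g : ι → E → X} {g' : E → X}
    (hg : ∀ i, Measurable (g i)) (hg' : Measurable g') {D : ι → Set E} {D' : Set E}
    (hD : ∀ i, MeasurableSet (D i)) (hD' : MeasurableSet D') (hDS : ∀ᶠ i in l, D i ⊆ S)
    (hDS' : D' ⊆ S) (hlim : ∀ b, Tendsto (fun i => g i b) l (𝓝 (g' b)))
    (hmem : ∀ b, ∀ᶠ i in l, (b ∈ D i ↔ b ∈ D')) {ν : ι → FiniteMeasure X} {ρ : FiniteMeasure X}
    (hν : ∀ i, (ν i : Measure X) = (B.restrict (D i)).map (g i))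
    (hρ : (ρ : Measure X) = (B.restrict D').map g') : Tendsto ν l (𝓝 ρ) := by
  have : IsFiniteMeasure (B.restrict S) := ⟨by rwa [Measure.restrict_apply_univ, lt_top_iff_ne_top]⟩
  rw [FiniteMeasure.tendsto_iff_forall_lintegral_tendsto]
  intro f
  have hf : Measurable fun x => (f x : ℝ≥0∞) := f.continuous.measurable.coe_nnreal_ennreal
  have hlintegral : ∀ {C : Set E} {k : E → X}, MeasurableSet C → C ⊆ S → Measurable k →
      ∫⁻ x, f x ∂((B.restrict C).map k) =
        ∫⁻ b, C.indicator (fun b => (f (k b) : ℝ≥0∞)) b ∂(B.restrict S) := by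
    intro C k hC hCS hk
    rw [lintegral_map hf hk, lintegral_indicator hC, Measure.restrict_restrict hC,
      inter_eq_left.2 hCS]
  have hcongr : (fun i => ∫⁻ b, (D i).indicator (fun b => (f (g i b) : ℝ≥0∞)) b ∂(B.restrict S))
      =ᶠ[l] fun i => ∫⁻ x, f x ∂(ν i : Measure X) := by
    filter_upwards [hDS] with i hi
    rw [hν, hlintegral (hD i) hi (hg i)]
  refine Tendsto.congr' hcongr ?_
  rw [hρ, hlintegral hD' hDS' hg']
  refine tendsto_lintegral_filter_of_dominated_convergence (fun _ => (nndist 0 f : ℝ≥0∞))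
    (Eventually.of_forall fun i => (hf.comp (hg i)).indicator (hD i))
    (Eventually.of_forall fun i => ae_of_all _ fun b => ?_) ?_ (ae_of_all _ fun b => ?_)
  · exact (indicator_le_self (D i) (fun b => (f (g i b) : ℝ≥0∞)) b).trans
      (ENNReal.coe_le_coe.2 (f.apply_le_nndist_zero _))
  · rw [lintegral_const]
    exact ENNReal.mul_ne_top ENNReal.coe_ne_top (measure_ne_top _ _)
  · have hfb : Tendsto (fun i => (f (g i b) : ℝ≥0∞)) l (𝓝 (f (g' b))) :=
      ENNReal.tendsto_coe.2 ((f.continuous.tendsto _).comp (hlim b))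
    by_cases hb : b ∈ D'
    · rw [indicator_of_mem hb]
      refine hfb.congr' ((hmem b).mono fun i hi => ?_)
      exact (indicator_of_mem (hi.2 hb) fun b => (f (g i b) : ℝ≥0∞)).symm
    · rw [indicator_of_notMem hb]
      refine tendsto_const_nhds.congr' ((hmem b).mono fun i hi => ?_)
      exact (indicator_of_notMem (mt hi.1 hb) fun b => (f (g i b) : ℝ≥0∞)).symm

/-- The individuals alive at time `t`, an individual being the pair of its birth and death times. -/
def aliveAt (t : ℝ) : Set (ℝ × ℝ) := {b | b.1 ≤ t ∧ t < b.2}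

/-- The individuals alive immediately before time `t`, including those that die at time `t`. -/
def aliveBefore (t : ℝ) : Set (ℝ × ℝ) := {b | b.1 < t ∧ t ≤ b.2}

theorem measurableSet_aliveAt (t : ℝ) : MeasurableSet (aliveAt t) :=
  (measurableSet_le measurable_fst measurable_const).inter
    (measurableSet_lt measurable_const measurable_snd)

theorem measurableSet_aliveBefore (t : ℝ) : MeasurableSet (aliveBefore t) :=
  (measurableSet_lt measurable_fst measurable_const).inter
    (measurableSet_le measurable_const measurable_snd)

theorem eventually_mem_aliveAt_iff_nhdsGE (b : ℝ × ℝ) (t : ℝ) :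
    ∀ᶠ r in 𝓝[≥] t, (b ∈ aliveAt r ↔ b ∈ aliveAt t) := by
  have hlt : ∀ c, t < c → ∀ᶠ r in 𝓝[≥] t, r < c := fun c hc =>
    mem_nhdsWithin_of_mem_nhds (Iio_mem_nhds hc)
  have hbirth : ∀ᶠ r in 𝓝[≥] t, (b.1 ≤ r ↔ b.1 ≤ t) := by
    rcases le_or_gt b.1 t with h | h
    · filter_upwards [self_mem_nhdsWithin] with r hr using iff_of_true (h.trans hr) h
    · filter_upwards [hlt _ h] with r hr using iff_of_false hr.not_ge h.not_ge
  have hdeath : ∀ᶠ r in 𝓝[≥] t, (r < b.2 ↔ t < b.2) := by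
    rcases lt_or_ge t b.2 with h | h
    · filter_upwards [hlt _ h] with r hr using iff_of_true hr h
    · filter_upwards [self_mem_nhdsWithin] with r hr using iff_of_false (h.trans hr).not_gt h.not_gt
  exact (hbirth.and hdeath).mono fun r hr => and_congr hr.1 hr.2

theorem eventually_mem_aliveAt_iff_nhdsLT (b : ℝ × ℝ) (t : ℝ) :
    ∀ᶠ r in 𝓝[<] t, (b ∈ aliveAt r ↔ b ∈ aliveBefore t) := by
  have hgt : ∀ c, c < t → ∀ᶠ r in 𝓝[<] t, c < r := fun c hc =>
    mem_nhdsWithin_of_mem_nhds (Ioi_mem_nhds hc)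
  have hbirth : ∀ᶠ r in 𝓝[<] t, (b.1 ≤ r ↔ b.1 < t) := by
    rcases lt_or_ge b.1 t with h | h
    · filter_upwards [hgt _ h] with r hr using iff_of_true hr.le h
    · filter_upwards [self_mem_nhdsWithin] with r hr
        using iff_of_false (lt_of_lt_of_le hr h).not_ge h.not_gt
  have hdeath : ∀ᶠ r in 𝓝[<] t, (r < b.2 ↔ t ≤ b.2) := by
    rcases le_or_gt t b.2 with h | h
    · filter_upwards [self_mem_nhdsWithin] with r hr using iff_of_true (lt_of_lt_of_le hr h) h
    · filter_upwards [hgt _ h] with r hr using iff_of_false hr.le.not_gt h.not_ge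
  exact (hbirth.and hdeath).mono fun r hr => and_congr hr.1 hr.2

/-- The distribution of the residual lives at time `t` in the population `B` of individuals. -/
def residualLives (B : Measure (ℝ × ℝ)) (t : ℝ) : Measure ℝ :=
  (B.restrict (aliveAt t)).map fun b => b.2 - t

theorem residualLives_apply (B : Measure (ℝ × ℝ)) (t : ℝ) {s : Set ℝ} (hs : MeasurableSet s) :
    residualLives B t s = B {b | b ∈ aliveAt t ∧ b.2 - t ∈ s} := by
  have hsub : Measurable fun b : ℝ × ℝ => b.2 - t := by fun_prop
  rw [residualLives, Measure.map_apply hsub hs, Measure.restrict_apply (hsub hs), inter_comm]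
  rfl

theorem residualLives_le (B : Measure (ℝ × ℝ)) (t : ℝ) (s : Set ℝ) :
    residualLives B t s ≤ B {b | b.1 ≤ t} := by
  refine (measure_mono (subset_univ s)).trans ?_
  rw [residualLives_apply _ _ MeasurableSet.univ]
  exact measure_mono fun b hb => hb.1.1

theorem residualLives_Iic_zero (B : Measure (ℝ × ℝ)) (t : ℝ) : residualLives B t (Iic 0) = 0 := by
  rw [residualLives_apply _ _ measurableSet_Iic]
  refine measure_mono_null (fun b hb => ?_) measure_empty
  exact (sub_pos.2 hb.1.2).not_ge hb.2

/-- The path of residual life distributions of a population with finitely many births in finite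
time. -/
def residualPath (B : Measure (ℝ × ℝ)) (hB : ∀ t : ℝ≥0, B {b | b.1 ≤ t} < ⊤) (t : ℝ≥0) :
    LifeMeasure :=
  ⟨⟨residualLives B t, ⟨(residualLives_le B t univ).trans_lt (hB t)⟩⟩,
    (FiniteMeasure.null_iff_toMeasure_null _ _).2 (residualLives_Iic_zero B t)⟩

theorem tendsto_residualPath {B : Measure (ℝ × ℝ)} (hB : ∀ t : ℝ≥0, B {b | b.1 ≤ t} < ⊤)
    {t : ℝ≥0} {l : Filter ℝ≥0} [l.IsCountablyGenerated] (hl : l ≤ 𝓝 t) {D : Set (ℝ × ℝ)}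
    (hD : MeasurableSet D) (hDt : ∀ b ∈ D, b.1 ≤ t)
    (hmem : ∀ b, ∀ᶠ r : ℝ≥0 in l, (b ∈ aliveAt r ↔ b ∈ D)) {ρ : FiniteMeasure ℝ}
    (hρ : (ρ : Measure ℝ) = (B.restrict D).map fun b => b.2 - (t : ℝ)) :
    Tendsto (fun r => (residualPath B hB r).1) l (𝓝 ρ) := by
  have hcoe : Tendsto (fun r : ℝ≥0 => (r : ℝ)) l (𝓝 (t : ℝ)) :=
    (NNReal.continuous_coe.tendsto t).mono_left hl
  have hbefore : ∀ᶠ r : ℝ≥0 in l, aliveAt r ⊆ {b | b.1 ≤ (t : ℝ) + 1} :=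
    (hcoe.eventually (gt_mem_nhds (lt_add_one (t : ℝ)))).mono fun r hr b hb => hb.1.trans hr.le
  exact tendsto_map_restrict (ι := ℝ≥0) (g := fun r b => b.2 - (r : ℝ)) (D := fun r => aliveAt r)
    (by simpa using (hB (t + 1)).ne) (fun r => by fun_prop) (by fun_prop)
    (fun r => measurableSet_aliveAt r) hD hbefore
    (fun b hb => (hDt b hb).trans (le_add_of_nonneg_right zero_le_one))
    (fun b => hcoe.const_sub b.2) hmem (fun r => rfl) hρ

theorem cadlagAt_residualPath (B : Measure (ℝ × ℝ)) (hB : ∀ t : ℝ≥0, B {b | b.1 ≤ t} < ⊤)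
    (t : ℝ≥0) : CadlagAt (residualPath B hB) t := by
  have hGE : Tendsto (fun r : ℝ≥0 => (r : ℝ)) (𝓝[≥] t) (𝓝[≥] (t : ℝ)) :=
    NNReal.continuous_coe.continuousWithinAt.tendsto_nhdsWithin fun _ => NNReal.coe_le_coe.2
  have hLT : Tendsto (fun r : ℝ≥0 => (r : ℝ)) (𝓝[<] t) (𝓝[<] (t : ℝ)) :=
    NNReal.continuous_coe.continuousWithinAt.tendsto_nhdsWithin fun _ => NNReal.coe_lt_coe.2
  have hfin : B (aliveBefore t) < ⊤ := (measure_mono fun b hb => hb.1.le).trans_lt (hB t)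
  have : IsFiniteMeasure (B.restrict (aliveBefore t)) :=
    ⟨by rwa [Measure.restrict_apply_univ]⟩
  constructor
  · rw [ContinuousWithinAt, tendsto_subtype_rng]
    exact tendsto_residualPath hB nhdsWithin_le_nhds (measurableSet_aliveAt t) (fun b hb => hb.1)
      (fun b => hGE.eventually (eventually_mem_aliveAt_iff_nhdsGE b t)) rfl
  · exact ⟨⟨(B.restrict (aliveBefore t)).map fun b => b.2 - t, inferInstance⟩,
      tendsto_residualPath hB nhdsWithin_le_nhds (measurableSet_aliveBefore t)
        (fun b hb => hb.1.le)
        (fun b => hLT.eventually (eventually_mem_aliveAt_iff_nhdsLT b t)) rfl⟩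

end ResidualLives

section LeftLimits

variable {X Y : ℝ≥0 → LifeMeasure} {s : ℝ≥0}

theorem nhdsLT_neBot_of_pos (hs : 0 < s) : (𝓝[<] s).NeBot :=
  nhdsLT_neBot_of_exists_lt ⟨0, hs⟩

theorem CadlagAt.tendsto_leftLimit (h : CadlagAt X s) (hs : 0 < s) :
    Tendsto (fun r => (X r).1) (𝓝[<] s) (𝓝 (leftLimit X s)) := by
  obtain ⟨ν, hν⟩ := h.2
  have := nhdsLT_neBot_of_pos hs
  rwa [leftLimit, leftLim_eq_of_tendsto hν]

theorem leftLimit_congr (hs : 0 < s) (hX : CadlagAt X s) (h : ∀ r < s, X r = Y r) :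
    leftLimit X s = leftLimit Y s := by
  have := nhdsLT_neBot_of_pos hs
  refine (leftLim_eq_of_tendsto ((hX.tendsto_leftLimit hs).congr' ?_)).symm
  filter_upwards [self_mem_nhdsWithin] with r hr
  rw [h r hr]

theorem mass_leftLimit_le (hs : 0 < s) (hX : CadlagAt X s) {K : ℝ≥0∞}
    (h : ∀ᶠ r in 𝓝[<] s, totalMass (X r) ≤ K) : (leftLimit X s : Measure ℝ) univ ≤ K := by
  have := nhdsLT_neBot_of_pos hs
  have hmass : Tendsto (fun r => ((X r).1.mass : ℝ≥0∞)) (𝓝[<] s) (𝓝 ((leftLimit X s).mass)) :=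
    ENNReal.tendsto_coe.2 ((FiniteMeasure.continuous_mass.tendsto _).comp (hX.tendsto_leftLimit hs))
  simp only [FiniteMeasure.ennreal_mass] at hmass
  exact le_of_tendsto hmass h

end LeftLimits

section Predictable

variable {Ω : Type*} {mΩ : MeasurableSpace Ω} (F : Filtration ℝ≥0 mΩ)

/-- The rectangles `A × B` with `A` known at a time `s` and `B` after time `s`; at `s = 0` there is
no constraint on `B`. -/
def predictableRectangles : Set (Set (Ω × NoisePoint)) :=
  {C | ∃ (s : ℝ≥0) (A : Set Ω) (B : Set NoisePoint), MeasurableSet[F s] A ∧ MeasurableSet B ∧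
    (∀ q ∈ B, s = 0 ∨ (s : ℝ) < q.1) ∧ C = A ×ˢ B}

/-- The predictable σ-algebra on `Ω × NoisePoint`. -/
@[reducible] def predictableSigma : MeasurableSpace (Ω × NoisePoint) :=
  MeasurableSpace.generateFrom (predictableRectangles F)

theorem isPiSystem_predictableRectangles : IsPiSystem (predictableRectangles F) := by
  rintro _ ⟨s, A, B, hA, hB, hs, rfl⟩ _ ⟨s', A', B', hA', hB', hs', rfl⟩ _
  refine ⟨max s s', A ∩ A', B ∩ B', ?_, hB.inter hB', ?_, prod_inter_prod⟩
  · exact (F.mono (le_max_left s s') _ hA).inter (F.mono (le_max_right s s') _ hA')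
  · rintro q ⟨hq, hq'⟩
    rcases le_total s s' with h | h
    · rw [max_eq_right h]
      exact hs' q hq'
    · rw [max_eq_left h]
      exact hs q hq

theorem predictableSigma_le :
    predictableSigma F ≤ (inferInstance : MeasurableSpace (Ω × NoisePoint)) := by
  refine MeasurableSpace.generateFrom_le ?_
  rintro _ ⟨s, A, B, hA, hB, -, rfl⟩
  exact (F.le s _ hA).prod hB

theorem prod_mem_predictableRectangles {A : Set Ω} {B : Set NoisePoint}
    (hA : MeasurableSet[F 0] A) (hB : MeasurableSet B) : A ×ˢ B ∈ predictableRectangles F :=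
  ⟨0, A, B, hA, hB, fun _ _ => Or.inl rfl, rfl⟩

theorem measurable_snd_predictable :
    Measurable[predictableSigma F] (Prod.snd : Ω × NoisePoint → NoisePoint) := fun B hB => by
  rw [← univ_prod]
  exact MeasurableSpace.measurableSet_generateFrom
    (prod_mem_predictableRectangles F MeasurableSet.univ hB)

theorem measurable_fst_predictable :
    Measurable[predictableSigma F, F 0] (Prod.fst : Ω × NoisePoint → Ω) := fun A hA => by
  rw [← prod_univ]
  exact MeasurableSpace.measurableSet_generateFrom
    (prod_mem_predictableRectangles F hA MeasurableSet.univ)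

theorem measurableSet_inter_time_le_of_predictable (t : ℝ≥0) {C : Set (Ω × NoisePoint)}
    (hC : MeasurableSet[predictableSigma F] C) :
    MeasurableSet[(F t).prod inferInstance] (C ∩ {x | x.2.1 ≤ t}) := by
  have hT : MeasurableSet[(F t).prod inferInstance] {x : Ω × NoisePoint | x.2.1 ≤ (t : ℝ)} :=
    (@measurable_snd Ω NoisePoint (F t) inferInstance)
      (measurableSet_le measurable_fst measurable_const)
  induction C, hC using MeasurableSpace.generateFrom_induction with
  | hC C hC _ =>
    obtain ⟨s, A, B, hA, hB, hs, rfl⟩ := hC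
    by_cases hst : s ≤ t
    · exact MeasurableSet.inter
        (@MeasurableSet.prod Ω NoisePoint (F t) inferInstance _ _ (F.mono hst _ hA) hB) hT
    · convert @MeasurableSet.empty _ ((F t).prod inferInstance)
      refine eq_empty_of_forall_notMem fun x ⟨⟨_, hq⟩, hqt⟩ => hst ?_
      rcases hs x.2 hq with h | h
      · exact h ▸ zero_le
      · exact NNReal.coe_le_coe.1 (h.trans_le hqt).le
  | empty => simp
  | compl C _ ih =>
    have hcompl : Cᶜ ∩ {x : Ω × NoisePoint | x.2.1 ≤ (t : ℝ)} =
        {x : Ω × NoisePoint | x.2.1 ≤ (t : ℝ)} \ (C ∩ {x | x.2.1 ≤ (t : ℝ)}) := by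
      rw [sdiff_inter_self_eq_sdiff, sdiff_eq, inter_comm]
    rw [hcompl]
    exact hT.diff ih
  | iUnion f _ ih =>
    rw [iUnion_inter]
    exact MeasurableSet.iUnion ih

end Predictable

section SpanningSets

variable {E : Type*} [MeasurableSpace E] (Λ : Measure E) [SigmaFinite Λ]

theorem iSup_measure_inter_spanningSets (N : Measure E) (B : Set E) :
    ⨆ n, N (B ∩ spanningSets Λ n) = N B := by
  have hmono : Monotone fun n => B ∩ spanningSets Λ n := fun _ _ hmn =>
    inter_subset_inter_right _ (monotone_spanningSets Λ hmn)
  rw [← hmono.measure_iUnion, ← inter_iUnion, iUnion_spanningSets, inter_univ]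

/-- Joint measurability of the sections needs σ-finiteness; it is supplied by a reference measure
whose spanning sets all have finite mass. -/
theorem measurable_map_prodMk {Ω : Type*} [MeasurableSpace Ω] {N : Ω → Measure E}
    (hN : Measurable N) (hfin : ∀ ω n, N ω (spanningSets Λ n) < ⊤) :
    Measurable fun ω => (N ω).map (Prod.mk ω) := by
  refine Measure.measurable_of_measurable_coe _ fun C hC => ?_
  have hsec : ∀ ω, MeasurableSet (Prod.mk ω ⁻¹' C : Set E) := fun ω => measurable_prodMk_left hC
  have hsup : ∀ ω, (N ω).map (Prod.mk ω) C = ⨆ n, N ω (Prod.mk ω ⁻¹' C ∩ spanningSets Λ n) :=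
    fun ω => by
      rw [Measure.map_apply measurable_prodMk_left hC, iSup_measure_inter_spanningSets]
  simp_rw [hsup]
  refine Measurable.iSup fun n => ?_
  let κ : Kernel Ω E :=
    ⟨fun ω => (N ω).restrict (spanningSets Λ n),
      Measure.measurable_of_measurable_coe _ fun B hB => by
        simp_rw [Measure.restrict_apply hB]
        exact (Measure.measurable_coe (hB.inter (measurableSet_spanningSets Λ n))).comp hN⟩
  have hκ : ∀ ω, IsFiniteMeasure (κ ω) := fun ω =>
    ⟨by simpa only [κ, Kernel.coe_mk, Measure.restrict_apply_univ] using hfin ω n⟩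
  simpa only [κ, Kernel.coe_mk, Measure.restrict_apply (hsec _)] using
    Kernel.measurable_kernel_prodMk_left_of_finite hC hκ

open Classical in
/-- A random measure, set to zero where it is infinite on some spanning set of `Λ`. -/
def regularize {Ω : Type*} (M : Ω → Measure E) (ω : Ω) : Measure E :=
  if ∀ n, M ω (spanningSets Λ n) < ⊤ then M ω else 0

theorem regularize_spanningSets_lt_top {Ω : Type*} (M : Ω → Measure E) (ω : Ω) (n : ℕ) :
    regularize Λ M ω (spanningSets Λ n) < ⊤ := by
  unfold regularize
  split_ifs with h
  · exact h n
  · exact ENNReal.zero_lt_top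

theorem measurable_regularize {Ω : Type*} [MeasurableSpace Ω] {M : Ω → Measure E}
    (hM : Measurable M) : Measurable (regularize Λ M) := by
  refine Measurable.ite ?_ hM measurable_const
  rw [ofPred_forall]
  exact MeasurableSet.iInter fun n => measurableSet_lt
    ((Measure.measurable_coe (measurableSet_spanningSets Λ n)).comp hM) measurable_const

end SpanningSets

section CompleteFiltration

variable {Ω : Type*} {mΩ : MeasurableSpace Ω} {P : Measure Ω} {F : Filtration ℝ≥0 mΩ}
  (hF : ∀ N : Set Ω, P N = 0 → MeasurableSet[F 0] N)

include hF

theorem measurableSet_of_ae_iff {t : ℝ≥0} {V W : Set Ω} (hW : MeasurableSet[F t] W)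
    (hVW : ∀ᵐ ω ∂P, ω ∈ W ↔ ω ∈ V) : MeasurableSet[F t] V := by
  have hnull : P {ω | ¬ (ω ∈ W ↔ ω ∈ V)} = 0 := ae_iff.1 hVW
  have hmeas : ∀ {N}, P N = 0 → MeasurableSet[F t] N := fun hN => F.mono zero_le _ (hF _ hN)
  have hV : V = (W \ {ω | ¬ (ω ∈ W ↔ ω ∈ V)}) ∪ (V ∩ {ω | ¬ (ω ∈ W ↔ ω ∈ V)}) := by
    ext ω
    simp only [mem_union, Set.mem_sdiff, mem_inter_iff, mem_ofPred_eq]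
    tauto
  rw [hV]
  exact (hW.diff (hmeas hnull)).union (hmeas (measure_mono_null inter_subset_right hnull))

theorem measurable_of_ae_eq {E : Type*} [MeasurableSpace E] {t : ℝ≥0} {f g : Ω → E}
    (hf : Measurable[F t] f) (hfg : ∀ᵐ ω ∂P, f ω = g ω) : Measurable[F t] g := fun B hB =>
  measurableSet_of_ae_iff hF (hf hB) (hfg.mono fun ω hω => by rw [mem_preimage, hω, mem_preimage])

end CompleteFiltration

section RandomMeasure

theorem lintegral_natCast_poissonMeasure (r : ℝ≥0) :
    ∫⁻ k : ℕ, (k : ℝ≥0∞) ∂(poissonMeasure r) = r := by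
  have hstep : ∀ n : ℕ, ((n + 1 : ℕ) : ℝ≥0∞) * poissonMeasure r {n + 1} =
      r * poissonMeasure r {n} := by
    intro n
    rw [poissonMeasure_singleton, poissonMeasure_singleton, ← ENNReal.ofReal_natCast,
      ← ENNReal.ofReal_coe_nnreal, ← ENNReal.ofReal_mul (Nat.cast_nonneg _),
      ← ENNReal.ofReal_mul r.coe_nonneg, Nat.factorial_succ]
    congr 1
    push_cast
    field_simp
    ring
  calc ∫⁻ k : ℕ, (k : ℝ≥0∞) ∂(poissonMeasure r)
      = ∑' n : ℕ, (n : ℝ≥0∞) * poissonMeasure r {n} := lintegral_countable' _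
    _ = ∑' n : ℕ, ((n + 1 : ℕ) : ℝ≥0∞) * poissonMeasure r {n + 1} := by
        rw [tsum_eq_zero_add' ENNReal.summable, Nat.cast_zero, zero_mul, zero_add]
    _ = r * ∑' n : ℕ, 1 * poissonMeasure r {n} := by
        simp_rw [hstep, ENNReal.tsum_mul_left, one_mul]
    _ = r := by rw [← lintegral_countable', lintegral_one, measure_univ, mul_one]

variable {Ω : Type*} {mΩ : MeasurableSpace Ω} {P : Measure Ω} {F : Filtration ℝ≥0 mΩ}
  {Λ : Measure NoisePoint} {M : Ω → Measure NoisePoint}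

namespace IsPoissonRandomMeasure

theorem measurable_apply (hM : IsPoissonRandomMeasure P F Λ M) {B : Set NoisePoint}
    (hB : MeasurableSet B) : Measurable fun ω => M ω B :=
  (Measure.measurable_coe hB).comp hM.measurable

theorem measurable_apply_of_subset_Iic (hM : IsPoissonRandomMeasure P F Λ M) (t : ℝ≥0)
    {B : Set NoisePoint} (hB : MeasurableSet B) (hBt : B ⊆ {q | q.1 ≤ t}) :
    Measurable[F t] fun ω => M ω B :=
  (comap_measurable _).mono
    ((le_iSup₂_of_le (f := fun B _ => MeasurableSpace.comap (fun ω => M ω B) _)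
      B ⟨hB, hBt⟩ le_rfl).trans (hM.adapted t)) le_rfl

theorem lintegral_apply_of_lt_top (hM : IsPoissonRandomMeasure P F Λ M) {B : Set NoisePoint}
    (hB : MeasurableSet B) (hΛB : Λ B < ⊤) : ∫⁻ ω, M ω B ∂P = Λ B := by
  calc ∫⁻ ω, M ω B ∂P = ∫⁻ x, x ∂(P.map fun ω => M ω B) :=
        (lintegral_map measurable_id (hM.measurable_apply hB)).symm
    _ = ∫⁻ k : ℕ, (k : ℝ≥0∞) ∂(poissonMeasure (Λ B).toNNReal) := by
        rw [hM.law B hB hΛB]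
        exact lintegral_map measurable_id measurable_from_top
    _ = Λ B := by rw [lintegral_natCast_poissonMeasure, ENNReal.coe_toNNReal hΛB.ne]

variable [SigmaFinite Λ]

theorem ae_regularize_eq (hM : IsPoissonRandomMeasure P F Λ M) :
    ∀ᵐ ω ∂P, regularize Λ M ω = M ω := by
  have hfin : ∀ n, ∀ᵐ ω ∂P, M ω (spanningSets Λ n) < ⊤ := fun n =>
    ae_lt_top (hM.measurable_apply (measurableSet_spanningSets Λ n)) (by
      rw [hM.lintegral_apply_of_lt_top (measurableSet_spanningSets Λ n)
        (measure_spanningSets_lt_top Λ n)]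
      exact (measure_spanningSets_lt_top Λ n).ne)
  filter_upwards [ae_all_iff.2 hfin] with ω hω using if_pos hω

theorem measurable_map_prodMk_regularize (hM : IsPoissonRandomMeasure P F Λ M) :
    Measurable fun ω => (regularize Λ M ω).map (Prod.mk ω) :=
  measurable_map_prodMk Λ (measurable_regularize Λ hM.measurable)
    (regularize_spanningSets_lt_top Λ M)

theorem aemeasurable_lintegral (hM : IsPoissonRandomMeasure P F Λ M) {f : Ω × NoisePoint → ℝ≥0∞}
    (hf : Measurable f) : AEMeasurable (fun ω => ∫⁻ q, f (ω, q) ∂(M ω)) P := by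
  refine ⟨fun ω => ∫⁻ x, f x ∂((regularize Λ M ω).map (Prod.mk ω)),
    (Measure.measurable_lintegral hf).comp hM.measurable_map_prodMk_regularize, ?_⟩
  filter_upwards [hM.ae_regularize_eq] with ω hω
  rw [hω, lintegral_map hf measurable_prodMk_left]

theorem aemeasurable_section (hM : IsPoissonRandomMeasure P F Λ M) {C : Set (Ω × NoisePoint)}
    (hC : MeasurableSet C) : AEMeasurable (fun ω => M ω (Prod.mk ω ⁻¹' C)) P := by
  refine (hM.aemeasurable_lintegral (measurable_one.indicator hC)).congr (ae_of_all _ fun ω => ?_)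
  exact lintegral_indicator_one (measurable_prodMk_left hC)

theorem measurable_section_of_predictable (hM : IsPoissonRandomMeasure P F Λ M)
    (hF : ∀ N : Set Ω, P N = 0 → MeasurableSet[F 0] N) (t : ℝ≥0) {C : Set (Ω × NoisePoint)}
    (hC : MeasurableSet[predictableSigma F] C) (hCt : C ⊆ {x | x.2.1 ≤ t}) :
    Measurable[F t] fun ω => M ω (Prod.mk ω ⁻¹' C) := by
  have hT : MeasurableSet {q : NoisePoint | q.1 ≤ (t : ℝ)} :=
    measurableSet_le measurable_fst measurable_const
  have hC' : MeasurableSet[(F t).prod inferInstance] C := by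
    simpa only [inter_eq_left.2 hCt] using measurableSet_inter_time_le_of_predictable F t hC
  have hmeas : Measurable[F t] fun ω => (regularize Λ M ω).restrict {q | q.1 ≤ (t : ℝ)} := by
    refine Measure.measurable_of_measurable_coe _ fun B hB => ?_
    simp_rw [Measure.restrict_apply hB]
    refine measurable_of_ae_eq hF
      (hM.measurable_apply_of_subset_Iic t (hB.inter hT) inter_subset_right) ?_
    filter_upwards [hM.ae_regularize_eq] with ω hω
    rw [hω]
  have hmap := @measurable_map_prodMk _ _ Λ _ _ (F t) _ hmeas fun ω n =>
    (Measure.restrict_apply_le _ _).trans_lt (regularize_spanningSets_lt_top Λ M ω n)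
  refine measurable_of_ae_eq hF
    ((@Measure.measurable_coe _ ((F t).prod inferInstance) _ hC').comp hmap) ?_
  filter_upwards [hM.ae_regularize_eq] with ω hω
  rw [Function.comp_apply, @Measure.map_apply _ _ _ ((F t).prod inferInstance) _ _
    (@measurable_prodMk_left _ _ (F t) _ ω) _ hC', hω]
  exact Measure.restrict_eq_self _ fun q hq => hCt hq

theorem lintegral_apply (hM : IsPoissonRandomMeasure P F Λ M) {B : Set NoisePoint}
    (hB : MeasurableSet B) : ∫⁻ ω, M ω B ∂P = Λ B := by
  have hBn : ∀ n, MeasurableSet (B ∩ spanningSets Λ n) := fun n =>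
    hB.inter (measurableSet_spanningSets Λ n)
  have hmono : Monotone fun n ω => M ω (B ∩ spanningSets Λ n) := fun _ _ hmn _ =>
    measure_mono (inter_subset_inter_right _ (monotone_spanningSets Λ hmn))
  simp_rw [← iSup_measure_inter_spanningSets Λ _ B]
  rw [lintegral_iSup (fun n => hM.measurable_apply (hBn n)) hmono]
  exact iSup_congr fun n => hM.lintegral_apply_of_lt_top (hBn n)
    ((measure_mono inter_subset_right).trans_lt (measure_spanningSets_lt_top Λ n))

theorem ae_apply_eq_zero (hM : IsPoissonRandomMeasure P F Λ M) {B : Set NoisePoint}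
    (hB : MeasurableSet B) (hΛB : Λ B = 0) : ∀ᵐ ω ∂P, M ω B = 0 :=
  (lintegral_eq_zero_iff (hM.measurable_apply hB)).1 ((hM.lintegral_apply hB).trans hΛB)

theorem setLIntegral_apply_of_lt_time (hM : IsPoissonRandomMeasure P F Λ M) {s : ℝ≥0} {A : Set Ω}
    (hA : MeasurableSet[F s] A) {B : Set NoisePoint} (hB : MeasurableSet B)
    (hs : B ⊆ {q | (s : ℝ) < q.1}) : ∫⁻ ω in A, M ω B ∂P = P A * Λ B := by
  have hsig : noiseSigma M (Ioi (s : ℝ)) ≤ mΩ :=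
    iSup₂_le fun C hC => (hM.measurable_apply hC.1).comap_le
  have hmB : Measurable[noiseSigma M (Ioi (s : ℝ))] fun ω => M ω B :=
    (comap_measurable _).mono (le_iSup₂_of_le B ⟨hB, hs⟩ le_rfl) le_rfl
  have hind : Measurable[F s] (A.indicator (1 : Ω → ℝ≥0∞)) :=
    (@measurable_const ℝ≥0∞ Ω _ (F s) 1).indicator hA
  calc ∫⁻ ω in A, M ω B ∂P = ∫⁻ ω, M ω B * A.indicator 1 ω ∂P := by
        rw [← lintegral_indicator (F.le s _ hA)]
        refine lintegral_congr fun ω => ?_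
        by_cases hω : ω ∈ A
        · rw [indicator_of_mem hω, indicator_of_mem hω, Pi.one_apply, mul_one]
        · rw [indicator_of_notMem hω, indicator_of_notMem hω, mul_zero]
    _ = (∫⁻ ω, M ω B ∂P) * ∫⁻ ω, A.indicator 1 ω ∂P :=
        lintegral_mul_eq_lintegral_mul_lintegral_of_independent_measurableSpace hsig (F.le s)
          (hM.indep_past s) hmB hind
    _ = P A * Λ B := by
        rw [hM.lintegral_apply hB, lintegral_indicator_one (F.le s _ hA), mul_comm]

theorem setLIntegral_apply_of_predictable (hM : IsPoissonRandomMeasure P F Λ M)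
    (hΛ : Λ {q | q.1 ≤ 0} = 0) {s : ℝ≥0} {A : Set Ω} (hA : MeasurableSet[F s] A)
    {B : Set NoisePoint} (hB : MeasurableSet B) (hs : ∀ q ∈ B, s = 0 ∨ (s : ℝ) < q.1) :
    ∫⁻ ω in A, M ω B ∂P = P A * Λ B := by
  let T : Set NoisePoint := {q | (s : ℝ) < q.1}
  have hT : MeasurableSet T := measurableSet_lt measurable_const measurable_fst
  have hBT : ∀ {N : Measure NoisePoint}, N {q | q.1 ≤ 0} = 0 → N B = N (B ∩ T) := by
    intro N hN
    refine (measure_inter_conull' (measure_mono_null ?_ hN)).symm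
    rintro q ⟨hq, hqT⟩
    rcases hs q hq with rfl | hsq
    · exact not_lt.1 fun hq0 : 0 < q.1 => hqT hq0
    · exact absurd hsq hqT
  have hM0 := hM.ae_apply_eq_zero (measurableSet_le measurable_fst measurable_const) hΛ
  rw [hBT hΛ, ← hM.setLIntegral_apply_of_lt_time hA (hB.inter hT) inter_subset_right]
  exact lintegral_congr_ae (ae_restrict_of_ae (hM0.mono fun ω hω => hBT hω))

/-- The left side is the Campbell measure of `M`; the two measures agree on predictable rectangles
because `M` after time `s` is independent of `F s`. -/
theorem trim_bind_regularize [IsProbabilityMeasure P] (hM : IsPoissonRandomMeasure P F Λ M)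
    (hΛ : Λ {q | q.1 ≤ 0} = 0) :
    (P.bind fun ω => (regularize Λ M ω).map (Prod.mk ω)).trim (predictableSigma_le F) =
      (P.prod Λ).trim (predictableSigma_le F) := by
  have hrect : ∀ C ∈ predictableRectangles F,
      (P.bind fun ω => (regularize Λ M ω).map (Prod.mk ω)).trim (predictableSigma_le F) C =
        (P.prod Λ).trim (predictableSigma_le F) C := by
    intro C hC
    have hCpred : MeasurableSet[predictableSigma F] C :=
      MeasurableSpace.measurableSet_generateFrom hC
    have hCmeas := predictableSigma_le F _ hCpred
    obtain ⟨s, A, B, hA, hB, hs, rfl⟩ := hC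
    rw [trim_measurableSet_eq _ hCpred, trim_measurableSet_eq _ hCpred, Measure.prod_prod,
      Measure.bind_apply hCmeas hM.measurable_map_prodMk_regularize.aemeasurable,
      ← hM.setLIntegral_apply_of_predictable hΛ hA hB hs, ← lintegral_indicator (F.le s _ hA)]
    refine lintegral_congr_ae (hM.ae_regularize_eq.mono fun ω hω => ?_)
    simp only [hω, Measure.map_apply measurable_prodMk_left hCmeas]
    by_cases hωA : ω ∈ A
    · rw [mk_preimage_prod_right hωA, indicator_of_mem hωA]
    · rw [mk_preimage_prod_right_eq_empty hωA, indicator_of_notMem hωA, measure_empty]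
  have hspan : ∀ n, univ ×ˢ spanningSets Λ n ∈ predictableRectangles F := fun n =>
    prod_mem_predictableRectangles F MeasurableSet.univ (measurableSet_spanningSets Λ n)
  refine Measure.ext_of_generateFrom_of_iUnion (predictableRectangles F)
    (fun n => univ ×ˢ spanningSets Λ n) rfl (isPiSystem_predictableRectangles F) ?_ hspan
    (fun n => ?_) hrect
  · rw [← prod_iUnion, iUnion_spanningSets, univ_prod_univ]
  · rw [hrect _ (hspan n), trim_measurableSet_eq _
      (MeasurableSpace.measurableSet_generateFrom (hspan n)), Measure.prod_prod, measure_univ,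
      one_mul]
    exact (measure_spanningSets_lt_top Λ n).ne

theorem lintegral_lintegral_of_predictable [IsProbabilityMeasure P]
    (hM : IsPoissonRandomMeasure P F Λ M) (hΛ : Λ {q | q.1 ≤ 0} = 0)
    {f : Ω × NoisePoint → ℝ≥0∞} (hf : Measurable[predictableSigma F] f) :
    ∫⁻ ω, ∫⁻ q, f (ω, q) ∂(M ω) ∂P = ∫⁻ ω, ∫⁻ q, f (ω, q) ∂Λ ∂P := by
  have hf' : Measurable f := hf.mono (predictableSigma_le F) le_rfl
  calc ∫⁻ ω, ∫⁻ q, f (ω, q) ∂(M ω) ∂P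
      = ∫⁻ ω, ∫⁻ x, f x ∂((regularize Λ M ω).map (Prod.mk ω)) ∂P := by
        refine lintegral_congr_ae (hM.ae_regularize_eq.mono fun ω hω => ?_)
        simp only [hω, lintegral_map hf' measurable_prodMk_left]
    _ = ∫⁻ x, f x ∂(P.bind fun ω => (regularize Λ M ω).map (Prod.mk ω)) :=
        (Measure.lintegral_bind hM.measurable_map_prodMk_regularize.aemeasurable
          hf'.aemeasurable).symm
    _ = ∫⁻ x, f x ∂(P.prod Λ) := by
        rw [← lintegral_trim (predictableSigma_le F) hf, hM.trim_bind_regularize hΛ,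
          lintegral_trim (predictableSigma_le F) hf]
    _ = ∫⁻ ω, ∫⁻ q, f (ω, q) ∂Λ ∂P := lintegral_prod _ hf'.aemeasurable

end IsPoissonRandomMeasure

end RandomMeasure

section RateMeasure

variable {α : ℝ → ℝ}

/-- A nonnegative, bounded and measurable function on `(0,∞)`. Values outside `(0,∞)` are
irrelevant. -/
structure IsMeasurableRate (α : ℝ → ℝ) : Prop where
  measurable_indicator : Measurable ((Ioi 0).indicator α)
  nonneg : ∀ x, 0 < x → 0 ≤ α x
  bounded : ∃ C, ∀ x, 0 < x → α x ≤ C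

theorem IsC1Plus.isMeasurableRate (hα : IsC1Plus α) : IsMeasurableRate α where
  measurable_indicator := by
    classical
    rw [← piecewise_eq_indicator]
    exact hα.contDiffOn.continuousOn.measurable_piecewise continuousOn_const measurableSet_Ioi
  nonneg := hα.nonneg
  bounded := hα.bounded

/-- The measure `α(x) ν(dx)` on `(0,∞)`. -/
def rateMeasure (α : ℝ → ℝ) (ν : FiniteMeasure ℝ) : Measure ℝ :=
  (ν : Measure ℝ).withDensity fun x => ENNReal.ofReal ((Ioi 0).indicator α x)

theorem isFiniteMeasure_rateMeasure (hα : IsMeasurableRate α) (ν : FiniteMeasure ℝ) :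
    IsFiniteMeasure (rateMeasure α ν) := by
  obtain ⟨C, hC⟩ := hα.bounded
  refine isFiniteMeasure_withDensity_ofReal (HasFiniteIntegral.of_bounded (C := |C|)
    (ae_of_all _ fun x => ?_))
  by_cases hx : 0 < x
  · simpa [indicator_of_mem (mem_Ioi.2 hx), abs_of_nonneg (hα.nonneg x hx)] using
      (hC x hx).trans (le_abs_self C)
  · simp [indicator_of_notMem (notMem_Ioi.2 (not_lt.1 hx))]

theorem pairing_indicator (hα : IsMeasurableRate α) (ν : FiniteMeasure ℝ) {s : Set ℝ}
    (hs : MeasurableSet s) : pairing ν (s.indicator α) = (rateMeasure α ν s).toReal := by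
  rw [pairing, ← integral_indicator measurableSet_Ioi, indicator_indicator, inter_comm,
    ← indicator_indicator, integral_indicator hs, integral_eq_lintegral_of_nonneg_ae
      (ae_of_all _ (indicator_nonneg (s := Ioi 0) hα.nonneg))
      hα.measurable_indicator.aestronglyMeasurable, rateMeasure, withDensity_apply _ hs]

theorem pairing_eq (hα : IsMeasurableRate α) (ν : FiniteMeasure ℝ) :
    pairing ν α = (rateMeasure α ν univ).toReal := by
  rw [← pairing_indicator hα ν MeasurableSet.univ, indicator_univ]

theorem pairing_indicator_Ioc (hα : IsMeasurableRate α) (ν : FiniteMeasure ℝ) (z : ℝ) :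
    pairing ν ((Ioc 0 z).indicator α) = (rateMeasure α ν (Iic z)).toReal := by
  rw [← pairing_indicator hα ν measurableSet_Iic]
  refine setIntegral_congr_fun measurableSet_Ioi fun x hx => ?_
  simp only [indicator, mem_Ioc, mem_Iic, mem_Ioi.1 hx, true_and]

theorem measurable_rateMeasure_apply (hα : IsMeasurableRate α) {s : Set ℝ} (hs : MeasurableSet s) :
    Measurable fun ν : FiniteMeasure ℝ => rateMeasure α ν s := by
  simp_rw [rateMeasure, withDensity_apply _ hs, ← lintegral_indicator hs]
  exact (Measure.measurable_lintegral (hα.measurable_indicator.ennreal_ofReal.indicator hs)).comp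
    measurable_subtype_coe

theorem measurable_pairing (hα : IsMeasurableRate α) : Measurable fun ν => pairing ν α := by
  simp_rw [pairing_eq hα]
  exact (measurable_rateMeasure_apply hα MeasurableSet.univ).ennreal_toReal

end RateMeasure

section ParentLife

variable {α : ℝ → ℝ}

theorem parentLife_eq_iInf_rat (hα : IsMeasurableRate α) (ν : FiniteMeasure ℝ) (y : ℝ) :
    parentLife α ν y = ⨅ z : ℚ, if 0 ≤ z ∧
      (rateMeasure α ν univ).toReal * y < (rateMeasure α ν (Iic (z : ℝ))).toReal
      then ENNReal.ofReal z else ⊤ := by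
  have := isFiniteMeasure_rateMeasure hα ν
  simp_rw [parentLife, pairing_eq hα, pairing_indicator_Ioc hα]
  refine le_antisymm (le_iInf fun z => ?_) (le_iInf₂ fun z hz => ?_)
  · split_ifs with h
    · refine iInf₂_le_of_le (z : ℝ).toNNReal ?_ le_rfl
      rw [Real.coe_toNNReal _ (by exact_mod_cast h.1)]
      exact h.2
    · exact le_top
  · refine ENNReal.le_of_forall_pos_le_add fun ε hε _ => ?_
    obtain ⟨x, hx1, hx2⟩ := exists_rat_btwn (show (z : ℝ) < z + ε by simpa using hε)
    refine iInf_le_of_le x ?_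
    rw [if_pos]
    · rw [← ENNReal.coe_add, ← ENNReal.ofReal_coe_nnreal]
      exact ENNReal.ofReal_le_ofReal (by push_cast; exact hx2.le)
    · refine ⟨by exact_mod_cast z.2.trans hx1.le, hz.trans_le ?_⟩
      exact ENNReal.toReal_mono (measure_ne_top _ _) (measure_mono (Iic_subset_Iic.2 hx1.le))

theorem measurable_parentLife (hα : IsMeasurableRate α) :
    Measurable fun x : FiniteMeasure ℝ × ℝ => parentLife α x.1 x.2 := by
  simp_rw [parentLife_eq_iInf_rat hα]
  refine Measurable.iInf fun z => Measurable.ite ?_ measurable_const measurable_const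
  have hR {s : Set ℝ} (hs : MeasurableSet s) :
      Measurable fun x : FiniteMeasure ℝ × ℝ => (rateMeasure α x.1 s).toReal :=
    ((measurable_rateMeasure_apply hα hs).comp measurable_fst).ennreal_toReal
  exact (MeasurableSet.const _).inter
    (measurableSet_lt ((hR MeasurableSet.univ).mul measurable_snd) (hR measurableSet_Iic))

theorem measurable_parentLife_left (hα : IsMeasurableRate α) (ν : FiniteMeasure ℝ) :
    Measurable (parentLife α ν) :=
  Measurable.of_uncurry_left (f := parentLife α) (measurable_parentLife hα)

theorem parentLife_le_of_lt (hα : IsMeasurableRate α) {ν : FiniteMeasure ℝ} {y : ℝ} {z : ℝ≥0}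
    (h : (rateMeasure α ν univ).toReal * y < (rateMeasure α ν (Iic (z : ℝ))).toReal) :
    parentLife α ν y ≤ z :=
  iInf₂_le z (by rwa [pairing_eq hα, pairing_indicator_Ioc hα])

theorem mul_le_of_parentLife_le (hα : IsMeasurableRate α) {ν : FiniteMeasure ℝ} {y : ℝ} {z : ℝ≥0}
    (h : parentLife α ν y ≤ z) :
    (rateMeasure α ν univ).toReal * y ≤ (rateMeasure α ν (Iic (z : ℝ))).toReal := by
  have := isFiniteMeasure_rateMeasure hα ν
  refine ge_of_tendsto ((ENNReal.tendsto_toReal (measure_ne_top _ _)).comp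
    (tendsto_measure_Iic_nhdsGT (rateMeasure α ν) z)) ?_
  filter_upwards [self_mem_nhdsWithin] with b hb
  have hlt : parentLife α ν y < ENNReal.ofReal b :=
    h.trans_lt (ENNReal.lt_ofReal_iff_toReal_lt ENNReal.coe_ne_top |>.2 hb)
  simp only [parentLife, iInf_lt_iff, pairing_eq hα, pairing_indicator_Ioc hα] at hlt
  obtain ⟨w, hw, hwb⟩ := hlt
  have hwb' : (w : ℝ) < b := ENNReal.lt_ofReal_iff_toReal_lt ENNReal.coe_ne_top |>.1 hwb
  exact hw.le.trans
    (ENNReal.toReal_mono (measure_ne_top _ _) (measure_mono (Iic_subset_Iic.2 hwb'.le)))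

theorem volume_restrict_Ioc_of_Iio_subset {A : Set ℝ} {a : ℝ} (ha : a ≤ 1) (hA : Iio a ⊆ A)
    (hA' : A ⊆ Iic a) : (volume.restrict (Ioc (0 : ℝ) 1)) A = ENNReal.ofReal a := by
  rw [Measure.restrict_apply' measurableSet_Ioc]
  refine le_antisymm ?_ ?_
  · calc volume (A ∩ Ioc 0 1) ≤ volume (Ioc 0 a) := measure_mono fun y hy => ⟨hy.2.1, hA' hy.1⟩
      _ = ENNReal.ofReal a := by rw [Real.volume_Ioc, sub_zero]
  · calc ENNReal.ofReal a = volume (Ioo 0 a) := by rw [Real.volume_Ioo, sub_zero]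
      _ ≤ volume (A ∩ Ioc 0 1) := measure_mono fun y hy => ⟨hA hy.2, hy.1, hy.2.le.trans ha⟩

theorem rateMeasure_univ_mul_volume_parentLife_le (hα : IsMeasurableRate α) (ν : FiniteMeasure ℝ)
    (z : ℝ≥0) :
    rateMeasure α ν univ * (volume.restrict (Ioc (0 : ℝ) 1)) (parentLife α ν ⁻¹' Iic (z : ℝ≥0∞)) =
      rateMeasure α ν (Iic (z : ℝ)) := by
  have := isFiniteMeasure_rateMeasure hα ν
  rcases eq_or_ne (rateMeasure α ν univ) 0 with hc | hc
  · rw [hc, zero_mul, measure_mono_null (subset_univ _) hc]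
  have hcpos : 0 < (rateMeasure α ν univ).toReal := ENNReal.toReal_pos hc (measure_ne_top _ _)
  have hle : (rateMeasure α ν (Iic (z : ℝ))).toReal ≤ (rateMeasure α ν univ).toReal :=
    ENNReal.toReal_mono (measure_ne_top _ _) (measure_mono (subset_univ _))
  rw [volume_restrict_Ioc_of_Iio_subset (A := parentLife α ν ⁻¹' Iic (z : ℝ≥0∞))
      ((div_le_one hcpos).2 hle) (fun y hy => parentLife_le_of_lt hα ((lt_div_iff₀' hcpos).1 hy))
      (fun y hy => (le_div_iff₀' hcpos).2 (mul_le_of_parentLife_le hα hy)),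
    ENNReal.ofReal_div_of_pos hcpos, ENNReal.ofReal_toReal (measure_ne_top _ _),
    ENNReal.ofReal_toReal (measure_ne_top _ _), ENNReal.mul_div_cancel hc (measure_ne_top _ _)]

/-- The quantile transform: `A_α(ν,·)` maps Lebesgue measure on `(0,1]` to the normalisation of
`α(x) ν(dx)`. -/
theorem map_parentLife (hα : IsMeasurableRate α) (ν : FiniteMeasure ℝ) :
    rateMeasure α ν univ • (volume.restrict (Ioc (0 : ℝ) 1)).map (parentLife α ν) =
      (rateMeasure α ν).map ENNReal.ofReal := by
  have := isFiniteMeasure_rateMeasure hα ν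
  have hA := measurable_parentLife_left hα ν
  have := (volume.restrict (Ioc (0 : ℝ) 1)).isFiniteMeasure_map (parentLife α ν)
  have := Measure.smul_finite ((volume.restrict (Ioc (0 : ℝ) 1)).map (parentLife α ν))
    (measure_ne_top (rateMeasure α ν) univ)
  refine Measure.ext_of_Iic _ _ fun a => ?_
  rw [Measure.smul_apply, Measure.map_apply hA measurableSet_Iic,
    Measure.map_apply ENNReal.measurable_ofReal measurableSet_Iic, smul_eq_mul]
  induction a using ENNReal.recTopCoe with
  | top => simp
  | coe z =>
    have hpre : ENNReal.ofReal ⁻¹' Iic (z : ℝ≥0∞) = Iic (z : ℝ) := by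
      ext x
      rw [mem_preimage, mem_Iic, mem_Iic, ENNReal.ofReal_le_iff_le_toReal ENNReal.coe_ne_top,
        ENNReal.coe_toReal]
    rw [hpre, rateMeasure_univ_mul_volume_parentLife_le hα]

end ParentLife

section Reproduction

variable {α : ℝ → ℝ} {p : ℝ → ℕ → ℝ}

/-- A bounded measurable birth rate together with offspring laws that depend measurably on the
residual life of the parent and have bounded means. -/
structure IsMeasurableMechanism (α : ℝ → ℝ) (p : ℝ → ℕ → ℝ) : Prop where
  rate : IsMeasurableRate α
  prob_measurable : ∀ i, Measurable ((Ioi 0).indicator fun x => p x i)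
  prob_nonneg : ∀ x, 0 < x → ∀ i, 0 ≤ p x i
  prob_sum : ∀ x, 0 < x → HasSum (p x) 1
  mean_bounded : (⨆ x ∈ Ioi (0 : ℝ), offspringMean p x) < ⊤

theorem IsBranchingMechanism.isMeasurableMechanism (h : IsBranchingMechanism α p) :
    IsMeasurableMechanism α p where
  rate := h.rate.isMeasurableRate
  prob_measurable i := (h.prob i).isMeasurableRate.measurable_indicator
  prob_nonneg x hx i := (h.prob i).nonneg x hx
  prob_sum := h.prob_sum
  mean_bounded := h.mean_bounded

/-- The supremum over `x` of the rate at which an individual with residual life `x` reproduces, when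
an event with `n` offspring has weight `f n`. The weight `f n = n` gives `growthRate`. -/
def eventRate (α : ℝ → ℝ) (p : ℝ → ℕ → ℝ) (f : ℕ → ℝ≥0∞) : ℝ≥0∞ :=
  ⨆ x ∈ Ioi (0 : ℝ), ENNReal.ofReal (α x) * ∑' n, f n * ENNReal.ofReal (p x n)

theorem growthRate_eq_eventRate : growthRate α p = eventRate α p fun n => n := rfl

theorem le_eventRate (f : ℕ → ℝ≥0∞) {x : ℝ} (hx : 0 < x) :
    ENNReal.ofReal (α x) * ∑' n, f n * ENNReal.ofReal (p x n) ≤ eventRate α p f :=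
  le_iSup₂ (f := fun x (_ : x ∈ Ioi (0 : ℝ)) =>
    ENNReal.ofReal (α x) * ∑' n, f n * ENNReal.ofReal (p x n)) x hx

theorem eventRate_lt_top (hα : IsMeasurableRate α) {f : ℕ → ℝ≥0∞} {b : ℝ≥0∞} (hb : b < ⊤)
    (hf : ∀ x, 0 < x → ∑' n, f n * ENNReal.ofReal (p x n) ≤ b) : eventRate α p f < ⊤ := by
  obtain ⟨C, hC⟩ := hα.bounded
  refine (iSup₂_le fun x hx => ?_).trans_lt (ENNReal.mul_lt_top (ENNReal.ofReal_lt_top (r := C)) hb)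
  exact mul_le_mul' (ENNReal.ofReal_le_ofReal (hC x hx)) (hf x hx)

namespace IsMeasurableMechanism

theorem eventRate_one_lt_top (h : IsMeasurableMechanism α p) : eventRate α p 1 < ⊤ := by
  refine eventRate_lt_top h.rate ENNReal.one_lt_top fun x hx => le_of_eq ?_
  simp_rw [Pi.one_apply, one_mul]
  rw [← ENNReal.ofReal_tsum_of_nonneg (h.prob_nonneg x hx) (h.prob_sum x hx).summable,
    (h.prob_sum x hx).tsum_eq, ENNReal.ofReal_one]

theorem growthRate_lt_top (h : IsMeasurableMechanism α p) : growthRate α p < ⊤ :=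
  eventRate_lt_top h.rate h.mean_bounded fun x hx =>
    le_iSup₂ (f := fun x (_ : x ∈ Ioi (0 : ℝ)) => offspringMean p x) x hx

theorem measurable_offspringProb (h : IsMeasurableMechanism α p) :
    Measurable fun x : ℝ≥0∞ × ℕ => offspringProb p x.1 x.2 := by
  refine measurable_from_prod_countable_left fun n => ?_
  have heq : (fun a : ℝ≥0∞ => offspringProb p a n) =
      (Ioo 0 ⊤).indicator fun a => (Ioi 0).indicator (fun x => p x n) a.toReal := by
    funext a
    simp only [offspringProb, indicator, mem_Ioo, mem_Ioi, ENNReal.toReal_pos_iff]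
    split_ifs <;> rfl
  exact heq ▸
    ((h.prob_measurable n).comp ENNReal.measurable_toReal).indicator measurableSet_Ioo

theorem measurable_offspringProb_parentLife (h : IsMeasurableMechanism α p) :
    Measurable fun x : FiniteMeasure ℝ × ℝ × ℕ => offspringProb p (parentLife α x.1 x.2.1) x.2.2 :=
  h.measurable_offspringProb.comp (((measurable_parentLife h.rate).comp
    (measurable_fst.prodMk (measurable_fst.comp measurable_snd))).prodMk
      (measurable_snd.comp measurable_snd))

end IsMeasurableMechanism

/-- The marks `(u,w,v)` of the noise that cause a reproduction in a population `ν` of mass at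
most `K`. -/
def reproduces (α : ℝ → ℝ) (p : ℝ → ℕ → ℝ) (K : ℝ≥0∞) (ν : FiniteMeasure ℝ) :
    Set (ℝ × Mark × ℝ) :=
  {r | (ν : Measure ℝ) univ ≤ K ∧ r.1 ∈ Ioc 0 (pairing ν α) ∧
    r.2.2 ∈ Ioc 0 (offspringProb p (parentLife α ν r.2.1.1) r.2.1.2.1)}

theorem IsMeasurableMechanism.measurableSet_reproduces (h : IsMeasurableMechanism α p) (K : ℝ≥0∞) :
    MeasurableSet {x : FiniteMeasure ℝ × (ℝ × Mark × ℝ) | x.2 ∈ reproduces α p K x.1} := by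
  have hmass : Measurable fun x : FiniteMeasure ℝ × (ℝ × Mark × ℝ) => (x.1 : Measure ℝ) univ :=
    (measurable_finiteMeasure_apply MeasurableSet.univ).comp measurable_fst
  have hpairing : Measurable fun x : FiniteMeasure ℝ × (ℝ × Mark × ℝ) => pairing x.1 α :=
    (measurable_pairing h.rate).comp measurable_fst
  have hprob : Measurable fun x : FiniteMeasure ℝ × (ℝ × Mark × ℝ) =>
      offspringProb p (parentLife α x.1 x.2.2.1.1) x.2.2.1.2.1 :=
    h.measurable_offspringProb_parentLife.comp
      (f := fun x : FiniteMeasure ℝ × (ℝ × Mark × ℝ) => (x.1, x.2.2.1.1, x.2.2.1.2.1))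
      (by fun_prop)
  have hu : Measurable fun x : FiniteMeasure ℝ × (ℝ × Mark × ℝ) => x.2.1 := by fun_prop
  have hv : Measurable fun x : FiniteMeasure ℝ × (ℝ × Mark × ℝ) => x.2.2.2 := by fun_prop
  exact (measurableSet_le hmass measurable_const).inter
    (((measurableSet_lt measurable_const hu).inter (measurableSet_le hu hpairing)).inter
      ((measurableSet_lt measurable_const hv).inter (measurableSet_le hv hprob)))

end Reproduction

section Intensity

/-- The intensity `du K(dw) dv` of the noise without its time coordinate. -/
def tailIntensity (G : Measure ℝ) [IsProbabilityMeasure G] : Measure (ℝ × Mark × ℝ) :=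
  (volume.restrict (Ioi (0 : ℝ))).prod
    ((markMeasure G).prod (volume.restrict (Ioc (0 : ℝ) 1)))

variable {α : ℝ → ℝ} {p : ℝ → ℕ → ℝ} (G : Measure ℝ) [IsProbabilityMeasure G]

instance : SigmaFinite (markMeasure G) := by
  unfold markMeasure
  infer_instance

instance : SigmaFinite (tailIntensity G) := by
  unfold tailIntensity
  infer_instance

instance : SigmaFinite (intensity G) := by
  unfold intensity
  infer_instance

theorem intensity_eq_prod :
    intensity G = (volume.restrict (Ioi (0 : ℝ))).prod (tailIntensity G) := rfl

theorem intensity_nonpos : intensity G {q | q.1 ≤ 0} = 0 := by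
  have hprod : {q : NoisePoint | q.1 ≤ 0} = Iic 0 ×ˢ univ := by ext; simp
  rw [intensity_eq_prod, hprod, Measure.prod_prod, Measure.restrict_apply measurableSet_Iic,
    Iic_inter_Ioi, Ioc_self, measure_empty, zero_mul]

theorem lintegral_markMeasure {f : ℝ → ℕ → ℝ≥0∞} (hf : Measurable fun x : ℝ × ℕ => f x.1 x.2) :
    ∫⁻ w, f w.1 w.2.1 ∂(markMeasure G) = ∫⁻ y in Ioc (0 : ℝ) 1, ∑' n, f y n := by
  have hf' : Measurable fun w : Mark => f w.1 w.2.1 :=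
    hf.comp (f := fun w : Mark => (w.1, w.2.1)) (by fun_prop)
  rw [markMeasure, lintegral_prod _ hf'.aemeasurable]
  refine lintegral_congr fun y => ?_
  have hy : Measurable fun w : ℕ × (ℕ → ℝ) => f y w.1 :=
    hf.comp (f := fun w : ℕ × (ℕ → ℝ) => (y, w.1)) (by fun_prop)
  rw [lintegral_prod (fun w : ℕ × (ℕ → ℝ) => f y w.1) hy.aemeasurable, lintegral_count]
  simp

theorem lintegral_subgraph_le {E : Type*} [MeasurableSpace E] (κ : Measure E)
    {c : E → ℝ} (hc : Measurable c) {g : E → ℝ≥0∞} (hg : Measurable g) :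
    ∫⁻ x in {x : E × ℝ | x.2 ∈ Ioc 0 (c x.1)}, g x.1 ∂(κ.prod (volume.restrict (Ioc (0 : ℝ) 1))) ≤
      ∫⁻ w, g w * ENNReal.ofReal (c w) ∂κ := by
  have hS : MeasurableSet {x : E × ℝ | x.2 ∈ Ioc 0 (c x.1)} :=
    (measurableSet_lt measurable_const measurable_snd).inter
      (measurableSet_le measurable_snd (hc.comp measurable_fst))
  have hg' : Measurable fun x : E × ℝ => g x.1 := hg.comp measurable_fst
  rw [← lintegral_indicator hS, lintegral_prod _ (hg'.indicator hS).aemeasurable]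
  refine lintegral_mono fun w => ?_
  calc ∫⁻ v in Ioc (0 : ℝ) 1, (Ioc 0 (c w)).indicator (fun _ => g w) v
      = g w * (volume.restrict (Ioc (0 : ℝ) 1)) (Ioc 0 (c w)) :=
        lintegral_indicator_const measurableSet_Ioc _
    _ ≤ g w * volume (Ioc 0 (c w)) := by gcongr; exact Measure.restrict_le_self
    _ = g w * ENNReal.ofReal (c w) := by rw [Real.volume_Ioc, sub_zero]

theorem lintegral_reproduces_le_parentLife (h : IsMeasurableMechanism α p) (ν : FiniteMeasure ℝ)
    (K : ℝ≥0∞) (f : ℕ → ℝ≥0∞) :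
    ∫⁻ r in reproduces α p K ν, f r.2.1.2.1 ∂(tailIntensity G) ≤
      ENNReal.ofReal (pairing ν α) * ∫⁻ y in Ioc (0 : ℝ) 1,
        ∑' n, f n * ENNReal.ofReal (offspringProb p (parentLife α ν y) n) := by
  have hprob : Measurable fun x : ℝ × ℕ => offspringProb p (parentLife α ν x.1) x.2 :=
    h.measurable_offspringProb_parentLife.comp (f := fun x : ℝ × ℕ => (ν, x)) (by fun_prop)
  have hf : Measurable f := measurable_from_top
  let κ := (markMeasure G).prod (volume.restrict (Ioc (0 : ℝ) 1))
  let accepted : Set (Mark × ℝ) :=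
    {x | x.2 ∈ Ioc 0 (offspringProb p (parentLife α ν x.1.1) x.1.2.1)}
  have hsub : reproduces α p K ν ⊆ Ioc 0 (pairing ν α) ×ˢ accepted := fun r hr => hr.2
  have hlength : (volume.restrict (Ioi (0 : ℝ))) (Ioc 0 (pairing ν α)) ≤
      ENNReal.ofReal (pairing ν α) := by
    simpa only [Real.volume_Ioc, sub_zero] using
      (Measure.restrict_apply_le (μ := volume) (Ioi (0 : ℝ)) (Ioc 0 (pairing ν α)))
  calc ∫⁻ r in reproduces α p K ν, f r.2.1.2.1 ∂(tailIntensity G)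
      ≤ ∫⁻ r in Ioc 0 (pairing ν α) ×ˢ accepted, f r.2.1.2.1 ∂(tailIntensity G) :=
        lintegral_mono_set hsub
    _ = ∫⁻ r, 1 * f r.2.1.2.1 ∂(((volume.restrict (Ioi 0)).restrict (Ioc 0 (pairing ν α))).prod
          (κ.restrict accepted)) := by
        simp_rw [one_mul, Measure.prod_restrict]
        rfl
    _ = (volume.restrict (Ioi (0 : ℝ))) (Ioc 0 (pairing ν α)) *
          ∫⁻ x in accepted, f x.1.2.1 ∂κ := by
        rw [lintegral_prod_mul (f := fun _ => 1) (g := fun x : Mark × ℝ => f x.1.2.1)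
          aemeasurable_const (hf.comp (by fun_prop)).aemeasurable, lintegral_one,
          Measure.restrict_apply_univ]
    _ ≤ ENNReal.ofReal (pairing ν α) * ∫⁻ w : Mark, f w.2.1 *
          ENNReal.ofReal (offspringProb p (parentLife α ν w.1) w.2.1) ∂(markMeasure G) := by
        refine mul_le_mul' hlength (lintegral_subgraph_le (markMeasure G)
          (c := fun w => offspringProb p (parentLife α ν w.1) w.2.1) (g := fun w => f w.2.1) ?_ ?_)
        · exact hprob.comp (f := fun w : Mark => (w.1, w.2.1)) (by fun_prop)
        · exact hf.comp (by fun_prop)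
    _ = _ := by
        rw [lintegral_markMeasure G (f := fun y n =>
          f n * ENNReal.ofReal (offspringProb p (parentLife α ν y) n))
          ((hf.comp measurable_snd).mul hprob.ennreal_ofReal)]

theorem lintegral_reproduces_le_mass (h : IsMeasurableMechanism α p) (ν : FiniteMeasure ℝ)
    (K : ℝ≥0∞) (f : ℕ → ℝ≥0∞) :
    ∫⁻ r in reproduces α p K ν, f r.2.1.2.1 ∂(tailIntensity G) ≤
      eventRate α p f * (ν : Measure ℝ) univ := by
  have := isFiniteMeasure_rateMeasure h.rate ν
  let m : ℝ≥0∞ → ℝ≥0∞ := fun a => ∑' n, f n * ENNReal.ofReal (offspringProb p a n)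
  have hm : Measurable m := by
    refine Measurable.tsum fun n => Measurable.const_mul ?_ _
    exact (h.measurable_offspringProb.comp measurable_prodMk_right).ennreal_ofReal
  have hA := measurable_parentLife_left h.rate ν
  have hrate : ∀ x, ENNReal.ofReal ((Ioi 0).indicator α x) * m (ENNReal.ofReal x) ≤
      eventRate α p f := by
    intro x
    by_cases hx : 0 < x
    · refine le_trans (le_of_eq ?_) (le_eventRate f hx)
      simp [m, offspringProb, hx, ENNReal.toReal_ofReal hx.le]
    · simp [hx]
  calc ∫⁻ r in reproduces α p K ν, f r.2.1.2.1 ∂(tailIntensity G)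
      ≤ ENNReal.ofReal (pairing ν α) * ∫⁻ y in Ioc (0 : ℝ) 1, m (parentLife α ν y) :=
        lintegral_reproduces_le_parentLife G h ν K f
    _ = ∫⁻ a, m a ∂(rateMeasure α ν univ •
          (volume.restrict (Ioc (0 : ℝ) 1)).map (parentLife α ν)) := by
        rw [pairing_eq h.rate, ENNReal.ofReal_toReal (measure_ne_top _ _),
          lintegral_smul_measure, lintegral_map hm hA, smul_eq_mul]
    _ = ∫⁻ x, ENNReal.ofReal ((Ioi 0).indicator α x) * m (ENNReal.ofReal x) ∂(ν : Measure ℝ) := by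
        rw [map_parentLife h.rate ν, lintegral_map hm ENNReal.measurable_ofReal]
        exact lintegral_withDensity_eq_lintegral_mul _
          h.rate.measurable_indicator.ennreal_ofReal (hm.comp ENNReal.measurable_ofReal)
    _ ≤ ∫⁻ _, eventRate α p f ∂(ν : Measure ℝ) := lintegral_mono hrate
    _ = eventRate α p f * (ν : Measure ℝ) univ := lintegral_const _

theorem lintegral_reproduces_le_level (h : IsMeasurableMechanism α p) (ν : FiniteMeasure ℝ)
    (K : ℝ≥0∞) (f : ℕ → ℝ≥0∞) :
    ∫⁻ r in reproduces α p K ν, f r.2.1.2.1 ∂(tailIntensity G) ≤ eventRate α p f * K := by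
  by_cases hK : (ν : Measure ℝ) univ ≤ K
  · exact (lintegral_reproduces_le_mass G h ν K f).trans (by gcongr)
  · have hempty : reproduces α p K ν = ∅ := by
      ext r
      simp [reproduces, hK]
    simp [hempty]

end Intensity

section LeftVersion

/-- The index `j` of the last grid point `j / (n + 1)` strictly before `s`. -/
def gridIndex (n : ℕ) (s : ℝ) : ℕ := ⌈s * (n + 1)⌉₊ - 1

/-- The last point of the grid of mesh `1 / (n + 1)` strictly before `s`, used to approximate left
limits by values of the path. -/
def gridPoint (n : ℕ) (s : ℝ) : ℝ≥0 := gridIndex n s / (n + 1)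

theorem gridPoint_lt (n : ℕ) {s : ℝ} (hs : 0 < s) : (gridPoint n s : ℝ) < s := by
  have hpos : 0 < s * (n + 1) := by positivity
  have hcast : (gridIndex n s : ℝ) = ⌈s * (n + 1)⌉₊ - 1 := by
    rw [gridIndex, Nat.cast_sub (Nat.ceil_pos.2 hpos), Nat.cast_one]
  rw [gridPoint]
  push_cast
  rw [div_lt_iff₀ (by positivity), hcast, sub_lt_iff_lt_add]
  exact Nat.ceil_lt_add_one hpos.le

theorem sub_one_div_le_gridPoint (n : ℕ) (s : ℝ) : s - 1 / ((n : ℝ) + 1) ≤ gridPoint n s := by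
  have hceil : (⌈s * (n + 1)⌉₊ : ℝ) ≤ gridIndex n s + 1 := by
    exact_mod_cast (tsub_le_iff_right.1 le_rfl : _ ≤ gridIndex n s + 1)
  rw [gridPoint]
  push_cast
  rw [le_div_iff₀ (by positivity), sub_mul, one_div_mul_cancel (by positivity)]
  linarith [Nat.le_ceil (s * (n + 1))]

theorem gridIndex_of_nonpos (n : ℕ) {s : ℝ} (hs : s ≤ 0) : gridIndex n s = 0 := by
  rw [gridIndex, Nat.ceil_eq_zero.2 (mul_nonpos_of_nonpos_of_nonneg hs (by positivity))]

theorem measurable_gridIndex (n : ℕ) : Measurable (gridIndex n) :=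
  (measurable_from_top (f := fun k : ℕ => k - 1)).comp
    (Nat.measurable_ceil.comp (measurable_id.mul_const _))

theorem tendsto_gridPoint {s : ℝ≥0} (hs : 0 < s) :
    Tendsto (fun n => gridPoint n s) atTop (𝓝[<] s) := by
  have hlt : ∀ n, gridPoint n s < s := fun n => gridPoint_lt n (NNReal.coe_pos.2 hs)
  refine tendsto_nhdsWithin_iff.2 ⟨NNReal.tendsto_coe.1 ?_, Eventually.of_forall hlt⟩
  have hlower : Tendsto (fun n : ℕ => (s : ℝ) - 1 / ((n : ℝ) + 1)) atTop (𝓝 s) := by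
    simpa only [sub_zero] using tendsto_one_div_add_atTop_nhds_zero_nat.const_sub (s : ℝ)
  exact tendsto_of_tendsto_of_tendsto_of_le_of_le hlower tendsto_const_nhds
    (fun n => sub_one_div_le_gridPoint n s) fun n => (hlt n).le

/-- The left limit at time `s` of a càdlàg path. Unlike `leftLimit`, it is defined by a countable
operation on earlier values, which makes it a predictable function of a random path. -/
def leftVersion (X : ℝ≥0 → LifeMeasure) (s : ℝ) : FiniteMeasure ℝ :=
  limsupMeasure fun n => (X (gridPoint n s)).1

theorem leftVersion_eq_leftLimit {X : ℝ≥0 → LifeMeasure} {s : ℝ≥0} (hs : 0 < s)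
    (hX : CadlagAt X s) : leftVersion X s = leftLimit X s :=
  limsupMeasure_eq_of_tendsto ((hX.tendsto_leftLimit hs).comp (tendsto_gridPoint hs))

variable {Ω : Type*} {mΩ : MeasurableSpace Ω} {F : Filtration ℝ≥0 mΩ} {X : ℝ≥0 → Ω → LifeMeasure}

theorem measurable_apply_gridPoint (hX : ∀ t, Measurable[F t] (X t)) (n : ℕ) :
    Measurable[predictableSigma F] fun x : Ω × NoisePoint => (X (gridPoint n x.2.1) x.1).1 := by
  intro B hB
  have hunion : (fun x : Ω × NoisePoint => (X (gridPoint n x.2.1) x.1).1) ⁻¹' B =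
      ⋃ j : ℕ, ((fun ω => (X (j / (n + 1)) ω).1) ⁻¹' B) ×ˢ
        {q : NoisePoint | gridIndex n q.1 = j} := by
    ext x
    simp only [mem_preimage, mem_iUnion, mem_prod, mem_ofPred_eq, exists_eq_right', gridPoint]
  rw [hunion]
  refine MeasurableSet.iUnion fun j => MeasurableSpace.measurableSet_generateFrom
    ⟨j / (n + 1), _, _, (measurable_subtype_coe.comp (hX _)) hB,
      (measurable_gridIndex n).comp measurable_fst (measurableSet_singleton j), ?_, rfl⟩
  rintro q (rfl : gridIndex n q.1 = j)
  rcases le_or_gt q.1 0 with hq | hq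
  · exact Or.inl (by simp [gridIndex_of_nonpos n hq])
  · exact Or.inr (gridPoint_lt n hq)

theorem measurable_leftVersion (hX : ∀ t, Measurable[F t] (X t)) :
    Measurable[predictableSigma F] fun x : Ω × NoisePoint =>
      leftVersion (fun r => X r x.1) x.2.1 :=
  @measurable_limsupMeasure _ (predictableSigma F) _ (measurable_apply_gridPoint hX)

end LeftVersion

section Events

variable {α : ℝ → ℝ} {p : ℝ → ℕ → ℝ}

/-- The reproduction events of the path `X` that occur when the mass of the population is at most
`K`, formulated with `leftVersion` in order to be measurable for every path. -/
def eventSet (α : ℝ → ℝ) (p : ℝ → ℕ → ℝ) (K : ℝ≥0∞) (X : ℝ≥0 → LifeMeasure) : Set NoisePoint :=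
  {q | 0 < q.1 ∧ q.2 ∈ reproduces α p K (leftVersion X q.1)}

/-- The reproduction events of the path `X` up to time `t` that occur when the mass of the
population is at most `K`: the truncation of `birthEvents` at level `K`. -/
def truncEvents (α : ℝ → ℝ) (p : ℝ → ℕ → ℝ) (K : ℝ≥0∞) (X : ℝ≥0 → LifeMeasure) (t : ℝ≥0) :
    Set NoisePoint :=
  {q | q.1 ∈ Ioc 0 (t : ℝ) ∧ q.2 ∈ reproduces α p K (leftLimit X q.1.toNNReal)}

theorem truncEvents_top (X : ℝ≥0 → LifeMeasure) (t : ℝ≥0) :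
    truncEvents α p ⊤ X t = birthEvents α p X t := by
  ext q
  simp [truncEvents, birthEvents, reproduces]

theorem truncEvents_mono_time (K : ℝ≥0∞) (X : ℝ≥0 → LifeMeasure) {s t : ℝ≥0} (h : s ≤ t) :
    truncEvents α p K X s ⊆ truncEvents α p K X t :=
  fun _ hq => ⟨⟨hq.1.1, hq.1.2.trans (by exact_mod_cast h)⟩, hq.2⟩

theorem truncEvents_congr_path (K : ℝ≥0∞) {X Y : ℝ≥0 → LifeMeasure} {t : ℝ≥0}
    (hX : ∀ s ≤ t, CadlagAt X s) (h : ∀ s < t, X s = Y s) :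
    truncEvents α p K X t = truncEvents α p K Y t := by
  ext q
  refine and_congr_right fun hq => ?_
  have hs : 0 < q.1.toNNReal := Real.toNNReal_pos.2 hq.1
  have hst : q.1.toNNReal ≤ t := Real.toNNReal_le_iff_le_coe.2 hq.2
  rw [leftLimit_congr hs (hX _ hst) fun r hr => h r (hr.trans_le hst)]

theorem truncEvents_congr_level {K K' : ℝ≥0∞} {X : ℝ≥0 → LifeMeasure} {t : ℝ≥0}
    (hX : ∀ s ≤ t, CadlagAt X s) (hK : ∀ s < t, totalMass (X s) ≤ K) (hKK' : K ≤ K') :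
    truncEvents α p K X t = truncEvents α p K' X t := by
  ext q
  refine and_congr_right fun hq => ?_
  have hs : 0 < q.1.toNNReal := Real.toNNReal_pos.2 hq.1
  have hst : q.1.toNNReal ≤ t := Real.toNNReal_le_iff_le_coe.2 hq.2
  have hmass : (leftLimit X q.1.toNNReal : Measure ℝ) univ ≤ K := by
    refine mass_leftLimit_le hs (hX _ hst) ?_
    filter_upwards [self_mem_nhdsWithin] with r hr
    exact hK r (lt_of_lt_of_le hr hst)
  simp [reproduces, hmass, hmass.trans hKK']

theorem truncEvents_eq_eventSet (K : ℝ≥0∞) {X : ℝ≥0 → LifeMeasure} {t : ℝ≥0}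
    (hX : ∀ s ≤ t, CadlagAt X s) :
    truncEvents α p K X t = eventSet α p K X ∩ {q | q.1 ≤ t} := by
  have hleft : ∀ s : ℝ, 0 < s → s ≤ t → leftVersion X s = leftLimit X s.toNNReal := by
    intro s hs hst
    lift s to ℝ≥0 using hs.le
    rw [Real.toNNReal_coe]
    exact leftVersion_eq_leftLimit (NNReal.coe_pos.1 hs) (hX s (NNReal.coe_le_coe.1 hst))
  ext q
  constructor
  · rintro ⟨⟨h0, ht⟩, hq⟩
    exact ⟨⟨h0, by rwa [hleft _ h0 ht]⟩, ht⟩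
  · rintro ⟨⟨h0, hq⟩, ht⟩
    exact ⟨⟨h0, ht⟩, by rwa [← hleft _ h0 ht]⟩

theorem measurableSet_predictable_eventSet {Ω : Type*} {mΩ : MeasurableSpace Ω}
    {F : Filtration ℝ≥0 mΩ} (h : IsMeasurableMechanism α p) (K : ℝ≥0∞)
    {X : ℝ≥0 → Ω → LifeMeasure} (hX : ∀ t, Measurable[F t] (X t)) :
    MeasurableSet[predictableSigma F]
      {x : Ω × NoisePoint | x.2 ∈ eventSet α p K fun r => X r x.1} := by
  have hq := measurable_snd_predictable F
  have htime : Measurable[predictableSigma F] fun x : Ω × NoisePoint => x.2.1 :=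
    measurable_fst.comp hq
  have hstate : Measurable[predictableSigma F] fun x : Ω × NoisePoint =>
      (leftVersion (fun r => X r x.1) x.2.1, x.2.2) :=
    (measurable_leftVersion hX).prodMk (measurable_snd.comp hq)
  exact (htime measurableSet_Ioi).inter (hstate (h.measurableSet_reproduces K))

/-- `Y t` is the right side at time `t` of the equation truncated at level `K`, evaluated along the
path `X`. For `X = Y` and `K = ∞` this is the equation itself. -/
def Produces (α : ℝ → ℝ) (p : ℝ → ℕ → ℝ) (K : ℝ≥0∞) (N : Measure NoisePoint) (μ : LifeMeasure)
    (X Y : ℝ≥0 → LifeMeasure) (t : ℝ≥0) : Prop :=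
  ∀ x : ℝ, 0 < x →
    distrib (Y t) x = (distrib μ (x + t) - distrib μ t) +
      ∫⁻ q, (truncEvents α p K X t).indicator (aliveOffspring t x) q ∂N

theorem solvesAt_iff_produces {N : Measure NoisePoint} {μ : LifeMeasure} {X : ℝ≥0 → LifeMeasure}
    {t : ℝ≥0} : SolvesAt α p N μ X t ↔ Produces α p ⊤ N μ X X t := by
  simp only [SolvesAt, Produces, truncEvents_top]

theorem Produces.eq {K K' : ℝ≥0∞} {N : Measure NoisePoint} {μ : LifeMeasure}
    {X Y X' Y' : ℝ≥0 → LifeMeasure} {t : ℝ≥0} (h : Produces α p K N μ X Y t)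
    (h' : Produces α p K' N μ X' Y' t)
    (hevents : truncEvents α p K X t =ᵐ[N] truncEvents α p K' X' t) : Y t = Y' t := by
  refine distrib_ext fun x hx => ?_
  rw [h x hx, h' x hx, lintegral_congr_ae (indicator_ae_eq_of_ae_eq_set hevents)]

end Events

section Uniqueness

variable {α : ℝ → ℝ} {p : ℝ → ℕ → ℝ} {K : ℝ≥0∞} {N : Measure NoisePoint}
  {X Y : ℝ≥0 → LifeMeasure} {T t₁ : ℝ≥0}

theorem CadlagAt.tendsto_totalMass {t : ℝ≥0} (hX : CadlagAt X t) :
    Tendsto (fun r => totalMass (X r)) (𝓝[≥] t) (𝓝 (totalMass (X t))) := by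
  have hcont : Continuous totalMass := by
    have : Continuous fun μ : LifeMeasure => ((μ.1.mass : ℝ≥0) : ℝ≥0∞) :=
      ENNReal.continuous_coe.comp (FiniteMeasure.continuous_mass.comp continuous_subtype_val)
    exact this.congr fun _ => FiniteMeasure.ennreal_mass
  exact (hcont.tendsto _).comp hX.1

theorem exists_measure_inter_Ioc_eq_zero
    (hN : ∀ B, MeasurableSet B → ∃ k : ℕ∞, N B = (k : ℝ≥0∞)) {S : Set NoisePoint} (hS : N S < ⊤)
    (T : ℝ) : ∃ ε : ℝ≥0, 0 < ε ∧ N (S ∩ {q | q.1 ∈ Ioc T (T + ε)}) = 0 := by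
  let D : ℕ → Set NoisePoint :=
    fun n => toMeasurable N S ∩ {q | q.1 ∈ Ioc T (T + 1 / ((n : ℝ) + 1))}
  have hDm : ∀ n, MeasurableSet (D n) := fun n =>
    (measurableSet_toMeasurable N S).inter (measurable_fst measurableSet_Ioc)
  have hanti : Antitone D := fun m n hmn q hq =>
    ⟨hq.1, hq.2.1, hq.2.2.trans (by gcongr)⟩
  have hinter : ⋂ n, D n = ∅ := by
    refine eq_empty_of_forall_notMem fun q hq => ?_
    rw [mem_iInter] at hq
    have hlim := (tendsto_one_div_add_atTop_nhds_zero_nat (𝕜 := ℝ)).const_add T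
    rw [add_zero] at hlim
    exact ((hq 0).2.1.trans_le (ge_of_tendsto' hlim fun n => (hq n).2.2)).false
  have hfin : N (D 0) ≠ ⊤ :=
    ((measure_mono inter_subset_left).trans_lt (by rwa [measure_toMeasurable])).ne
  have hlim : Tendsto (fun n => N (D n)) atTop (𝓝 0) := by
    rw [← measure_empty (μ := N), ← hinter]
    exact tendsto_measure_iInter_atTop (fun n => (hDm n).nullMeasurableSet) hanti ⟨0, hfin⟩
  obtain ⟨n, hn⟩ := (hlim.eventually (gt_mem_nhds zero_lt_one)).exists
  have hzero : N (D n) = 0 := by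
    obtain ⟨j, hj⟩ := hN _ (hDm n)
    rw [hj] at hn ⊢
    have : j < 1 := by exact_mod_cast hn
    simp [Order.lt_one_iff.1 this]
  refine ⟨1 / (n + 1), by positivity, measure_mono_null ?_ hzero⟩
  rintro q ⟨hqS, hqT⟩
  exact ⟨subset_toMeasurable N S hqS, by simpa using hqT⟩

/-- By right-continuity the mass stays below some `k` during a short time after `T`, so that all
events shortly after `T` belong to the finite set `truncEvents α p k X t₁`. -/
theorem exists_truncEvents_ae_eq (hN : ∀ B, MeasurableSet B → ∃ k : ℕ∞, N B = (k : ℝ≥0∞))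
    (hT : T < t₁) (hX : ∀ t ≤ t₁, CadlagAt X t)
    (hfin : ∀ k : ℕ, N (truncEvents α p k X t₁) < ⊤) :
    ∃ t₂ ≤ t₁, T < t₂ ∧ ∀ t, T ≤ t → t ≤ t₂ →
      truncEvents α p K X t =ᵐ[N] truncEvents α p K X T := by
  obtain ⟨k, hk⟩ := ENNReal.exists_nat_gt (show totalMass (X T) ≠ ⊤ from measure_ne_top _ _)
  obtain ⟨t₃, hTt₃, ht₃⟩ := (mem_nhdsGE_iff_exists_Ico_subset' hT).1
    ((hX T hT.le).tendsto_totalMass.eventually (gt_mem_nhds hk))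
  obtain ⟨ε, hε, hnull⟩ := exists_measure_inter_Ioc_eq_zero hN (hfin k) T
  obtain ⟨t₂, ht₂, ht₂'⟩ :=
    exists_between (lt_min hT (lt_min hTt₃ (lt_add_of_pos_right T hε)))
  simp only [lt_min_iff] at ht₂'
  obtain ⟨ht₂₁, ht₂₃, ht₂ε⟩ := ht₂'
  refine ⟨t₂, ht₂₁.le, ht₂, fun t hTt ht => ?_⟩
  refine eventuallyEq_set.2 ((measure_eq_zero_iff_ae_notMem.1 hnull).mono fun q hq => ?_)
  refine ⟨fun hqt => ?_, fun hqT => truncEvents_mono_time K X hTt hqT⟩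
  by_contra hqT
  have hTq : (T : ℝ) < q.1 := by
    by_contra! hle
    exact hqT ⟨⟨hqt.1.1, hle⟩, hqt.2⟩
  have hqt₂ : q.1 ≤ t₂ := hqt.1.2.trans (NNReal.coe_le_coe.2 ht)
  have hTq' : T < q.1.toNNReal := Real.lt_toNNReal_iff_coe_lt.2 hTq
  have hqt₂' : q.1.toNNReal ≤ t₂ := Real.toNNReal_le_iff_le_coe.2 hqt₂
  have hmass : (leftLimit X q.1.toNNReal : Measure ℝ) univ ≤ k := by
    refine mass_leftLimit_le (zero_le.trans_lt hTq') (hX _ (hqt₂'.trans ht₂₁.le)) ?_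
    filter_upwards [Ioo_mem_nhdsLT hTq'] with r hr
    exact (ht₃ ⟨hr.1.le, hr.2.trans_le (hqt₂'.trans ht₂₃.le)⟩ : totalMass (X r) < k).le
  exact hq ⟨⟨⟨hqt.1.1, hqt₂.trans (NNReal.coe_le_coe.2 ht₂₁.le)⟩, hmass, hqt.2.2⟩, hTq,
    hqt₂.trans (NNReal.coe_le_coe.2 ht₂ε.le)⟩

/-- Two solutions driven by the same noise agree up to and including the first time `T` at which
they could differ, and no further event occurs immediately after `T`. -/
theorem eq_of_produces {μ : LifeMeasure}
    (hN : ∀ B, MeasurableSet B → ∃ k : ℕ∞, N B = (k : ℝ≥0∞))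
    (hX : ∀ t ≤ t₁, CadlagAt X t) (hY : ∀ t ≤ t₁, CadlagAt Y t)
    (hXfin : ∀ k : ℕ, N (truncEvents α p k X t₁) < ⊤)
    (hYfin : ∀ k : ℕ, N (truncEvents α p k Y t₁) < ⊤)
    (hXeq : ∀ t ≤ t₁, Produces α p K N μ X X t) (hYeq : ∀ t ≤ t₁, Produces α p K N μ Y Y t) :
    ∀ t ≤ t₁, X t = Y t := by
  by_contra! hne
  obtain ⟨t₀, ht₀, hne⟩ := hne
  set T := sInf {t | X t ≠ Y t}
  have hTt₀ : T ≤ t₀ := csInf_le' hne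
  have hTt₁ : T ≤ t₁ := hTt₀.trans ht₀
  have hbefore : ∀ s < T, X s = Y s := fun s hs => not_not.1 (notMem_of_lt_csInf' hs)
  have hevents : truncEvents α p K X T = truncEvents α p K Y T :=
    truncEvents_congr_path K (fun s hs => hX s (hs.trans hTt₁)) hbefore
  have hat : X T = Y T := (hXeq T hTt₁).eq (hYeq T hTt₁) (Eq.eventuallyEq hevents)
  have hTlt : T < t₁ := by
    refine lt_of_le_of_ne hTt₁ fun h => hne ?_
    rwa [le_antisymm (ht₀.trans h.ge) hTt₀]
  obtain ⟨a, hat₁, hTa, hXa⟩ := exists_truncEvents_ae_eq (K := K) hN hTlt hX hXfin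
  obtain ⟨b, -, hTb, hYb⟩ := exists_truncEvents_ae_eq (K := K) hN hTlt hY hYfin
  suffices hle : min a b ≤ T from (lt_min hTa hTb).not_ge hle
  refine le_csInf ⟨t₀, hne⟩ fun t ht => ?_
  by_contra! hlt
  obtain ⟨hta, htb⟩ := lt_min_iff.1 hlt
  rcases lt_or_ge t T with h | h
  · exact ht (hbefore t h)
  · have htt₁ := hta.le.trans hat₁
    refine ht ((hXeq t htt₁).eq (hYeq t htt₁) ?_)
    exact (hXa t h hta.le).trans (hevents ▸ (hYb t h htb.le).symm)

end Uniqueness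

section Compensation

/-- The offspring number `n` of the point `(s,u,(y,n,z),v)`. -/
def offspring (q : NoisePoint) : ℕ := q.2.2.1.2.1

theorem measurable_offspring : Measurable offspring := by
  unfold offspring
  fun_prop

variable {Ω : Type*} {mΩ : MeasurableSpace Ω} {P : Measure Ω} [IsProbabilityMeasure P]
  {F : Filtration ℝ≥0 mΩ} {M : Ω → Measure NoisePoint} {G : Measure ℝ} [IsProbabilityMeasure G]

theorem IsPoissonRandomMeasure.lintegral_lintegral_eq_lintegral_time
    (hM : IsPoissonRandomMeasure P F (intensity G) M) {f : Ω × NoisePoint → ℝ≥0∞}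
    (hf : Measurable[predictableSigma F] f) :
    ∫⁻ ω, ∫⁻ q, f (ω, q) ∂(M ω) ∂P =
      ∫⁻ s in Ioi (0 : ℝ), ∫⁻ ω, ∫⁻ r, f (ω, (s, r)) ∂(tailIntensity G) ∂P := by
  have hf' : Measurable f := hf.mono (predictableSigma_le F) le_rfl
  calc ∫⁻ ω, ∫⁻ q, f (ω, q) ∂(M ω) ∂P
      = ∫⁻ ω, ∫⁻ q, f (ω, q) ∂(intensity G) ∂P :=
        hM.lintegral_lintegral_of_predictable (intensity_nonpos G) hf
    _ = ∫⁻ ω, (∫⁻ s in Ioi (0 : ℝ), (∫⁻ r, f (ω, (s, r)) ∂(tailIntensity G))) ∂P := by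
        refine lintegral_congr fun ω => ?_
        rw [intensity_eq_prod]
        exact lintegral_prod (fun q => f (ω, q)) (hf'.comp measurable_prodMk_left).aemeasurable
    _ = ∫⁻ s in Ioi (0 : ℝ), ∫⁻ ω, ∫⁻ r, f (ω, (s, r)) ∂(tailIntensity G) ∂P := by
        refine lintegral_lintegral_swap (Measurable.aemeasurable ?_)
        exact Measurable.lintegral_prod_right'
          (f := fun x : (Ω × ℝ) × (ℝ × Mark × ℝ) => f (x.1.1, (x.1.2, x.2)))
          (hf'.comp (by fun_prop))

theorem IsPoissonRandomMeasure.lintegral_setLIntegral_le_of_rate_le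
    (hM : IsPoissonRandomMeasure P F (intensity G) M)
    {D : Set (Ω × NoisePoint)} (hD : MeasurableSet[predictableSigma F] D) {t : ℝ≥0}
    (hDt : ∀ x ∈ D, x.2.1 ∈ Ioc 0 (t : ℝ)) (f : ℕ → ℝ≥0∞) (g : ℝ → Ω → ℝ≥0∞)
    (hg : ∀ᵐ ω ∂P, ∀ s ∈ Ioc 0 (t : ℝ),
      ∫⁻ r in {r | (ω, (s, r)) ∈ D}, f r.2.1.2.1 ∂(tailIntensity G) ≤ g s ω) :
    ∫⁻ ω, ∫⁻ q in Prod.mk ω ⁻¹' D, f (offspring q) ∂(M ω) ∂P ≤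
      ∫⁻ s in Ioc 0 (t : ℝ), ∫⁻ ω, g s ω ∂P := by
  have hD' := predictableSigma_le F _ hD
  let h : Ω × NoisePoint → ℝ≥0∞ := D.indicator fun x => f (offspring x.2)
  have hh : Measurable[predictableSigma F] h :=
    Measurable.indicator (measurable_from_top.comp
      (measurable_offspring.comp (measurable_snd_predictable F))) hD
  have hsection : ∀ s ω, ∫⁻ r, h (ω, (s, r)) ∂(tailIntensity G) =
      ∫⁻ r in {r | (ω, (s, r)) ∈ D}, f r.2.1.2.1 ∂(tailIntensity G) := fun s ω => by
    have hm : MeasurableSet {r : ℝ × Mark × ℝ | (ω, (s, r)) ∈ D} :=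
      (measurable_prodMk_left.comp measurable_prodMk_left) hD'
    rw [← lintegral_indicator hm]
    rfl
  calc ∫⁻ ω, ∫⁻ q in Prod.mk ω ⁻¹' D, f (offspring q) ∂(M ω) ∂P
      = ∫⁻ ω, ∫⁻ q, h (ω, q) ∂(M ω) ∂P := by
        refine lintegral_congr fun ω => ?_
        rw [← lintegral_indicator (measurable_prodMk_left hD')]
        rfl
    _ = ∫⁻ s in Ioi (0 : ℝ), ∫⁻ ω, ∫⁻ r, h (ω, (s, r)) ∂(tailIntensity G) ∂P :=
        hM.lintegral_lintegral_eq_lintegral_time hh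
    _ ≤ ∫⁻ s in Ioi (0 : ℝ), (Ioc 0 (t : ℝ)).indicator (fun s => ∫⁻ ω, g s ω ∂P) s := by
        refine lintegral_mono fun s => ?_
        by_cases hs : s ∈ Ioc 0 (t : ℝ)
        · rw [indicator_of_mem hs]
          exact lintegral_mono_ae (hg.mono fun ω hω => (hsection s ω).trans_le (hω s hs))
        · have hzero : ∀ ω r, h (ω, (s, r)) = 0 := fun ω r =>
            indicator_of_notMem (fun hx => hs (hDt _ hx)) _
          simp [hzero]
    _ ≤ ∫⁻ s, (Ioc 0 (t : ℝ)).indicator (fun s => ∫⁻ ω, g s ω ∂P) s := setLIntegral_le_lintegral _ _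
    _ = ∫⁻ s in Ioc 0 (t : ℝ), ∫⁻ ω, g s ω ∂P := lintegral_indicator measurableSet_Ioc _

end Compensation

section Moments

variable {α : ℝ → ℝ} {p : ℝ → ℕ → ℝ} {Ω : Type*}

/-- The reproduction events of the random path `X` up to time `t`, as a subset of `Ω × NoisePoint`;
it is predictable if `X` is adapted. -/
def predictableEvents (α : ℝ → ℝ) (p : ℝ → ℕ → ℝ) (K : ℝ≥0∞) (X : ℝ≥0 → Ω → LifeMeasure)
    (t : ℝ≥0) : Set (Ω × NoisePoint) :=
  {x | x.2 ∈ eventSet α p K (fun r => X r x.1) ∩ {q | q.1 ≤ t}}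

theorem time_mem_of_mem_predictableEvents {K : ℝ≥0∞} {X : ℝ≥0 → Ω → LifeMeasure} {t : ℝ≥0}
    {x : Ω × NoisePoint} (hx : x ∈ predictableEvents α p K X t) : x.2.1 ∈ Ioc 0 (t : ℝ) :=
  ⟨hx.1.1, hx.2⟩

theorem predictableEvents_time_section {K : ℝ≥0∞} {X : ℝ≥0 → Ω → LifeMeasure} {t : ℝ≥0} {s : ℝ}
    (hs : s ∈ Ioc 0 (t : ℝ)) (ω : Ω) :
    {r | (ω, (s, r)) ∈ predictableEvents α p K X t} =
      reproduces α p K (leftVersion (fun r => X r ω) s) := by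
  ext r
  simp [predictableEvents, eventSet, hs.1, hs.2]

variable {mΩ : MeasurableSpace Ω} {P : Measure Ω} {F : Filtration ℝ≥0 mΩ}
  {M : Ω → Measure NoisePoint} {G : Measure ℝ} [IsProbabilityMeasure G]

theorem measurableSet_predictableEvents (h : IsMeasurableMechanism α p) (K : ℝ≥0∞)
    {X : ℝ≥0 → Ω → LifeMeasure} (hX : ∀ t, Measurable[F t] (X t)) (t : ℝ≥0) :
    MeasurableSet[predictableSigma F] (predictableEvents α p K X t) :=
  (measurableSet_predictable_eventSet h K hX).inter
    ((measurable_fst.comp (measurable_snd_predictable F)) measurableSet_Iic)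

theorem IsPoissonRandomMeasure.aemeasurable_setLIntegral_predictableEvents
    (hM : IsPoissonRandomMeasure P F (intensity G) M) (h : IsMeasurableMechanism α p) (K : ℝ≥0∞)
    {X : ℝ≥0 → Ω → LifeMeasure} (hX : ∀ t, Measurable[F t] (X t)) (t : ℝ≥0) (f : ℕ → ℝ≥0∞) :
    AEMeasurable (fun ω => ∫⁻ q in Prod.mk ω ⁻¹' predictableEvents α p K X t,
      f (offspring q) ∂(M ω)) P := by
  have hD := predictableSigma_le F _ (measurableSet_predictableEvents h K hX t)
  have hf : Measurable f := measurable_from_top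
  refine (hM.aemeasurable_lintegral
    ((hf.comp (measurable_offspring.comp measurable_snd)).indicator hD)).congr ?_
  refine Eventually.of_forall fun ω => ?_
  dsimp only
  rw [← lintegral_indicator (measurable_prodMk_left hD)]
  rfl

variable [IsProbabilityMeasure P]

theorem IsPoissonRandomMeasure.lintegral_predictableEvents_le_level
    (hM : IsPoissonRandomMeasure P F (intensity G) M) (h : IsMeasurableMechanism α p) (K : ℝ≥0∞)
    {X : ℝ≥0 → Ω → LifeMeasure} (hX : ∀ t, Measurable[F t] (X t)) (t : ℝ≥0) (f : ℕ → ℝ≥0∞) :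
    ∫⁻ ω, ∫⁻ q in Prod.mk ω ⁻¹' predictableEvents α p K X t, f (offspring q) ∂(M ω) ∂P ≤
      eventRate α p f * K * t := by
  refine (hM.lintegral_setLIntegral_le_of_rate_le (measurableSet_predictableEvents h K hX t)
    (fun _ => time_mem_of_mem_predictableEvents) f (fun _ _ => eventRate α p f * K)
    (Eventually.of_forall fun ω s hs => ?_)).trans_eq ?_
  · rw [predictableEvents_time_section hs]
    exact lintegral_reproduces_le_level G h _ K f
  · simp

theorem IsPoissonRandomMeasure.ae_setLIntegral_eventSet_lt_top
    (hM : IsPoissonRandomMeasure P F (intensity G) M) (h : IsMeasurableMechanism α p) (K : ℕ)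
    {X : ℝ≥0 → Ω → LifeMeasure} (hX : ∀ t, Measurable[F t] (X t)) {f : ℕ → ℝ≥0∞}
    (hf : eventRate α p f < ⊤) :
    ∀ᵐ ω ∂P, ∀ t : ℝ≥0,
      ∫⁻ q in eventSet α p K (fun r => X r ω) ∩ {q | q.1 ≤ t}, f (offspring q) ∂(M ω) < ⊤ := by
  have hnat : ∀ᵐ ω ∂P, ∀ n : ℕ,
      ∫⁻ q in eventSet α p K (fun r => X r ω) ∩ {q | q.1 ≤ (n : ℝ≥0)}, f (offspring q) ∂(M ω) < ⊤ :=
    ae_all_iff.2 fun n => ae_lt_top' (hM.aemeasurable_setLIntegral_predictableEvents h K hX n f)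
      (ne_top_of_le_ne_top (by finiteness) (hM.lintegral_predictableEvents_le_level h K hX n f))
  filter_upwards [hnat] with ω hω t
  obtain ⟨n, hn⟩ := exists_nat_ge t
  refine (lintegral_mono_set (inter_subset_inter_right _ fun q hq => ?_)).trans_lt (hω n)
  exact le_trans hq (NNReal.coe_le_coe.2 hn)

theorem IsPoissonRandomMeasure.ae_truncEvents_lt_top
    (hM : IsPoissonRandomMeasure P F (intensity G) M) (h : IsMeasurableMechanism α p)
    {X : ℝ≥0 → Ω → LifeMeasure} (hX : ∀ t, Measurable[F t] (X t)) :
    ∀ᵐ ω ∂P, ∀ (k : ℕ) (t : ℝ≥0), (∀ s ≤ t, CadlagAt (fun r => X r ω) s) →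
      M ω (truncEvents α p k (fun r => X r ω) t) < ⊤ := by
  filter_upwards [ae_all_iff.2 fun k : ℕ =>
    hM.ae_setLIntegral_eventSet_lt_top h k hX h.eventRate_one_lt_top] with ω hω k t hX
  rw [truncEvents_eq_eventSet _ hX]
  simpa using hω k t

theorem IsPoissonRandomMeasure.pathwise_unique
    (hM : IsPoissonRandomMeasure P F (intensity G) M) (h : IsMeasurableMechanism α p)
    {X₀ : Ω → LifeMeasure} {X Y : ℝ≥0 → Ω → LifeMeasure} {ζ η : Ω → WithTop ℝ≥0}
    (hX : IsSolution P F α p M X₀ X ζ) (hY : IsSolution P F α p M X₀ Y η) :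
    ∀ᵐ ω ∂P, ∀ t : ℝ≥0, (t : WithTop ℝ≥0) < ζ ω → (t : WithTop ℝ≥0) < η ω → X t ω = Y t ω := by
  filter_upwards [hX.cadlag, hX.equation, hY.cadlag, hY.equation,
    hM.ae_truncEvents_lt_top h hX.adapted, hM.ae_truncEvents_lt_top h hY.adapted]
    with ω cadlagX eqX cadlagY eqY finX finY t htζ htη
  have hζ : ∀ s ≤ t, (s : WithTop ℝ≥0) < ζ ω := fun s hs => (WithTop.coe_le_coe.2 hs).trans_lt htζ
  have hη : ∀ s ≤ t, (s : WithTop ℝ≥0) < η ω := fun s hs => (WithTop.coe_le_coe.2 hs).trans_lt htη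
  have hXt : ∀ s ≤ t, CadlagAt (fun r => X r ω) s := fun s hs => cadlagX s (hζ s hs)
  have hYt : ∀ s ≤ t, CadlagAt (fun r => Y r ω) s := fun s hs => cadlagY s (hη s hs)
  exact eq_of_produces (K := ⊤) (hM.integer_valued ω) hXt hYt (fun k => finX k t hXt)
    (fun k => finY k t hYt) (fun s hs => solvesAt_iff_produces.1 (eqX s (hζ s hs)))
    (fun s hs => solvesAt_iff_produces.1 (eqY s (hη s hs))) t le_rfl

end Moments

section BirthMeasure

/-- The birth and death times of the `i`-th child born in the event `q = (s,u,(y,n,z),v)`. -/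
def lifeSpan (i : ℕ) (q : NoisePoint) : ℝ × ℝ := (q.1, q.1 + q.2.2.1.2.2 i)

theorem measurable_lifeSpan (i : ℕ) : Measurable (lifeSpan i) := by
  unfold lifeSpan
  fun_prop

theorem measurableSet_lt_offspring (i : ℕ) : MeasurableSet {q | i < offspring q} :=
  measurable_offspring measurableSet_Ioi

/-- The point measure of birth and death times of the population started at time `0` from `μ` and
fed by the children born in the events of `N` that lie in `S`. -/
def birthMeasure (N : Measure NoisePoint) (μ : LifeMeasure) (S : Set NoisePoint) :
    Measure (ℝ × ℝ) :=
  (μ.1 : Measure ℝ).map (Prod.mk 0) +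
    Measure.sum fun i => (N.restrict (S ∩ {q | i < offspring q})).map (lifeSpan i)

theorem birthMeasure_apply (N : Measure NoisePoint) (μ : LifeMeasure) (S : Set NoisePoint)
    {C : Set (ℝ × ℝ)} (hC : MeasurableSet C) :
    birthMeasure N μ S C = (μ.1 : Measure ℝ) (Prod.mk 0 ⁻¹' C) +
      ∑' i, N (lifeSpan i ⁻¹' C ∩ (S ∩ {q | i < offspring q})) := by
  rw [birthMeasure, Measure.add_apply, Measure.map_apply measurable_prodMk_left hC,
    Measure.sum_apply _ hC]
  congr 1
  refine tsum_congr fun i => ?_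
  rw [Measure.map_apply (measurable_lifeSpan i) hC,
    Measure.restrict_apply (measurable_lifeSpan i hC)]

theorem tsum_measure_inter_lt_offspring (N : Measure NoisePoint) (S : Set NoisePoint)
    {H : ℕ → Set NoisePoint} (hH : ∀ i, MeasurableSet (H i)) :
    ∑' i, N (H i ∩ (S ∩ {q | i < offspring q})) =
      ∫⁻ q in S, ∑ i ∈ Finset.range (offspring q), (H i).indicator 1 q ∂N := by
  have hm : ∀ i, MeasurableSet (H i ∩ {q | i < offspring q}) :=
    fun i => (hH i).inter (measurableSet_lt_offspring i)
  have hsum : ∀ q, ∑ i ∈ Finset.range (offspring q), (H i).indicator (1 : NoisePoint → ℝ≥0∞) q =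
      ∑' i, (H i ∩ {q | i < offspring q}).indicator 1 q := fun q => by
    rw [tsum_eq_sum (s := Finset.range (offspring q)) fun i hi =>
      indicator_of_notMem (fun hq => hi (Finset.mem_range.2 hq.2)) _]
    refine Finset.sum_congr rfl fun i hi => ?_
    have hi' : i < offspring q := Finset.mem_range.1 hi
    by_cases hq : q ∈ H i <;> simp [hq, hi']
  simp_rw [hsum]
  rw [lintegral_tsum fun i => (measurable_one.indicator (hm i)).aemeasurable]
  refine tsum_congr fun i => ?_
  rw [lintegral_indicator_one (hm i), Measure.restrict_apply (hm i), inter_right_comm, inter_assoc]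

theorem birthMeasure_time_le (N : Measure NoisePoint) (μ : LifeMeasure) (S : Set NoisePoint)
    (t : ℝ≥0) :
    birthMeasure N μ S {b | b.1 ≤ t} =
      totalMass μ + ∫⁻ q in S ∩ {q | q.1 ≤ t}, (offspring q : ℝ≥0∞) ∂N := by
  have hinitial : Prod.mk (0 : ℝ) ⁻¹' {b : ℝ × ℝ | b.1 ≤ t} = univ :=
    eq_univ_of_forall fun _ => t.coe_nonneg
  have hchildren : ∀ i, lifeSpan i ⁻¹' {b | b.1 ≤ t} ∩ (S ∩ {q | i < offspring q}) =
      univ ∩ ((S ∩ {q | q.1 ≤ t}) ∩ {q | i < offspring q}) := fun i => by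
    ext q
    simp only [lifeSpan, mem_inter_iff, mem_preimage, mem_ofPred_eq, mem_univ, true_and]
    tauto
  rw [birthMeasure_apply _ _ _ (measurableSet_le measurable_fst measurable_const), hinitial]
  simp_rw [hchildren]
  rw [tsum_measure_inter_lt_offspring N _ fun _ => MeasurableSet.univ]
  simp [totalMass]

theorem residualLives_birthMeasure (N : Measure NoisePoint) (μ : LifeMeasure) (S : Set NoisePoint)
    (t : ℝ≥0) {C : Set ℝ} (hC : MeasurableSet C) :
    residualLives (birthMeasure N μ S) t C = (μ.1 : Measure ℝ) {z | (t : ℝ) < z ∧ z - t ∈ C} +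
      ∑' i, N (lifeSpan i ⁻¹' {b | b ∈ aliveAt t ∧ b.2 - t ∈ C} ∩ (S ∩ {q | i < offspring q})) := by
  have hsub : Measurable fun b : ℝ × ℝ => b.2 - (t : ℝ) := by fun_prop
  have hD : MeasurableSet {b : ℝ × ℝ | b ∈ aliveAt t ∧ b.2 - (t : ℝ) ∈ C} :=
    (measurableSet_aliveAt t).inter (hsub hC)
  rw [residualLives_apply _ _ hC, birthMeasure_apply _ _ _ hD]
  congr 3
  ext z
  simp [aliveAt]

theorem measure_residual_Ioc (μ : LifeMeasure) (t : ℝ≥0) (x : ℝ) :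
    (μ.1 : Measure ℝ) {z | (t : ℝ) < z ∧ z - t ∈ Ioc 0 x} = distrib μ (x + t) - distrib μ t := by
  have hshift : {z : ℝ | (t : ℝ) < z ∧ z - t ∈ Ioc 0 x} = Ioc (t : ℝ) (x + t) := by
    ext z
    simp only [mem_ofPred_eq, mem_Ioc, sub_pos, sub_le_iff_le_add, ← and_assoc, and_self]
  rw [hshift]
  rcases le_total x 0 with hx | hx
  · rw [Ioc_eq_empty (by linarith), measure_empty, tsub_eq_zero_of_le]
    exact measure_mono (Ioc_subset_Ioc_right (by linarith))
  · refine ENNReal.eq_sub_of_add_eq (measure_ne_top _ _) ?_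
    have htx : (t : ℝ) ≤ x + t := by linarith
    rw [distrib, distrib, ← Ioc_union_Ioc_eq_Ioc t.coe_nonneg htx, add_comm]
    exact (measure_union (Ioc_disjoint_Ioc_of_le le_rfl) measurableSet_Ioc).symm

theorem residualLives_birthMeasure_Ioc (N : Measure NoisePoint) (μ : LifeMeasure)
    {S : Set NoisePoint} (hS : MeasurableSet S) (t : ℝ≥0) (x : ℝ) :
    residualLives (birthMeasure N μ S) t (Ioc 0 x) = (distrib μ (x + t) - distrib μ t) +
      ∫⁻ q, (S ∩ {q | q.1 ≤ t}).indicator (aliveOffspring t x) q ∂N := by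
  have hH : ∀ i, MeasurableSet {q : NoisePoint | q.2.2.1.2.2 i - ((t : ℝ) - q.1) ∈ Ioc 0 x} :=
    fun i => measurableSet_preimage (by fun_prop) measurableSet_Ioc
  have hchildren : ∀ i, lifeSpan i ⁻¹' {b | b ∈ aliveAt t ∧ b.2 - t ∈ Ioc 0 x} ∩
      (S ∩ {q | i < offspring q}) = {q : NoisePoint | q.2.2.1.2.2 i - ((t : ℝ) - q.1) ∈ Ioc 0 x} ∩
        ((S ∩ {q | q.1 ≤ t}) ∩ {q | i < offspring q}) := fun i => by
    ext q
    simp only [lifeSpan, aliveAt, mem_inter_iff, mem_preimage, mem_ofPred_eq, mem_Ioc]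
    constructor
    · rintro ⟨⟨⟨hborn, hdead⟩, _, hle⟩, hq, hi⟩
      exact ⟨⟨by linarith, by linarith⟩, ⟨hq, hborn⟩, hi⟩
    · rintro ⟨⟨hpos, hle⟩, ⟨hq, hborn⟩, hi⟩
      exact ⟨⟨⟨hborn, by linarith⟩, by linarith, by linarith⟩, hq, hi⟩
  rw [residualLives_birthMeasure _ _ _ _ measurableSet_Ioc, measure_residual_Ioc,
    lintegral_indicator (hS.inter (measurableSet_le measurable_fst measurable_const))]
  simp_rw [hchildren]
  exact congrArg _ (tsum_measure_inter_lt_offspring N _ hH)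

end BirthMeasure

section Step

variable {α : ℝ → ℝ} {p : ℝ → ℕ → ℝ} {Ω : Type*} {mΩ : MeasurableSpace Ω} {P : Measure Ω}
  {F : Filtration ℝ≥0 mΩ} {M : Ω → Measure NoisePoint} {G : Measure ℝ} [IsProbabilityMeasure G]
  {X₀ : Ω → LifeMeasure} {X : ℝ≥0 → Ω → LifeMeasure}

theorem IsPoissonRandomMeasure.measurable_residualLives_birthMeasure
    (hM : IsPoissonRandomMeasure P F (intensity G) M)
    (hF : ∀ N : Set Ω, P N = 0 → MeasurableSet[F 0] N) (h : IsMeasurableMechanism α p) (K : ℝ≥0∞)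
    (hX₀ : Measurable[F 0] X₀) (hX : ∀ t, Measurable[F t] (X t)) (t : ℝ≥0) :
    Measurable[F t] fun ω =>
      residualLives (birthMeasure (M ω) (X₀ ω) (eventSet α p K fun r => X r ω)) t := by
  refine Measure.measurable_of_measurable_coe _ fun C hC => ?_
  simp_rw [residualLives_birthMeasure _ _ _ t hC]
  have hsub : Measurable fun b : ℝ × ℝ => b.2 - (t : ℝ) := by fun_prop
  have hinitial : Measurable[F t] fun ω =>
      ((X₀ ω).1 : Measure ℝ) {z | (t : ℝ) < z ∧ z - t ∈ C} := by
    have hC' : MeasurableSet {z : ℝ | (t : ℝ) < z ∧ z - t ∈ C} :=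
      measurableSet_Ioi.inter ((measurable_id.sub_const (t : ℝ)) hC)
    exact (measurable_finiteMeasure_apply hC').comp
      (measurable_subtype_coe.comp (hX₀.mono (F.mono zero_le) le_rfl))
  have hchildren : ∀ i, Measurable[F t] fun ω => M ω
      (lifeSpan i ⁻¹' {b | b ∈ aliveAt t ∧ b.2 - t ∈ C} ∩
        (eventSet α p K (fun r => X r ω) ∩ {q | i < offspring q})) := fun i => by
    refine hM.measurable_section_of_predictable hF t (C := Prod.snd ⁻¹'
      (lifeSpan i ⁻¹' {b | b ∈ aliveAt t ∧ b.2 - t ∈ C}) ∩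
        ({x | x.2 ∈ eventSet α p K fun r => X r x.1} ∩ Prod.snd ⁻¹' {q | i < offspring q})) ?_
      fun x hx => hx.1.1.1
    have hq := measurable_snd_predictable F
    exact (hq (measurable_lifeSpan i ((measurableSet_aliveAt t).inter (hsub hC)))).inter
      ((measurableSet_predictable_eventSet h K hX).inter (hq (measurableSet_lt_offspring i)))
  exact hinitial.add (@Measurable.tsum _ _ _ (F t) _ _ _ _ _ _ _ _ _ _ _ _ hchildren)

theorem IsPoissonRandomMeasure.ae_birthMeasure_time_le_lt_top [IsProbabilityMeasure P]
    (hM : IsPoissonRandomMeasure P F (intensity G) M) (h : IsMeasurableMechanism α p) (K : ℕ)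
    (X₀ : Ω → LifeMeasure) (hX : ∀ t, Measurable[F t] (X t)) :
    ∀ᵐ ω ∂P, ∀ t : ℝ≥0,
      birthMeasure (M ω) (X₀ ω) (eventSet α p K fun r => X r ω) {b | b.1 ≤ t} < ⊤ := by
  filter_upwards [hM.ae_setLIntegral_eventSet_lt_top h K hX
    (growthRate_eq_eventRate (α := α) (p := p) ▸ h.growthRate_lt_top)] with ω hω t
  rw [birthMeasure_time_le]
  exact ENNReal.add_lt_top.2 ⟨measure_lt_top _ _, hω t⟩

open Classical in
theorem IsPoissonRandomMeasure.exists_produces [IsProbabilityMeasure P]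
    (hM : IsPoissonRandomMeasure P F (intensity G) M)
    (hF : ∀ N : Set Ω, P N = 0 → MeasurableSet[F 0] N) (h : IsMeasurableMechanism α p) (K : ℕ)
    (hX₀ : Measurable[F 0] X₀) (hX : ∀ t, Measurable[F t] (X t))
    (hXcadlag : ∀ ω t, CadlagAt (fun r => X r ω) t) :
    ∃ Y : ℝ≥0 → Ω → LifeMeasure, (∀ t, Measurable[F t] (Y t)) ∧
      (∀ ω t, CadlagAt (fun r => Y r ω) t) ∧
      ∀ᵐ ω ∂P, ∀ t, Produces α p K (M ω) (X₀ ω) (fun r => X r ω) (fun r => Y r ω) t ∧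
        totalMass (Y t ω) ≤ totalMass (X₀ ω) +
          ∫⁻ q in truncEvents α p K (fun r => X r ω) t, (offspring q : ℝ≥0∞) ∂(M ω) := by
  let B : Ω → Measure (ℝ × ℝ) := fun ω =>
    birthMeasure (M ω) (X₀ ω) (eventSet α p K fun r => X r ω)
  let B' : Ω → Measure (ℝ × ℝ) := fun ω => if ∀ t : ℝ≥0, B ω {b | b.1 ≤ t} < ⊤ then B ω else 0
  have hB'fin : ∀ ω, ∀ t : ℝ≥0, B' ω {b | b.1 ≤ t} < ⊤ := fun ω t => by
    by_cases hω : ∀ t : ℝ≥0, B ω {b | b.1 ≤ t} < ⊤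
    · simpa only [B', if_pos hω] using hω t
    · simp [B', if_neg hω]
  have hB'ae : ∀ᵐ ω ∂P, B' ω = B ω :=
    (hM.ae_birthMeasure_time_le_lt_top h K X₀ hX).mono fun ω hω => if_pos hω
  refine ⟨fun t ω => residualPath (B' ω) (hB'fin ω) t, fun t => ?_,
    fun ω t => cadlagAt_residualPath _ _ t, ?_⟩
  · refine Measurable.subtype_mk (Measurable.subtype_mk ?_)
    exact measurable_of_ae_eq hF (hM.measurable_residualLives_birthMeasure hF h K hX₀ hX t)
      (hB'ae.mono fun ω hω => by rw [hω])
  · filter_upwards [hB'ae] with ω hω t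
    rw [Produces, truncEvents_eq_eventSet K fun s _ => hXcadlag ω s]
    have hS : MeasurableSet (eventSet α p K fun r => X r ω) :=
      measurable_prodMk_left (x := ω)
        (predictableSigma_le F _ (measurableSet_predictable_eventSet h K hX))
    constructor
    · intro x _
      change residualLives (B' ω) t (Ioc 0 x) = _
      rw [hω]
      exact residualLives_birthMeasure_Ioc _ _ hS t x
    · change residualLives (B' ω) t univ ≤ _
      rw [hω, ← birthMeasure_time_le]
      exact residualLives_le _ _ _

end Step

section IteratedIntegral

theorem lintegral_pow_div_factorial (c t : ℝ≥0) (j : ℕ) :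
    ∫⁻ s in Ioc 0 (t : ℝ), (c : ℝ≥0∞) * ENNReal.ofReal ((c * s) ^ j / j.factorial) =
      ENNReal.ofReal ((c * t) ^ (j + 1) / (j + 1).factorial) := by
  have hmul : ∀ s : ℝ, (c : ℝ≥0∞) * ENNReal.ofReal ((c * s) ^ j / j.factorial) =
      ENNReal.ofReal (c ^ (j + 1) / j.factorial * s ^ j) := fun s => by
    rw [← ENNReal.ofReal_coe_nnreal, ← ENNReal.ofReal_mul c.coe_nonneg]
    congr 1
    ring
  simp_rw [hmul]
  rw [← ofReal_integral_eq_lintegral_ofReal, ← intervalIntegral.integral_of_le t.coe_nonneg,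
    intervalIntegral.integral_const_mul, integral_pow]
  · congr 1
    rw [Nat.factorial_succ, mul_pow]
    push_cast
    field_simp
    simp
  · exact Continuous.integrableOn_Ioc (by fun_prop)
  · filter_upwards [ae_restrict_mem measurableSet_Ioc] with s hs
    have := hs.1.le
    positivity

variable {f : ℕ → ℝ≥0 → ℝ≥0∞} {B : ℝ≥0∞} {c T : ℝ≥0}

theorem le_pow_div_factorial_of_le_lintegral (h₀ : ∀ t ≤ T, f 0 t ≤ B)
    (hf : ∀ j, ∀ t ≤ T, f (j + 1) t ≤ ∫⁻ s in Ioc 0 (t : ℝ), c * f j s.toNNReal) (j : ℕ) :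
    ∀ t ≤ T, f j t ≤ B * ENNReal.ofReal ((c * t) ^ j / j.factorial) := by
  induction j with
  | zero => simpa using h₀
  | succ j ih =>
    intro t ht
    calc f (j + 1) t
        ≤ ∫⁻ s in Ioc 0 (t : ℝ), c * f j s.toNNReal := hf j t ht
      _ ≤ ∫⁻ s in Ioc 0 (t : ℝ), B * (c * ENNReal.ofReal ((c * s) ^ j / j.factorial)) := by
          refine setLIntegral_mono' measurableSet_Ioc fun s hs => ?_
          have hle := ih s.toNNReal ((Real.toNNReal_le_iff_le_coe.2 hs.2).trans ht)
          rw [Real.coe_toNNReal s hs.1.le] at hle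
          exact (mul_le_mul_right hle _).trans_eq (mul_left_comm _ _ _)
      _ = B * ENNReal.ofReal ((c * t) ^ (j + 1) / (j + 1).factorial) := by
          rw [lintegral_const_mul _ (by fun_prop), lintegral_pow_div_factorial]

theorem tendsto_zero_of_le_lintegral (hB : B ≠ ⊤) (h₀ : ∀ t ≤ T, f 0 t ≤ B)
    (hf : ∀ j, ∀ t ≤ T, f (j + 1) t ≤ ∫⁻ s in Ioc 0 (t : ℝ), c * f j s.toNNReal) :
    Tendsto (fun j => f j T) atTop (𝓝 0) := by
  have hlim : Tendsto (fun j : ℕ => B * ENNReal.ofReal ((c * T) ^ j / j.factorial))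
      atTop (𝓝 0) := by
    simpa using ENNReal.Tendsto.const_mul
      (ENNReal.tendsto_ofReal (FloorSemiring.tendsto_pow_div_factorial_atTop ((c : ℝ) * T)))
      (Or.inr hB)
  exact tendsto_of_tendsto_of_tendsto_of_le_of_le tendsto_const_nhds hlim (fun _ => zero_le)
    fun j => le_pow_div_factorial_of_le_lintegral h₀ hf j T le_rfl

end IteratedIntegral

section EventualLimit

/-- The limit in `𝔐(0,∞)` of an eventually constant sequence, as a countable operation; this makes
it a measurable function of random sequences. -/
def eventualLimit (ν : ℕ → LifeMeasure) : LifeMeasure :=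
  ⟨(limsupMeasure fun n => (ν n).1).restrict (Ioi 0), by
    rw [FiniteMeasure.null_iff_toMeasure_null, FiniteMeasure.restrict_measure_eq]
    simp [Measure.restrict_apply measurableSet_Iic, Iic_inter_Ioi]⟩

theorem eventualLimit_eq {ν : ℕ → LifeMeasure} {μ : LifeMeasure}
    (h : ∀ᶠ n in atTop, ν n = μ) : eventualLimit ν = μ := by
  have hlim : limsupMeasure (fun n => (ν n).1) = μ.1 :=
    limsupMeasure_eq_of_tendsto
      (tendsto_const_nhds.congr' (h.mono fun _ hn => congrArg Subtype.val hn.symm))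
  have hnull : (μ.1 : Measure ℝ) (Ioi 0)ᶜ = 0 := by
    rw [compl_Ioi, ← FiniteMeasure.ennreal_coeFn_eq_coeFn_toMeasure, μ.2, ENNReal.coe_zero]
  refine Subtype.ext (Subtype.ext ?_)
  change ((limsupMeasure fun n => (ν n).1 : FiniteMeasure ℝ) : Measure ℝ).restrict (Ioi 0) = μ.1
  rw [hlim]
  exact Measure.restrict_eq_self_of_ae_mem (measure_eq_zero_iff_ae_notMem.1 hnull |>.mono
    fun x hx => not_not.1 hx)

theorem measurable_eventualLimit {E : Type*} {mE : MeasurableSpace E} {ν : ℕ → E → LifeMeasure}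
    (hν : ∀ n, Measurable (ν n)) : Measurable fun x => eventualLimit fun n => ν n x := by
  have hlim := measurable_limsupMeasure fun n => measurable_subtype_coe.comp (hν n)
  refine Measurable.subtype_mk (Measurable.subtype_mk
    (Measure.measurable_of_measurable_coe _ fun C hC => ?_))
  simp only [Measure.restrict_apply hC]
  exact (measurable_finiteMeasure_apply (hC.inter measurableSet_Ioi)).comp hlim

end EventualLimit

section Path

variable {α : ℝ → ℝ} {p : ℝ → ℕ → ℝ} {K : ℝ≥0∞} {X Y : ℝ≥0 → LifeMeasure} {t : ℝ≥0}

theorem CadlagAt.congr {t' : ℝ≥0} (h : CadlagAt X t) (ht : t < t') (hXY : ∀ s ≤ t', X s = Y s) :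
    CadlagAt Y t := by
  obtain ⟨hright, ν, hleft⟩ := h
  refine ⟨hright.congr_of_eventuallyEq ?_ (hXY t ht.le).symm, ν, hleft.congr' ?_⟩
  · filter_upwards [mem_nhdsWithin_of_mem_nhds (Iio_mem_nhds ht)] with s hs
    exact (hXY s (le_of_lt hs)).symm
  · filter_upwards [self_mem_nhdsWithin] with s hs
    rw [hXY s ((le_of_lt hs).trans ht.le)]

theorem leftVersion_congr {s : ℝ} (hs : 0 < s) (h : ∀ r ≤ s.toNNReal, X r = Y r) :
    leftVersion X s = leftVersion Y s := by
  have hgrid : ∀ n, X (gridPoint n s) = Y (gridPoint n s) := fun n =>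
    h _ (NNReal.le_toNNReal_of_coe_le (gridPoint_lt n hs).le)
  simp only [leftVersion, hgrid]

theorem truncEvents_inter_time_le (K : ℝ≥0∞) (X : ℝ≥0 → LifeMeasure) {s : ℝ≥0} (hst : s ≤ t) :
    truncEvents α p K X t ∩ {q | q.1 ≤ s} = truncEvents α p K X s := by
  refine Subset.antisymm (fun q hq => ⟨⟨hq.1.1.1, hq.2⟩, hq.1.2⟩) fun q hq => ?_
  exact ⟨truncEvents_mono_time K X hst hq, hq.1.2⟩

/-- Once two consecutive iterates agree on `[0,t]`, the iteration has become stationary there. -/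
theorem eq_of_produces_succ {N : Measure NoisePoint} {μ : LifeMeasure}
    {Z : ℕ → ℝ≥0 → LifeMeasure} (hZ : ∀ n t, CadlagAt (Z n) t)
    (hprod : ∀ n t, Produces α p K N μ (Z n) (Z (n + 1)) t) {j : ℕ}
    (hj : ∀ s ≤ t, Z (j + 1) s = Z j s) {m : ℕ} (hm : j ≤ m) : ∀ s ≤ t, Z m s = Z j s := by
  induction m, hm using Nat.le_induction with
  | base => exact fun _ _ => rfl
  | succ m _ ih =>
    intro s hs
    have hevents : truncEvents α p K (Z m) s = truncEvents α p K (Z j) s :=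
      truncEvents_congr_path K (fun r _ => hZ m r) fun r hr => ih r (hr.le.trans hs)
    exact ((hprod m s).eq (hprod j s) hevents.eventuallyEq).trans (hj s hs)

end Path

section Picard

variable {α : ℝ → ℝ} {p : ℝ → ℕ → ℝ} {Ω : Type*}

/-- The event that two processes differ at some time up to `t`. -/
def disagreement (X Y : ℝ≥0 → Ω → LifeMeasure) (t : ℝ≥0) : Set Ω :=
  {ω | ∃ s ≤ t, X s ω ≠ Y s ω}

/-- The points up to time `t` that are reproduction events of exactly one of two processes. -/
def discrepancy (α : ℝ → ℝ) (p : ℝ → ℕ → ℝ) (K : ℝ≥0∞) (X Y : ℝ≥0 → Ω → LifeMeasure)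
    (t : ℝ≥0) : Set (Ω × NoisePoint) :=
  symmDiff (predictableEvents α p K X t) (predictableEvents α p K Y t)

theorem notMem_disagreement_of_discrepancy_null {K : ℝ≥0∞} {X Y X' Y' : ℝ≥0 → Ω → LifeMeasure}
    {N : Measure NoisePoint} {ω : Ω} {μ : LifeMeasure} (hX : ∀ t, CadlagAt (fun r => X r ω) t)
    (hY : ∀ t, CadlagAt (fun r => Y r ω) t)
    (hX' : ∀ t, Produces α p K N μ (fun r => X r ω) (fun r => X' r ω) t)
    (hY' : ∀ t, Produces α p K N μ (fun r => Y r ω) (fun r => Y' r ω) t) {t : ℝ≥0}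
    (h : N (Prod.mk ω ⁻¹' discrepancy α p K X Y t) = 0) : ω ∉ disagreement X' Y' t := by
  rintro ⟨s, hs, hne⟩
  have hevents : truncEvents α p K (fun r => X r ω) t =ᵐ[N]
      truncEvents α p K (fun r => Y r ω) t := by
    rw [truncEvents_eq_eventSet K fun s _ => hX s, truncEvents_eq_eventSet K fun s _ => hY s]
    exact measure_symmDiff_eq_zero_iff.1 h
  refine hne ((hX' s).eq (hY' s) ?_)
  rw [← truncEvents_inter_time_le K _ hs, ← truncEvents_inter_time_le K _ hs]
  exact hevents.inter EventuallyEq.rfl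

variable {mΩ : MeasurableSpace Ω} {P : Measure Ω} {F : Filtration ℝ≥0 mΩ}
  {M : Ω → Measure NoisePoint} {G : Measure ℝ} [IsProbabilityMeasure G]

theorem measurableSet_discrepancy (h : IsMeasurableMechanism α p) (K : ℝ≥0∞)
    {X Y : ℝ≥0 → Ω → LifeMeasure} (hX : ∀ t, Measurable[F t] (X t))
    (hY : ∀ t, Measurable[F t] (Y t)) (t : ℝ≥0) :
    MeasurableSet[predictableSigma F] (discrepancy α p K X Y t) :=
  (measurableSet_predictableEvents h K hX t).symmDiff (measurableSet_predictableEvents h K hY t)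

theorem lintegral_discrepancy_le (G : Measure ℝ) [IsProbabilityMeasure G]
    (h : IsMeasurableMechanism α p) (K : ℝ≥0∞) (X Y : ℝ≥0 → Ω → LifeMeasure) {t : ℝ≥0} {s : ℝ}
    (hs : s ∈ Ioc 0 (t : ℝ)) (ω : Ω) :
    ∫⁻ _ in {r | (ω, (s, r)) ∈ discrepancy α p K X Y t}, 1 ∂(tailIntensity G) ≤
      (disagreement X Y s.toNNReal).indicator
        (fun _ => 2 * (eventRate α p (fun _ => 1) * K)) ω := by
  have hsection : {r | (ω, (s, r)) ∈ discrepancy α p K X Y t} =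
      symmDiff (reproduces α p K (leftVersion (fun r => X r ω) s))
        (reproduces α p K (leftVersion (fun r => Y r ω) s)) := by
    rw [← predictableEvents_time_section hs, ← predictableEvents_time_section hs]
    rfl
  rw [hsection]
  by_cases hω : ω ∈ disagreement X Y s.toNNReal
  · rw [indicator_of_mem hω, two_mul]
    calc ∫⁻ _ in symmDiff _ _, 1 ∂(tailIntensity G)
        ≤ _ := lintegral_mono_set symmDiff_le_sup
      _ ≤ _ := lintegral_union_le _ _ _
      _ ≤ _ := add_le_add (lintegral_reproduces_le_level G h _ K fun _ => 1)
        (lintegral_reproduces_le_level G h _ K fun _ => 1)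
  · have hagree : ∀ r ≤ s.toNNReal, X r ω = Y r ω := fun r hr =>
      not_not.1 fun hne => hω ⟨r, hr, hne⟩
    rw [leftVersion_congr hs.1 hagree, symmDiff_self]
    simp

theorem IsPoissonRandomMeasure.measure_section_ne_zero_le
    (hM : IsPoissonRandomMeasure P F (intensity G) M) {D : Set (Ω × NoisePoint)}
    (hD : MeasurableSet D) :
    P {ω | M ω (Prod.mk ω ⁻¹' D) ≠ 0} ≤ ∫⁻ ω, M ω (Prod.mk ω ⁻¹' D) ∂P := by
  refine (measure_mono fun ω (hω : M ω (Prod.mk ω ⁻¹' D) ≠ 0) => ?_).trans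
    (by simpa using mul_meas_ge_le_lintegral₀ (hM.aemeasurable_section hD) 1)
  obtain ⟨k, hk⟩ := hM.integer_valued ω _ (measurable_prodMk_left (x := ω) hD)
  have hk0 : k ≠ 0 := fun h => hω (by simp [hk, h])
  change 1 ≤ M ω (Prod.mk ω ⁻¹' D)
  rw [hk]
  exact_mod_cast Order.one_le_iff_ne_zero.2 hk0

variable [IsProbabilityMeasure P]

theorem IsPoissonRandomMeasure.measure_disagreement_le
    (hM : IsPoissonRandomMeasure P F (intensity G) M) (h : IsMeasurableMechanism α p) {K : ℝ≥0∞}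
    {X₀ : Ω → LifeMeasure} {X Y X' Y' : ℝ≥0 → Ω → LifeMeasure} (hX : ∀ t, Measurable[F t] (X t))
    (hY : ∀ t, Measurable[F t] (Y t)) (hXcadlag : ∀ ω t, CadlagAt (fun r => X r ω) t)
    (hYcadlag : ∀ ω t, CadlagAt (fun r => Y r ω) t)
    (hX' : ∀ᵐ ω ∂P, ∀ t, Produces α p K (M ω) (X₀ ω) (fun r => X r ω) (fun r => X' r ω) t)
    (hY' : ∀ᵐ ω ∂P, ∀ t, Produces α p K (M ω) (X₀ ω) (fun r => Y r ω) (fun r => Y' r ω) t)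
    (t : ℝ≥0) :
    P (disagreement X' Y' t) ≤ ∫⁻ s in Ioc 0 (t : ℝ),
      2 * (eventRate α p (fun _ => 1) * K) * P (disagreement X Y s.toNNReal) := by
  have hD := measurableSet_discrepancy (F := F) h K hX hY t
  calc P (disagreement X' Y' t)
      ≤ P {ω | M ω (Prod.mk ω ⁻¹' discrepancy α p K X Y t) ≠ 0} := by
        refine measure_mono_ae ?_
        filter_upwards [hX', hY'] with ω hωX hωY hω hnull
        exact notMem_disagreement_of_discrepancy_null (hXcadlag ω) (hYcadlag ω) hωX hωY hnull hω
    _ ≤ ∫⁻ ω, M ω (Prod.mk ω ⁻¹' discrepancy α p K X Y t) ∂P :=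
        hM.measure_section_ne_zero_le (predictableSigma_le F _ hD)
    _ = ∫⁻ ω, ∫⁻ _ in Prod.mk ω ⁻¹' discrepancy α p K X Y t, 1 ∂(M ω) ∂P := by simp
    _ ≤ ∫⁻ s in Ioc 0 (t : ℝ), ∫⁻ ω, (disagreement X Y s.toNNReal).indicator
          (fun _ => 2 * (eventRate α p (fun _ => 1) * K)) ω ∂P := by
        refine hM.lintegral_setLIntegral_le_of_rate_le hD ?_ (fun _ => 1) _
          (Eventually.of_forall fun ω s hs => lintegral_discrepancy_le G h K X Y hs ω)
        rintro x (hx | hx) <;> exact time_mem_of_mem_predictableEvents hx.1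
    _ ≤ _ := lintegral_mono fun s => lintegral_indicator_const_le _ _

theorem exists_picard_sequence (hM : IsPoissonRandomMeasure P F (intensity G) M)
    (hF : ∀ N : Set Ω, P N = 0 → MeasurableSet[F 0] N) (h : IsMeasurableMechanism α p) (K : ℕ)
    {X₀ : Ω → LifeMeasure} (hX₀ : Measurable[F 0] X₀) :
    ∃ X : ℕ → ℝ≥0 → Ω → LifeMeasure, (∀ n t, Measurable[F t] (X n t)) ∧
      (∀ n ω t, CadlagAt (fun r => X n r ω) t) ∧
      ∀ᵐ ω ∂P, ∀ n t, Produces α p K (M ω) (X₀ ω) (fun r => X n r ω) (fun r => X (n + 1) r ω) t ∧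
        totalMass (X (n + 1) t ω) ≤ totalMass (X₀ ω) +
          ∫⁻ q in truncEvents α p K (fun r => X n r ω) t, (offspring q : ℝ≥0∞) ∂(M ω) := by
  let Proc := {X : ℝ≥0 → Ω → LifeMeasure //
    (∀ t, Measurable[F t] (X t)) ∧ ∀ ω t, CadlagAt (fun r => X r ω) t}
  have hstep : ∀ X : Proc, ∃ Y : Proc, ∀ᵐ ω ∂P, ∀ t,
      Produces α p K (M ω) (X₀ ω) (fun r => X.1 r ω) (fun r => Y.1 r ω) t ∧
        totalMass (Y.1 t ω) ≤ totalMass (X₀ ω) +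
          ∫⁻ q in truncEvents α p K (fun r => X.1 r ω) t, (offspring q : ℝ≥0∞) ∂(M ω) := by
    rintro ⟨X, hX, hXcadlag⟩
    obtain ⟨Y, hY, hYcadlag, hprod⟩ := hM.exists_produces hF h K hX₀ hX hXcadlag
    exact ⟨⟨Y, hY, hYcadlag⟩, hprod⟩
  choose Φ hΦ using hstep
  let zero : Proc := ⟨fun _ _ => ⟨0, by simp⟩, fun _ => measurable_const,
    fun _ _ => ⟨continuousWithinAt_const, 0, tendsto_const_nhds⟩⟩
  refine ⟨fun n => (Φ^[n] zero).1, fun n => (Φ^[n] zero).2.1, fun n => (Φ^[n] zero).2.2, ?_⟩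
  refine ae_all_iff.2 fun n => ?_
  simp_rw [Function.iterate_succ_apply']
  exact hΦ _

theorem IsPoissonRandomMeasure.ae_picard_eventually_eq
    (hM : IsPoissonRandomMeasure P F (intensity G) M) (h : IsMeasurableMechanism α p) {K : ℕ}
    {X₀ : Ω → LifeMeasure} {X : ℕ → ℝ≥0 → Ω → LifeMeasure} (hX : ∀ n t, Measurable[F t] (X n t))
    (hcadlag : ∀ n ω t, CadlagAt (fun r => X n r ω) t)
    (hprod : ∀ᵐ ω ∂P, ∀ n t,
      Produces α p K (M ω) (X₀ ω) (fun r => X n r ω) (fun r => X (n + 1) r ω) t) :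
    ∀ᵐ ω ∂P, ∀ t : ℝ≥0, ∃ n, ∀ m ≥ n, ∀ s ≤ t, X m s ω = X n s ω := by
  let D : ℕ → ℝ≥0 → Set Ω := fun j => disagreement (X (j + 1)) (X j)
  obtain ⟨c, hc⟩ : ∃ c : ℝ≥0, (c : ℝ≥0∞) = 2 * (eventRate α p (fun _ => 1) * K) :=
    ENNReal.canLift.prf _ (by have := h.eventRate_one_lt_top; finiteness)
  have hD : ∀ j t, P (D (j + 1) t) ≤ ∫⁻ s in Ioc 0 (t : ℝ), c * P (D j s.toNNReal) := fun j => by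
    rw [hc]
    exact hM.measure_disagreement_le h (hX _) (hX _) (hcadlag _) (hcadlag _)
      (hprod.mono fun ω hω => hω (j + 1)) (hprod.mono fun ω hω => hω j)
  have hnull : ∀ t, P (⋂ j, D j t) = 0 := fun t =>
    le_antisymm (ge_of_tendsto' (tendsto_zero_of_le_lintegral (f := fun j t => P (D j t)) (T := t)
      ENNReal.one_ne_top (fun _ _ => prob_le_one) fun j t _ => hD j t) fun j =>
        measure_mono (iInter_subset _ j)) zero_le
  have hagree : ∀ᵐ ω ∂P, ∀ k : ℕ, ∃ j, ∀ s ≤ (k : ℝ≥0), X (j + 1) s ω = X j s ω := by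
    refine ae_all_iff.2 fun k => (measure_eq_zero_iff_ae_notMem.1 (hnull k)).mono fun ω hω => ?_
    simpa [D, disagreement] using hω
  filter_upwards [hagree, hprod] with ω hω hprodω t
  obtain ⟨k, hk⟩ := exists_nat_ge t
  obtain ⟨j, hj⟩ := hω k
  exact ⟨j, fun m hm s hs => eq_of_produces_succ (Z := fun n s => X n s ω)
    (fun n => hcadlag n ω) hprodω hj hm s (hs.trans hk)⟩

theorem exists_truncated_solution (hM : IsPoissonRandomMeasure P F (intensity G) M)
    (hF : ∀ N : Set Ω, P N = 0 → MeasurableSet[F 0] N) (h : IsMeasurableMechanism α p) (K : ℕ)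
    {X₀ : Ω → LifeMeasure} (hX₀ : Measurable[F 0] X₀) :
    ∃ X : ℝ≥0 → Ω → LifeMeasure, (∀ t, Measurable[F t] (X t)) ∧
      ∀ᵐ ω ∂P, ∀ t, CadlagAt (fun r => X r ω) t ∧
        Produces α p K (M ω) (X₀ ω) (fun r => X r ω) (fun r => X r ω) t ∧
        totalMass (X t ω) ≤ totalMass (X₀ ω) +
          ∫⁻ q in truncEvents α p K (fun r => X r ω) t, (offspring q : ℝ≥0∞) ∂(M ω) := by
  obtain ⟨Y, hY, hcadlag, hprod⟩ := exists_picard_sequence hM hF h K hX₀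
  have hstable := hM.ae_picard_eventually_eq h hY hcadlag
    (hprod.mono fun ω hω n t => (hω n t).1)
  refine ⟨fun t ω => eventualLimit fun n => Y n t ω,
    fun t => @measurable_eventualLimit _ (F t) _ fun n => hY n t, ?_⟩
  filter_upwards [hstable, hprod] with ω hω hprodω t
  obtain ⟨n, hn⟩ := hω (t + 1)
  have hlim : ∀ m ≥ n, ∀ s ≤ t + 1, Y m s ω = eventualLimit fun n => Y n s ω :=
    fun m hm s hs => (hn m hm s hs).trans (eventualLimit_eq
      (eventually_atTop.2 ⟨n, fun m hm => hn m hm s hs⟩)).symm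
  have ht : t < t + 1 := lt_add_one t
  have hevents := truncEvents_congr_path (α := α) (p := p) K (fun s (_ : s ≤ t) => hcadlag n ω s)
    fun s hs => hlim n le_rfl s (hs.le.trans ht.le)
  have hsucc := hprodω n t
  rw [Produces, hevents, hlim (n + 1) n.le_succ t ht.le] at hsucc
  exact ⟨(hcadlag n ω t).congr ht (hlim n le_rfl), hsucc⟩

end Picard

section Gronwall

variable {a C : ℝ≥0∞} {c t : ℝ≥0}

theorem add_lintegral_mul_exp (a : ℝ≥0∞) (c t : ℝ≥0) :
    a + ∫⁻ s in Ioc 0 (t : ℝ), c * (a * ENNReal.ofReal (Real.exp (c * s))) =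
      a * ENNReal.ofReal (Real.exp (c * t)) := by
  have hint : ∫⁻ s in Ioc 0 (t : ℝ), ENNReal.ofReal (Real.exp (c * s) * c) =
      ENNReal.ofReal (Real.exp (c * t) - 1) := by
    rw [← ofReal_integral_eq_lintegral_ofReal (Continuous.integrableOn_Ioc (by fun_prop))
      (Eventually.of_forall fun s => by positivity),
      ← intervalIntegral.integral_of_le t.coe_nonneg,
      intervalIntegral.integral_eq_sub_of_hasDerivAt (f := fun s : ℝ => Real.exp (c * s))
        (fun s _ => by simpa using ((hasDerivAt_id s).const_mul (c : ℝ)).exp)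
        (Continuous.intervalIntegrable (by fun_prop) _ _)]
    simp
  have hmul : ∀ s : ℝ, (c : ℝ≥0∞) * (a * ENNReal.ofReal (Real.exp (c * s))) =
      a * ENNReal.ofReal (Real.exp (c * s) * c) := fun s => by
    rw [ENNReal.ofReal_mul (Real.exp_nonneg _), ENNReal.ofReal_coe_nnreal]
    ring
  simp_rw [hmul]
  rw [lintegral_const_mul _ (by fun_prop), hint]
  nth_rw 1 [← mul_one a]
  rw [← mul_add, ← ENNReal.ofReal_one, ← ENNReal.ofReal_add zero_le_one, add_sub_cancel]
  exact sub_nonneg.2 (Real.one_le_exp (by positivity))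

/-- Grönwall's inequality without measurability of `φ`: the excess of `φ` over the exponential
satisfies the homogeneous integral inequality, so iteration shows that it vanishes. -/
theorem le_mul_exp_of_le_add_lintegral {φ : ℝ≥0 → ℝ≥0∞} (hC : C ≠ ⊤) (hφC : ∀ s ≤ t, φ s ≤ C)
    (hφ : ∀ s ≤ t, φ s ≤ a + ∫⁻ r in Ioc 0 (s : ℝ), c * φ r.toNNReal) :
    φ t ≤ a * ENNReal.ofReal (Real.exp (c * t)) := by
  let e : ℝ → ℝ≥0∞ := fun s => a * ENNReal.ofReal (Real.exp (c * s))
  let excess : ℝ≥0 → ℝ≥0∞ := fun s => φ s - e s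
  have hexcess : ∀ s ≤ t, excess s ≤ ∫⁻ r in Ioc 0 (s : ℝ), c * excess r.toNNReal := fun s hs => by
    refine tsub_le_iff_left.2 ?_
    calc φ s
        ≤ a + ∫⁻ r in Ioc 0 (s : ℝ), c * φ r.toNNReal := hφ s hs
      _ ≤ a + ∫⁻ r in Ioc 0 (s : ℝ), (c * e r + c * excess r.toNNReal) := by
          refine add_le_add le_rfl (setLIntegral_mono' measurableSet_Ioc fun r hr => ?_)
          rw [← mul_add]
          refine mul_le_mul_right ?_ _
          have hle : φ r.toNNReal ≤ e r.toNNReal + excess r.toNNReal := le_add_tsub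
          rwa [Real.coe_toNNReal r hr.1.le] at hle
      _ = e s + ∫⁻ r in Ioc 0 (s : ℝ), c * excess r.toNNReal := by
          rw [lintegral_add_left (by fun_prop), ← add_assoc, add_lintegral_mul_exp]
  have hlim := tendsto_zero_of_le_lintegral (f := fun _ => excess) hC
    (fun s hs => tsub_le_self.trans (hφC s hs)) fun _ => hexcess
  exact tsub_eq_zero_iff_le.1 (tendsto_nhds_unique tendsto_const_nhds hlim)

end Gronwall

section Progeny

variable {α : ℝ → ℝ} {p : ℝ → ℕ → ℝ} {Ω : Type*}

/-- The initial mass together with all births up to time `t` along the random path `X`, when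
reproduction is stopped above the mass `K`. -/
def progeny (M : Ω → Measure NoisePoint) (X₀ : Ω → LifeMeasure) (α : ℝ → ℝ) (p : ℝ → ℕ → ℝ)
    (K : ℝ≥0∞) (X : ℝ≥0 → Ω → LifeMeasure) (t : ℝ≥0) (ω : Ω) : ℝ≥0∞ :=
  totalMass (X₀ ω) +
    ∫⁻ q in Prod.mk ω ⁻¹' predictableEvents α p K X t, (offspring q : ℝ≥0∞) ∂(M ω)

variable {M : Ω → Measure NoisePoint} {X₀ : Ω → LifeMeasure}

theorem progeny_mono (K : ℝ≥0∞) (X : ℝ≥0 → Ω → LifeMeasure) (ω : Ω) :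
    Monotone fun t => progeny M X₀ α p K X t ω := fun _ _ hst =>
  add_le_add le_rfl (lintegral_mono_set fun _ hq => ⟨hq.1, hq.2.trans (NNReal.coe_le_coe.2 hst)⟩)

theorem progeny_eq_truncEvents {K : ℝ≥0∞} {X : ℝ≥0 → Ω → LifeMeasure} {ω : Ω} {t : ℝ≥0}
    (hX : ∀ s ≤ t, CadlagAt (fun r => X r ω) s) :
    progeny M X₀ α p K X t ω = totalMass (X₀ ω) +
      ∫⁻ q in truncEvents α p K (fun r => X r ω) t, (offspring q : ℝ≥0∞) ∂(M ω) := by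
  rw [truncEvents_eq_eventSet K hX]
  rfl

theorem measurable_totalMass : Measurable totalMass :=
  (measurable_finiteMeasure_apply MeasurableSet.univ).comp measurable_subtype_coe

variable {mΩ : MeasurableSpace Ω} {P : Measure Ω} {F : Filtration ℝ≥0 mΩ} {G : Measure ℝ}
  [IsProbabilityMeasure G]

theorem aemeasurable_progeny (hM : IsPoissonRandomMeasure P F (intensity G) M)
    (h : IsMeasurableMechanism α p) (hX₀ : Measurable X₀) (K : ℝ≥0∞)
    {X : ℝ≥0 → Ω → LifeMeasure} (hX : ∀ t, Measurable[F t] (X t)) (t : ℝ≥0) :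
    AEMeasurable (progeny M X₀ α p K X t) P :=
  (measurable_totalMass.comp hX₀).aemeasurable.add
    (hM.aemeasurable_setLIntegral_predictableEvents h K hX t fun n => n)

theorem setLIntegral_section {A : Set Ω} (hA : MeasurableSet A) (D : Set (Ω × NoisePoint))
    (f : NoisePoint → ℝ≥0∞) :
    ∫⁻ ω in A, (∫⁻ q in Prod.mk ω ⁻¹' D, f q ∂(M ω)) ∂P =
      ∫⁻ ω, ∫⁻ q in Prod.mk ω ⁻¹' (Prod.fst ⁻¹' A ∩ D), f q ∂(M ω) ∂P := by
  rw [← lintegral_indicator hA]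
  refine lintegral_congr fun ω => ?_
  by_cases hω : ω ∈ A <;> simp [hω, preimage_preimage]

theorem lintegral_reproduces_leftVersion_le (h : IsMeasurableMechanism α p) (K : ℝ≥0∞)
    {X : ℝ≥0 → LifeMeasure} {s : ℝ} (hs : 0 < s) (hX : CadlagAt X s.toNNReal) {C : ℝ≥0∞}
    (hC : ∀ r < s.toNNReal, totalMass (X r) ≤ C) :
    ∫⁻ r in reproduces α p K (leftVersion X s), (r.2.1.2.1 : ℝ≥0∞) ∂(tailIntensity G) ≤
      growthRate α p * C := by
  lift s to ℝ≥0 using hs.le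
  rw [Real.toNNReal_coe] at hX hC
  have hs' : 0 < s := NNReal.coe_pos.1 hs
  refine (lintegral_reproduces_le_mass G h _ K fun n => n).trans (mul_le_mul_right ?_ _)
  rw [leftVersion_eq_leftLimit hs' hX]
  exact mass_leftLimit_le hs' hX (eventually_nhdsWithin_of_forall hC)

end Progeny

section TruncatedSolution

/-- `X` is an adapted càdlàg solution of the equation in which reproduction is stopped above the
mass `K`, and its mass at any time is at most its progeny up to that time. -/
structure IsTruncatedSolution {Ω : Type*} {mΩ : MeasurableSpace Ω} (P : Measure Ω)
    (F : Filtration ℝ≥0 mΩ) (α : ℝ → ℝ) (p : ℝ → ℕ → ℝ) (M : Ω → Measure NoisePoint)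
    (X₀ : Ω → LifeMeasure) (K : ℝ≥0∞) (X : ℝ≥0 → Ω → LifeMeasure) : Prop where
  adapted : ∀ t, Measurable[F t] (X t)
  cadlag : ∀ᵐ ω ∂P, ∀ t, CadlagAt (fun r => X r ω) t
  produces : ∀ᵐ ω ∂P, ∀ t, Produces α p K (M ω) (X₀ ω) (fun r => X r ω) (fun r => X r ω) t
  totalMass_le : ∀ᵐ ω ∂P, ∀ t, totalMass (X t ω) ≤ progeny M X₀ α p K X t ω

variable {α : ℝ → ℝ} {p : ℝ → ℕ → ℝ} {Ω : Type*} {mΩ : MeasurableSpace Ω} {P : Measure Ω}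
  [IsProbabilityMeasure P] {F : Filtration ℝ≥0 mΩ} {M : Ω → Measure NoisePoint} {G : Measure ℝ}
  [IsProbabilityMeasure G] {X₀ : Ω → LifeMeasure}

theorem exists_isTruncatedSolution (hM : IsPoissonRandomMeasure P F (intensity G) M)
    (hF : ∀ N : Set Ω, P N = 0 → MeasurableSet[F 0] N) (h : IsMeasurableMechanism α p)
    (hX₀ : Measurable[F 0] X₀) (K : ℕ) : ∃ X, IsTruncatedSolution P F α p M X₀ K X := by
  obtain ⟨X, adapted, hX⟩ := exists_truncated_solution hM hF h K hX₀
  refine ⟨X, adapted, hX.mono fun ω hω t => (hω t).1, hX.mono fun ω hω t => (hω t).2.1, ?_⟩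
  filter_upwards [hX] with ω hω t
  exact (hω t).2.2.trans_eq (progeny_eq_truncEvents fun s _ => (hω s).1).symm

theorem IsTruncatedSolution.setLIntegral_births_le {K : ℝ≥0∞} {X : ℝ≥0 → Ω → LifeMeasure}
    (hX : IsTruncatedSolution P F α p M X₀ K X)
    (hM : IsPoissonRandomMeasure P F (intensity G) M) (h : IsMeasurableMechanism α p)
    {A : Set Ω} (hA : MeasurableSet[F 0] A) (t : ℝ≥0) :
    ∫⁻ ω in A, (∫⁻ q in Prod.mk ω ⁻¹' predictableEvents α p K X t, (offspring q : ℝ≥0∞) ∂(M ω)) ∂P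
      ≤ ∫⁻ s in Ioc 0 (t : ℝ),
        growthRate α p * ∫⁻ ω in A, progeny M X₀ α p K X s.toNNReal ω ∂P := by
  have hA' : MeasurableSet A := F.le 0 _ hA
  rw [setLIntegral_section hA']
  refine (hM.lintegral_setLIntegral_le_of_rate_le
    ((measurable_fst_predictable F hA).inter (measurableSet_predictableEvents h K hX.adapted t))
    (fun x hx => time_mem_of_mem_predictableEvents hx.2) (fun n => n)
    (fun s => A.indicator fun ω => growthRate α p * progeny M X₀ α p K X s.toNNReal ω)
    ?_).trans_eq ?_
  · filter_upwards [hX.cadlag, hX.totalMass_le] with ω cadlag hmass s hs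
    by_cases hω : ω ∈ A
    · rw [indicator_of_mem hω]
      refine (lintegral_mono_set fun r hr => hr.2).trans ?_
      change ∫⁻ r in {r | (ω, (s, r)) ∈ predictableEvents α p K X t}, _ ∂_ ≤ _
      rw [predictableEvents_time_section hs]
      exact lintegral_reproduces_leftVersion_le h K hs.1 (cadlag _)
        fun r hr => (hmass r).trans (progeny_mono K X ω hr.le)
    · simp [hω]
  · refine lintegral_congr fun s => ?_
    rw [lintegral_indicator hA', lintegral_const_mul' _ _ h.growthRate_lt_top.ne]

theorem IsTruncatedSolution.setLIntegral_progeny_le {K : ℕ} {X : ℝ≥0 → Ω → LifeMeasure}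
    (hX : IsTruncatedSolution P F α p M X₀ K X)
    (hM : IsPoissonRandomMeasure P F (intensity G) M) (h : IsMeasurableMechanism α p)
    (hX₀ : Measurable X₀) {A : Set Ω} (hA : MeasurableSet[F 0] A) (t : ℝ≥0) :
    ∫⁻ ω in A, progeny M X₀ α p K X t ω ∂P ≤ (∫⁻ ω in A, totalMass (X₀ ω) ∂P) *
      ENNReal.ofReal (Real.exp ((growthRate α p).toReal * t)) := by
  by_cases hmass : ∫⁻ ω in A, totalMass (X₀ ω) ∂P = ⊤
  · rw [hmass, ENNReal.top_mul (by simpa using Real.exp_pos _)]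
    exact le_top
  have hsplit : ∀ s, ∫⁻ ω in A, progeny M X₀ α p K X s ω ∂P = ∫⁻ ω in A, totalMass (X₀ ω) ∂P +
      ∫⁻ ω in A, (∫⁻ q in Prod.mk ω ⁻¹' predictableEvents α p K X s,
        (offspring q : ℝ≥0∞) ∂(M ω)) ∂P :=
    fun s => lintegral_add_left (measurable_totalMass.comp hX₀) _
  have hrate := h.growthRate_lt_top
  refine le_mul_exp_of_le_add_lintegral (c := (growthRate α p).toNNReal)
    (C := ∫⁻ ω in A, totalMass (X₀ ω) ∂P + growthRate α p * K * t) (by finiteness)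
    (φ := fun s => ∫⁻ ω in A, progeny M X₀ α p K X s ω ∂P) (fun s hs => ?_) fun s _ => ?_
  · rw [hsplit]
    refine add_le_add le_rfl ((setLIntegral_le_lintegral _ _).trans ?_)
    refine (hM.lintegral_predictableEvents_le_level h K hX.adapted s fun n => n).trans ?_
    rw [← growthRate_eq_eventRate]
    gcongr
  · rw [hsplit, ENNReal.coe_toNNReal hrate.ne]
    exact add_le_add le_rfl (hX.setLIntegral_births_le hM h hA s)

end TruncatedSolution

section Consistency

variable {α : ℝ → ℝ} {p : ℝ → ℕ → ℝ}

theorem eq_of_produces_of_totalMass_le {k m : ℝ≥0∞} (hkm : k ≤ m) {N : Measure NoisePoint}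
    (hN : ∀ B, MeasurableSet B → ∃ j : ℕ∞, N B = (j : ℝ≥0∞)) {μ : LifeMeasure}
    {X Y : ℝ≥0 → LifeMeasure} {t : ℝ≥0}
    (hX : ∀ s ≤ t, CadlagAt X s) (hY : ∀ s ≤ t, CadlagAt Y s)
    (hXfin : ∀ j : ℕ, N (truncEvents α p j X t) < ⊤)
    (hYfin : ∀ j : ℕ, N (truncEvents α p j Y t) < ⊤)
    (hXeq : ∀ s ≤ t, Produces α p k N μ X X s) (hYeq : ∀ s ≤ t, Produces α p m N μ Y Y s)
    (hmass : ∀ s ≤ t, totalMass (X s) ≤ k) :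
    (∀ s ≤ t, Y s = X s) ∧ truncEvents α p m Y t = truncEvents α p k X t := by
  have hlevel : ∀ s ≤ t, truncEvents α p k X s = truncEvents α p m X s := fun s hs =>
    truncEvents_congr_level (fun r hr => hX r (hr.trans hs))
      (fun r hr => hmass r (hr.le.trans hs)) hkm
  have hXeq' : ∀ s ≤ t, Produces α p m N μ X X s := fun s hs => by
    have hprod := hXeq s hs
    rwa [Produces, hlevel s hs] at hprod
  have heq := eq_of_produces hN hY hX hYfin hXfin hYeq hXeq'
  refine ⟨heq, ?_⟩
  rw [hlevel t le_rfl]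
  exact truncEvents_congr_path m hY fun s hs => heq s hs.le

variable {Ω : Type*} {mΩ : MeasurableSpace Ω} {P : Measure Ω} [IsProbabilityMeasure P]
  {F : Filtration ℝ≥0 mΩ} {M : Ω → Measure NoisePoint} {G : Measure ℝ} [IsProbabilityMeasure G]
  {X₀ : Ω → LifeMeasure} {Y : ℕ → ℝ≥0 → Ω → LifeMeasure}

theorem measure_totalMass_le_inter_progeny_ge_eq_zero
    (hM : IsPoissonRandomMeasure P F (intensity G) M) (h : IsMeasurableMechanism α p)
    (hX₀ : Measurable[F 0] X₀) (hY : ∀ K : ℕ, IsTruncatedSolution P F α p M X₀ K (Y K))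
    (m : ℕ) (t : ℝ≥0) :
    P ({ω | totalMass (X₀ ω) ≤ m} ∩
      ⋂ K : ℕ, {ω | (K : ℝ≥0∞) ≤ progeny M X₀ α p K (Y K) t ω}) = 0 := by
  by_contra hne
  set A : Set Ω := {ω | totalMass (X₀ ω) ≤ m}
  have hA : MeasurableSet[F 0] A := (measurable_totalMass.comp hX₀) measurableSet_Iic
  have hX₀' : Measurable X₀ := hX₀.mono (F.le 0) le_rfl
  have hinit : ∫⁻ ω in A, totalMass (X₀ ω) ∂P ≤ m :=
    calc ∫⁻ ω in A, totalMass (X₀ ω) ∂P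
        ≤ ∫⁻ _ in A, (m : ℝ≥0∞) ∂P := setLIntegral_mono' (F.le 0 _ hA) fun ω hω => hω
      _ = m * P A := setLIntegral_const _ _
      _ ≤ m := mul_le_of_le_one_right' prob_le_one
  set c : ℝ≥0∞ := m * ENNReal.ofReal (Real.exp ((growthRate α p).toReal * t))
  obtain ⟨K, hK⟩ := ENNReal.exists_nat_mul_gt hne (show c ≠ ⊤ by finiteness)
  refine absurd hK (not_lt.2 ?_)
  calc (K : ℝ≥0∞) * P (A ∩ ⋂ K : ℕ, {ω | (K : ℝ≥0∞) ≤ progeny M X₀ α p K (Y K) t ω})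
      ≤ K * (P.restrict A) {ω | (K : ℝ≥0∞) ≤ progeny M X₀ α p K (Y K) t ω} := by
        refine mul_le_mul_right ?_ _
        rw [Measure.restrict_apply' (F.le 0 _ hA), inter_comm]
        exact measure_mono (inter_subset_inter_left _ (iInter_subset _ K))
    _ ≤ ∫⁻ ω in A, progeny M X₀ α p K (Y K) t ω ∂P := mul_meas_ge_le_lintegral₀
        (aemeasurable_progeny hM h hX₀' K (hY K).adapted t).restrict _
    _ ≤ (∫⁻ ω in A, totalMass (X₀ ω) ∂P) *
          ENNReal.ofReal (Real.exp ((growthRate α p).toReal * t)) :=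
        (hY K).setLIntegral_progeny_le hM h hX₀' hA t
    _ ≤ c := mul_le_mul_left hinit _

theorem ae_exists_progeny_le (hM : IsPoissonRandomMeasure P F (intensity G) M)
    (h : IsMeasurableMechanism α p) (hX₀ : Measurable[F 0] X₀)
    (hY : ∀ K : ℕ, IsTruncatedSolution P F α p M X₀ K (Y K)) :
    ∀ᵐ ω ∂P, ∀ t : ℝ≥0, ∃ K : ℕ, progeny M X₀ α p K (Y K) t ω ≤ K := by
  filter_upwards [ae_all_iff.2 fun m : ℕ => ae_all_iff.2 fun n : ℕ =>
    measure_eq_zero_iff_ae_notMem.1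
      (measure_totalMass_le_inter_progeny_ge_eq_zero hM h hX₀ hY m n)] with ω hω t
  obtain ⟨n, hn⟩ := exists_nat_ge t
  obtain ⟨m, hm⟩ := ENNReal.exists_nat_gt (show totalMass (X₀ ω) ≠ ⊤ from measure_ne_top _ _)
  by_contra! hexceeds
  exact hω m n ⟨hm.le, mem_iInter.2 fun K => (hexceeds K).le.trans (progeny_mono K (Y K) ω hn)⟩

theorem ae_truncated_solutions_consistent (hM : IsPoissonRandomMeasure P F (intensity G) M)
    (h : IsMeasurableMechanism α p) (hX₀ : Measurable[F 0] X₀)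
    (hY : ∀ K : ℕ, IsTruncatedSolution P F α p M X₀ K (Y K)) :
    ∀ᵐ ω ∂P, ∀ t : ℝ≥0, ∃ n : ℕ, ∀ m ≥ n, (∀ s ≤ t, Y m s ω = Y n s ω) ∧
      progeny M X₀ α p m (Y m) t ω ≤ m := by
  filter_upwards [ae_all_iff.2 fun K => (hY K).cadlag, ae_all_iff.2 fun K => (hY K).produces,
    ae_all_iff.2 fun K => (hY K).totalMass_le,
    ae_all_iff.2 fun K => hM.ae_truncEvents_lt_top h (hY K).adapted,
    ae_exists_progeny_le hM h hX₀ hY] with ω cadlag hprod hmass hfin hprogeny t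
  obtain ⟨n, hn⟩ := hprogeny t
  refine ⟨n, fun m hm => ?_⟩
  have hnm : (n : ℝ≥0∞) ≤ m := Nat.cast_le.2 hm
  obtain ⟨heq, hevents⟩ := eq_of_produces_of_totalMass_le (μ := X₀ ω) hnm (hM.integer_valued ω)
    (fun s (_ : s ≤ t) => cadlag n s) (fun s _ => cadlag m s)
    (fun j => hfin n j t fun s _ => cadlag n s) (fun j => hfin m j t fun s _ => cadlag m s)
    (fun s _ => hprod n s) (fun s _ => hprod m s)
    fun s hs => (hmass n s).trans ((progeny_mono n (Y n) ω hs).trans hn)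
  refine ⟨heq, ?_⟩
  rw [progeny_eq_truncEvents fun s _ => cadlag n s] at hn
  rw [progeny_eq_truncEvents fun s _ => cadlag m s, hevents]
  exact hn.trans hnm

end Consistency

section Global

variable {α : ℝ → ℝ} {p : ℝ → ℕ → ℝ} {Ω : Type*} {mΩ : MeasurableSpace Ω} {P : Measure Ω}
  [IsProbabilityMeasure P] {F : Filtration ℝ≥0 mΩ} {M : Ω → Measure NoisePoint} {G : Measure ℝ}
  [IsProbabilityMeasure G] {X₀ : Ω → LifeMeasure} {Y : ℕ → ℝ≥0 → Ω → LifeMeasure}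
  {X : ℝ≥0 → Ω → LifeMeasure}

theorem ae_truncated_solutions_eq_eventualLimit
    (hM : IsPoissonRandomMeasure P F (intensity G) M) (h : IsMeasurableMechanism α p)
    (hX₀ : Measurable[F 0] X₀) (hY : ∀ K : ℕ, IsTruncatedSolution P F α p M X₀ K (Y K)) :
    ∀ᵐ ω ∂P, ∀ t : ℝ≥0, ∃ n : ℕ, ∀ m ≥ n,
      (∀ s ≤ t, Y m s ω = eventualLimit fun K => Y K s ω) ∧
        progeny M X₀ α p m (Y m) t ω ≤ m := by
  filter_upwards [ae_truncated_solutions_consistent hM h hX₀ hY] with ω hω t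
  obtain ⟨n, hn⟩ := hω t
  refine ⟨n, fun m hm => ⟨fun s hs => ?_, (hn m hm).2⟩⟩
  exact ((hn m hm).1 s hs).trans (eventualLimit_eq
    (eventually_atTop.2 ⟨n, fun m hm => (hn m hm).1 s hs⟩)).symm

theorem ae_solvesAt_of_truncated_solutions (hM : IsPoissonRandomMeasure P F (intensity G) M)
    (h : IsMeasurableMechanism α p) (hY : ∀ K : ℕ, IsTruncatedSolution P F α p M X₀ K (Y K))
    (hX : ∀ᵐ ω ∂P, ∀ t : ℝ≥0, ∃ m : ℕ, (∀ s ≤ t, Y m s ω = X s ω) ∧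
      progeny M X₀ α p m (Y m) t ω ≤ m) :
    ∀ᵐ ω ∂P, ∀ t, CadlagAt (fun r => X r ω) t ∧
      SolvesAt α p (M ω) (X₀ ω) (fun r => X r ω) t ∧
      M ω (birthEvents α p (fun r => X r ω) t) < ⊤ := by
  filter_upwards [hX, ae_all_iff.2 fun K => (hY K).cadlag, ae_all_iff.2 fun K => (hY K).produces,
    ae_all_iff.2 fun K => (hY K).totalMass_le,
    ae_all_iff.2 fun K => hM.ae_truncEvents_lt_top h (hY K).adapted]
    with ω hX cadlag hprod hmass hfin t
  obtain ⟨m, heq, hprogeny⟩ := hX (t + 1)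
  have ht : t < t + 1 := lt_add_one t
  have hlevel : ∀ s < t, totalMass (Y m s ω) ≤ m := fun s hs =>
    (hmass m s).trans ((progeny_mono m (Y m) ω (hs.trans ht).le).trans hprogeny)
  have hevents : truncEvents α p m (fun r => Y m r ω) t = truncEvents α p ⊤ (fun r => X r ω) t := by
    rw [truncEvents_congr_level (fun s _ => cadlag m s) hlevel le_top]
    exact truncEvents_congr_path _ (fun s _ => cadlag m s) fun s hs => heq s (hs.trans ht).le
  refine ⟨(cadlag m t).congr ht heq, ?_, ?_⟩
  · have hprod := hprod m t
    rw [Produces, hevents, heq t ht.le] at hprod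
    exact solvesAt_iff_produces.2 hprod
  · rw [← truncEvents_top, ← hevents]
    exact hfin m m t fun s _ => cadlag m s

theorem lintegral_iSup_totalMass_le (hM : IsPoissonRandomMeasure P F (intensity G) M)
    (h : IsMeasurableMechanism α p) (hX₀ : Measurable X₀)
    (hY : ∀ K : ℕ, IsTruncatedSolution P F α p M X₀ K (Y K)) {t : ℝ≥0}
    (hX : ∀ᵐ ω ∂P, ∃ n : ℕ, ∀ m ≥ n, ∀ s ≤ t, Y m s ω = X s ω) :
    (∫⁻ ω, (⨆ s ∈ Iic t, totalMass (X s ω)) ∂P) ≤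
      (∫⁻ ω, totalMass (X₀ ω) ∂P) *
        ENNReal.ofReal (Real.exp ((growthRate α p).toReal * t)) := by
  calc (∫⁻ ω, (⨆ s ∈ Iic t, totalMass (X s ω)) ∂P)
      ≤ ∫⁻ ω, liminf (fun m : ℕ => progeny M X₀ α p m (Y m) t ω) atTop ∂P := by
        refine lintegral_mono_ae ?_
        filter_upwards [hX, ae_all_iff.2 fun K => (hY K).totalMass_le] with ω hX hmass
        obtain ⟨n, hn⟩ := hX
        refine le_liminf_of_le (h := ?_)
        filter_upwards [eventually_ge_atTop n] with m hm
        refine iSup₂_le fun s hs => ?_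
        rw [← hn m hm s hs]
        exact (hmass m s).trans (progeny_mono m (Y m) ω hs)
    _ ≤ liminf (fun m : ℕ => ∫⁻ ω, progeny M X₀ α p m (Y m) t ω ∂P) atTop :=
        lintegral_liminf_le' fun m => aemeasurable_progeny hM h hX₀ m (hY m).adapted t
    _ ≤ (∫⁻ ω, totalMass (X₀ ω) ∂P) *
          ENNReal.ofReal (Real.exp ((growthRate α p).toReal * t)) := by
        refine liminf_le_of_le (h := fun b hb => ?_)
        obtain ⟨m, hm⟩ := hb.exists
        have hle := (hY m).setLIntegral_progeny_le hM h hX₀ (@MeasurableSet.univ Ω (F 0)) t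
        simp only [Measure.restrict_univ] at hle
        exact hm.trans hle

theorem exists_global_solution (hM : IsPoissonRandomMeasure P F (intensity G) M)
    (hF : ∀ N : Set Ω, P N = 0 → MeasurableSet[F 0] N) (h : IsMeasurableMechanism α p)
    (hX₀ : Measurable[F 0] X₀) :
    ∃ X : ℝ≥0 → Ω → LifeMeasure, (∀ t, Measurable[F t] (X t)) ∧
      (∀ᵐ ω ∂P, ∀ t, CadlagAt (fun r => X r ω) t ∧
        SolvesAt α p (M ω) (X₀ ω) (fun r => X r ω) t ∧
        M ω (birthEvents α p (fun r => X r ω) t) < ⊤) ∧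
      ∀ t : ℝ≥0, (∫⁻ ω, (⨆ s ∈ Iic t, totalMass (X s ω)) ∂P) ≤
        (∫⁻ ω, totalMass (X₀ ω) ∂P) *
          ENNReal.ofReal (Real.exp ((growthRate α p).toReal * t)) := by
  choose Y hY using fun K => exists_isTruncatedSolution hM hF h hX₀ K
  have hlim := ae_truncated_solutions_eq_eventualLimit hM h hX₀ hY
  refine ⟨fun t ω => eventualLimit fun K => Y K t ω,
    fun t => @measurable_eventualLimit _ (F t) _ fun K => (hY K).adapted t,
    ae_solvesAt_of_truncated_solutions hM h hY ?_,
    fun t => lintegral_iSup_totalMass_le hM h (hX₀.mono (F.le 0) le_rfl) hY ?_⟩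
  · exact hlim.mono fun ω hω t => (hω t).imp fun n hn => hn n le_rfl
  · exact hlim.mono fun ω hω => (hω t).imp fun n hn m hm => (hn m hm).1

end Global

section DrivingFiltration

variable {Ω : Type*} {mΩ : MeasurableSpace Ω} {P : Measure Ω} {F : Filtration ℝ≥0 mΩ}
  {M : Ω → Measure NoisePoint} {X₀ : Ω → LifeMeasure} {Λ : Measure NoisePoint}

theorem noiseSigma_mono {I J : Set ℝ} (hIJ : I ⊆ J) : noiseSigma M I ≤ noiseSigma M J :=
  iSup₂_le fun B hB => le_iSup₂_of_le B ⟨hB.1, hB.2.trans (preimage_mono hIJ)⟩ le_rfl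

theorem drivingSigma_mono : Monotone (drivingSigma P M X₀) := fun _ _ hst =>
  sup_le_sup (sup_le_sup le_rfl (noiseSigma_mono (Iic_subset_Iic.2 (NNReal.coe_le_coe.2 hst))))
    le_rfl

theorem drivingSigma_le (hF : ∀ N : Set Ω, P N = 0 → MeasurableSet[F 0] N)
    (hM : IsPoissonRandomMeasure P F Λ M) (hX₀ : Measurable[F 0] X₀) (t : ℝ≥0) :
    drivingSigma P M X₀ t ≤ F t :=
  sup_le (sup_le (hX₀.comap_le.trans (F.mono zero_le)) (hM.adapted t))
    (MeasurableSpace.generateFrom_le fun N hN => F.mono zero_le _ (hF N hN))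

/-- The `P`-completed filtration generated by the initial value and the noise. -/
def drivingFiltration (hF : ∀ N : Set Ω, P N = 0 → MeasurableSet[F 0] N)
    (hM : IsPoissonRandomMeasure P F Λ M) (hX₀ : Measurable[F 0] X₀) : Filtration ℝ≥0 mΩ where
  seq := drivingSigma P M X₀
  mono' := drivingSigma_mono
  le' t := (drivingSigma_le hF hM hX₀ t).trans (F.le t)

variable (hF : ∀ N : Set Ω, P N = 0 → MeasurableSet[F 0] N)
  (hM : IsPoissonRandomMeasure P F Λ M) (hX₀ : Measurable[F 0] X₀)

theorem isPoissonRandomMeasure_drivingFiltration :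
    IsPoissonRandomMeasure P (drivingFiltration hF hM hX₀) Λ M where
  measurable := hM.measurable
  integer_valued := hM.integer_valued
  law := hM.law
  indep := hM.indep
  adapted _ := le_sup_of_le_left le_sup_right
  indep_past t := indep_of_indep_of_le_right (hM.indep_past t) (drivingSigma_le hF hM hX₀ t)

theorem measurableSet_drivingFiltration_of_null {N : Set Ω} (hN : P N = 0) :
    MeasurableSet[drivingFiltration hF hM hX₀ 0] N :=
  (le_sup_right : MeasurableSpace.generateFrom {N | P N = 0} ≤ drivingSigma P M X₀ 0) N
    (MeasurableSpace.measurableSet_generateFrom hN)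

theorem measurable_initial_drivingFiltration : Measurable[drivingFiltration hF hM hX₀ 0] X₀ :=
  (comap_measurable X₀).mono (le_sup_of_le_left le_sup_left) le_rfl

end DrivingFiltration

end AgeBranching

end

open AgeBranching in
theorem mainTheorem2_general {Ω : Type*} {mΩ : MeasurableSpace Ω} (P : Measure Ω)
    [IsProbabilityMeasure P] (F : Filtration ℝ≥0 mΩ)
    (hF : ∀ N : Set Ω, P N = 0 → MeasurableSet[F 0] N)
    (α : ℝ → ℝ) (p : ℝ → ℕ → ℝ) (hαp : IsMeasurableMechanism α p)
    (G : Measure ℝ) [IsProbabilityMeasure G]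
    (M : Ω → Measure NoisePoint) (hM : IsPoissonRandomMeasure P F (intensity G) M)
    (X₀ : Ω → LifeMeasure) (hX₀ : Measurable[F 0] X₀) :
    (∃ X : ℝ≥0 → Ω → LifeMeasure,
      IsStrongSolution P F α p M X₀ X (fun _ => ⊤) ∧
      (∀ᵐ ω ∂P, ∀ t : ℝ≥0, M ω (birthEvents α p (fun r => X r ω) t) < ⊤) ∧
      (∀ t : ℝ≥0, (∫⁻ ω, (⨆ s ∈ Iic t, totalMass (X s ω)) ∂P) ≤
        (∫⁻ ω, totalMass (X₀ ω) ∂P) *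
          ENNReal.ofReal (Real.exp ((growthRate α p).toReal * t)))) ∧
    (∀ (X Y : ℝ≥0 → Ω → LifeMeasure) (ζ η : Ω → WithTop ℝ≥0),
      IsSolution P F α p M X₀ X ζ → IsSolution P F α p M X₀ Y η →
      ∀ᵐ ω ∂P, ∀ t : ℝ≥0, (t : WithTop ℝ≥0) < ζ ω → (t : WithTop ℝ≥0) < η ω →
        X t ω = Y t ω) := by
  obtain ⟨X, adapted, hX, hmoment⟩ := exists_global_solution
    (isPoissonRandomMeasure_drivingFiltration hF hM hX₀)
    (fun _ => measurableSet_drivingFiltration_of_null hF hM hX₀) hαp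
    (measurable_initial_drivingFiltration hF hM hX₀)
  have hsolution : IsStrongSolution P F α p M X₀ X (fun _ => ⊤) :=
    { lifetime := fun _ => by simp
      adapted := fun t => (adapted t).mono (drivingSigma_le hF hM hX₀ t) le_rfl
      cadlag := hX.mono fun _ hω t _ => (hω t).1
      equation := hX.mono fun _ hω t _ => (hω t).2.1
      strong := adapted }
  exact ⟨⟨X, hsolution, hX.mono fun _ hω t => (hω t).2.2, hmoment⟩,
    fun _ _ _ _ => hM.pathwise_unique hαp⟩

open AgeBranching in
theorem mainTheorem2 {Ω : Type*} {mΩ : MeasurableSpace Ω} (P : Measure Ω) [IsProbabilityMeasure P]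
    (F : Filtration ℝ≥0 mΩ) (hF : UsualHypotheses P F)
    (α : ℝ → ℝ) (p : ℝ → ℕ → ℝ) (hαp : IsBranchingMechanism α p)
    (G : Measure ℝ) [IsProbabilityMeasure G] (hG : G (Iic 0) = 0)
    (M : Ω → Measure NoisePoint) (hM : IsPoissonRandomMeasure P F (intensity G) M)
    (X₀ : Ω → LifeMeasure) (hX₀ : Measurable[F 0] X₀) :
    -- there is a strong solution with infinite lifetime ...
    (∃ X : ℝ≥0 → Ω → LifeMeasure,
      IsStrongSolution P F α p M X₀ X (fun _ => ⊤) ∧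
      -- ... whose reproduction events do not accumulate in finite time ...
      (∀ᵐ ω ∂P, ∀ t : ℝ≥0, M ω (birthEvents α p (fun r => X r ω) t) < ⊤) ∧
      -- ... and which satisfies the first-moment bound
      (∀ t : ℝ≥0, (∫⁻ ω, (⨆ s ∈ Iic t, totalMass (X s ω)) ∂P) ≤
        (∫⁻ ω, totalMass (X₀ ω) ∂P) *
          ENNReal.ofReal (Real.exp ((growthRate α p).toReal * t)))) ∧
    -- any two solutions driven by the same noise coincide as long as both are alive
    (∀ (X Y : ℝ≥0 → Ω → LifeMeasure) (ζ η : Ω → WithTop ℝ≥0),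
      IsSolution P F α p M X₀ X ζ → IsSolution P F α p M X₀ Y η →
      ∀ᵐ ω ∂P, ∀ t : ℝ≥0, (t : WithTop ℝ≥0) < ζ ω → (t : WithTop ℝ≥0) < η ω →
        X t ω = Y t ω) :=
  mainTheorem2_general P F hF.complete α p hαp.isMeasurableMechanism G M hM X₀ hX₀
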